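/- **The theory.** $\mathbf{V\#L}$ is the two-sorted theory (sorts: numbers $x,y,\dots$ and strings $X,Y,\dots$, i.e. finite sets of numbers; vocabulary $0,1,+,\cdot,|\ |,=,\le,\in$) axiomatized by 2-BASIC, the $\Sigma^B_0$-comprehension scheme $\exists X\,(|X|\le y\wedge\forall z<y\,(X(z)\leftrightarrow\varphi(z)))$ ($\varphi$ in $\Sigma^B_0$, $X$ not free in $\varphi$), String Multiplication $\forall X,Y\,\exists Z\,(Z=X\cdot Y)$ for binary numbers, and Matrix Powering: for every square integer matrix $X$ and every number $n$ there is $Y=X^n$ (strings code binary integers and matrices of them; $Z=X\cdot Y$ is expressed by the array of partial sums, $Y=X^n$ by the array of powers $X^0,\dots,X^n$). Let $J=J_n$ be the $2n\times 2n$ block diagonal matrix with $n$ blocks $\begin{pmatrix}0&1\\-1&0\end{pmatrix}$. **PB algorithm.** Let $n\ge 1$ and let $A=\begin{pmatrix}0&a_{12}&R\\-a_{12}&0&-{}^tS\\-{}^tR&S&M\end{pmatrix}$ be a skew symmetric $2n\times 2n$ integer matrix. Its vector of Pfaffian coefficients $\vec q_A=(q_n,\dots,q_0)$ is ${}^t(1,a_{12})$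 if $n=1$, and $\vec q_A=P_A\,\vec q_M$ if $n>1$, where $P_A$ is the $(n+1)\times n$ lower triangular Toeplitz matrix with first column ${}^t(1,\ a_{12},\ RJS,\ RJ(MJ)S,\ \dots,\ RJ(MJ)^{n-2}S)$, with $J=J_{n-1}$. **Pairs algorithm.** Let $A=\begin{pmatrix}0&R\\-{}^tR&M\end{pmatrix}$, $B=\begin{pmatrix}0&-{}^tS\\S&N\end{pmatrix}$ be skew symmetric $N_0\times N_0$ integer matrices, $N_0\ge 1$, and $m=\lfloor N_0/2\rfloor$. The vector of P-coefficients $\vec q_{A,B}=(q_m,\dots,q_0)$ is $(1)$ if $N_0=1$; for $N_0>1$ it is $T_{A,B}\,\vec q_{M,N}$, where $T_{A,B}$ is the lower triangular Toeplitz matrix with first column ${}^t(1,\ -RS,\ -R(NM)S,\ \dots,\ -R(NM)^{m-1}S)$, of size $(m+1)\times m$ if $N_0$ is even and $(m+1)\times(m+1)$ if $N_0$ is odd. **Theorem.** $\mathbf{V\#L}$ proves: for every $n\ge 1$ and every skew symmetric $2n\times 2n$ integer matrix $A$, the vector $\vec q_A$ computed by the PB algorithm and the vector $\vec q_{A,J}$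 computed by the pairs algorithm for $A$ and $J=J_n$ both exist, and $$\vec q_A=\vec q_{A,J}.$$ -/

import Mathlib

/-! # Two-sorted bounded arithmetic, the theory V#L, and two Pfaffian algorithms in it -/

universe u v

namespace VSharp

/-! ## Two-sorted first-order logic over the vocabulary `0, 1, +, ·, | |, =, ≤, ∈`

There are number variables `x₀, x₁, …` and string variables `X₀, X₁, …` (finite sets of numbers);
both are represented by their index. -/

/-- Number terms. The only string terms are the string variables. -/
inductive NTerm : Type
  | var (x : ℕ) : NTerm
  | zero : NTerm
  | one : NTerm
  | add (s t : NTerm) : NTerm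
  | mul (s t : NTerm) : NTerm
  | len (X : ℕ) : NTerm

instance : Zero NTerm := ⟨NTerm.zero⟩
instance : One NTerm := ⟨NTerm.one⟩
instance : Add NTerm := ⟨NTerm.add⟩
instance : Mul NTerm := ⟨NTerm.mul⟩

/-- Formulas. The quantifiers `allNum x`, `exNum x` bind the number variable `x`, and
`allStr X`, `exStr X` bind the string variable `X`. `mem t X` is `X(t)`, that is `t ∈ X`. -/
inductive Formula : Type
  | numEq (s t : NTerm) : Formula
  | numLe (s t : NTerm) : Formula
  | strEq (X Y : ℕ) : Formula
  | mem (t : NTerm) (X : ℕ) : Formula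
  | neg (φ : Formula) : Formula
  | and (φ ψ : Formula) : Formula
  | or (φ ψ : Formula) : Formula
  | imp (φ ψ : Formula) : Formula
  | allNum (x : ℕ) (φ : Formula) : Formula
  | exNum (x : ℕ) (φ : Formula) : Formula
  | allStr (X : ℕ) (φ : Formula) : Formula
  | exStr (X : ℕ) (φ : Formula) : Formula

/-- The number variable `x` occurs in a term. -/
def NTerm.OccursNum (x : ℕ) : NTerm → Prop
  | .var y => y = x
  | .zero => False
  | .one => False
  | .add s t => s.OccursNum x ∨ t.OccursNum x
  | .mul s t => s.OccursNum x ∨ t.OccursNum x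
  | .len _ => False

/-- The string variable `X` occurs in a term. -/
def NTerm.OccursStr (X : ℕ) : NTerm → Prop
  | .var _ => False
  | .zero => False
  | .one => False
  | .add s t => s.OccursStr X ∨ t.OccursStr X
  | .mul s t => s.OccursStr X ∨ t.OccursStr X
  | .len Y => Y = X

/-- The string variable `X` occurs free in a formula. -/
def Formula.FreeStr (X : ℕ) : Formula → Prop
  | .numEq s t => s.OccursStr X ∨ t.OccursStr X
  | .numLe s t => s.OccursStr X ∨ t.OccursStr X
  | .strEq Y Z => Y = X ∨ Z = X
  | .mem t Y => t.OccursStr X ∨ Y = X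
  | .neg φ => φ.FreeStr X
  | .and φ ψ => φ.FreeStr X ∨ ψ.FreeStr X
  | .or φ ψ => φ.FreeStr X ∨ ψ.FreeStr X
  | .imp φ ψ => φ.FreeStr X ∨ ψ.FreeStr X
  | .allNum _ φ => φ.FreeStr X
  | .exNum _ φ => φ.FreeStr X
  | .allStr Y φ => Y ≠ X ∧ φ.FreeStr X
  | .exStr Y φ => Y ≠ X ∧ φ.FreeStr X

/-- `Σ₀ᴮ` formulas: no string quantifiers, and all number quantifiers are bounded,
`∀ x ≤ t` or `∃ x ≤ t` with a term `t` that does not contain `x`. -/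
inductive IsSigma0B : Formula → Prop
  | numEq (s t : NTerm) : IsSigma0B (.numEq s t)
  | numLe (s t : NTerm) : IsSigma0B (.numLe s t)
  | strEq (X Y : ℕ) : IsSigma0B (.strEq X Y)
  | mem (t : NTerm) (X : ℕ) : IsSigma0B (.mem t X)
  | neg {φ : Formula} : IsSigma0B φ → IsSigma0B (.neg φ)
  | and {φ ψ : Formula} : IsSigma0B φ → IsSigma0B ψ → IsSigma0B (.and φ ψ)
  | or {φ ψ : Formula} : IsSigma0B φ → IsSigma0B ψ → IsSigma0B (.or φ ψ)
  | imp {φ ψ : Formula} : IsSigma0B φ → IsSigma0B ψ → IsSigma0B (.imp φ ψ)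
  | allLe {φ : Formula} (x : ℕ) (t : NTerm) : ¬ t.OccursNum x → IsSigma0B φ →
      IsSigma0B (.allNum x (.imp (.numLe (.var x) t) φ))
  | exLe {φ : Formula} (x : ℕ) (t : NTerm) : ¬ t.OccursNum x → IsSigma0B φ →
      IsSigma0B (.exNum x (.and (.numLe (.var x) t) φ))

/-- Two-sorted structures for the vocabulary. Equality is interpreted as true equality. -/
structure Struc where
  Num : Type u
  Str : Type v
  nonempty_str : Nonempty Str
  zero : Num
  one : Num
  add : Num → Num → Num
  mul : Num → Num → Num
  le : Num → Num → Prop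
  len : Str → Num
  mem : Num → Str → Prop

/-- The value of a term under an assignment of the variables. -/
def NTerm.eval (M : Struc.{u, v}) (ν : ℕ → M.Num) (σ : ℕ → M.Str) : NTerm → M.Num
  | .var x => ν x
  | .zero => M.zero
  | .one => M.one
  | .add s t => M.add (s.eval M ν σ) (t.eval M ν σ)
  | .mul s t => M.mul (s.eval M ν σ) (t.eval M ν σ)
  | .len X => M.len (σ X)

/-- Satisfaction of a formula in a structure under an assignment. -/
def Sat (M : Struc.{u, v}) : (ℕ → M.Num) → (ℕ → M.Str) → Formula → Prop
  | ν, σ, .numEq s t => s.eval M ν σ = t.eval M ν σ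
  | ν, σ, .numLe s t => M.le (s.eval M ν σ) (t.eval M ν σ)
  | _, σ, .strEq X Y => σ X = σ Y
  | ν, σ, .mem t X => M.mem (t.eval M ν σ) (σ X)
  | ν, σ, .neg φ => ¬ Sat M ν σ φ
  | ν, σ, .and φ ψ => Sat M ν σ φ ∧ Sat M ν σ ψ
  | ν, σ, .or φ ψ => Sat M ν σ φ ∨ Sat M ν σ ψ
  | ν, σ, .imp φ ψ => Sat M ν σ φ → Sat M ν σ ψ
  | ν, σ, .allNum x φ => ∀ a : M.Num, Sat M (Function.update ν x a) σ φ
  | ν, σ, .exNum x φ => ∃ a : M.Num, Sat M (Function.update ν x a) σ φ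
  | ν, σ, .allStr X φ => ∀ a : M.Str, Sat M ν (Function.update σ X a) φ
  | ν, σ, .exStr X φ => ∃ a : M.Str, Sat M ν (Function.update σ X a) φ

/-- A structure is a model of a formula if it satisfies its universal closure. -/
def Struc.Models (M : Struc.{u, v}) (φ : Formula) : Prop :=
  ∀ (ν : ℕ → M.Num) (σ : ℕ → M.Str), Sat M ν σ φ

/-- `Proves T φ`: the formula `φ` is a theorem of the theory with axioms `T`. A theory is the set
of logical consequences of its axioms (equivalently, by the completeness theorem, of the formulas
derivable from them in any of the usual proof systems). -/
def Proves (T : Set Formula) (φ : Formula) : Prop :=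
  ∀ M : Struc.{u, v}, (∀ ψ ∈ T, M.Models ψ) → M.Models φ

/-! ## Building formulas with fresh bound variables

A builder produces a formula from the index of the next unused number variable and that of the
next unused string variable; a quantifier takes the next unused variable and passes it on. -/

/-- A formula, up to the choice of its bound variables. -/
abbrev Fm : Type := ℕ → ℕ → Formula

/-- The formula in which the bound variables are numbered from `0`. -/
def Fm.sentence (f : Fm) : Formula := f 0 0

def fEq (s t : NTerm) : Fm := fun _ _ => .numEq s t
def fLe (s t : NTerm) : Fm := fun _ _ => .numLe s t
def fStrEq (X Y : ℕ) : Fm := fun _ _ => .strEq X Y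
def fMem (t : NTerm) (X : ℕ) : Fm := fun _ _ => .mem t X
def fNot (f : Fm) : Fm := fun d e => .neg (f d e)
def fAnd (f g : Fm) : Fm := fun d e => .and (f d e) (g d e)
def fOr (f g : Fm) : Fm := fun d e => .or (f d e) (g d e)
def fImp (f g : Fm) : Fm := fun d e => .imp (f d e) (g d e)
def fAllN (f : NTerm → Fm) : Fm := fun d e => .allNum d (f (.var d) (d + 1) e)
def fExN (f : NTerm → Fm) : Fm := fun d e => .exNum d (f (.var d) (d + 1) e)
def fAllS (f : ℕ → Fm) : Fm := fun d e => .allStr e (f e d (e + 1))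
def fExS (f : ℕ → Fm) : Fm := fun d e => .exStr e (f e d (e + 1))

infixr:35 " ∧ᶠ " => fAnd
infixr:30 " ∨ᶠ " => fOr
infixr:25 " →ᶠ " => fImp

def fIff (f g : Fm) : Fm := (f →ᶠ g) ∧ᶠ (g →ᶠ f)

infix:20 " ↔ᶠ " => fIff

def fLt (s t : NTerm) : Fm := fLe s t ∧ᶠ fNot (fEq s t)

/-- `∀ i < t`, for a term `t` built before `i`. -/
def fAllLt (t : NTerm) (f : NTerm → Fm) : Fm := fAllN fun i => fLt i t →ᶠ f i

/-- `∃ i < t`, for a term `t` built before `i`. -/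
def fExLt (t : NTerm) (f : NTerm → Fm) : Fm := fExN fun i => fLt i t ∧ᶠ f i

/-- The term `2t`. -/
def dbl (t : NTerm) : NTerm := (1 + 1) * t

/-! ## The axioms `2-BASIC` and `Σ₀ᴮ-COMP` -/

/-- The axioms `B1`–`B12`, `L1`, `L2`, `SE`. -/
def twoBasic : Set Formula :=
  { (fAllN fun x => fNot (fEq (x + 1) 0)).sentence,
    (fAllN fun x => fAllN fun y => fEq (x + 1) (y + 1) →ᶠ fEq x y).sentence,
    (fAllN fun x => fEq (x + 0) x).sentence,
    (fAllN fun x => fAllN fun y => fEq (x + (y + 1)) ((x + y) + 1)).sentence,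
    (fAllN fun x => fEq (x * 0) 0).sentence,
    (fAllN fun x => fAllN fun y => fEq (x * (y + 1)) (x * y + x)).sentence,
    (fAllN fun x => fAllN fun y => fLe x y ∧ᶠ fLe y x →ᶠ fEq x y).sentence,
    (fAllN fun x => fAllN fun y => fLe x (x + y)).sentence,
    (fAllN fun x => fLe 0 x).sentence,
    (fAllN fun x => fAllN fun y => fLe x y ∨ᶠ fLe y x).sentence,
    (fAllN fun x => fAllN fun y => fLe x y ↔ᶠ fLt x (y + 1)).sentence,
    (fAllN fun x => fNot (fEq x 0) →ᶠ fExN fun y => fLe y x ∧ᶠ fEq (y + 1) x).sentence,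
    (fAllS fun X => fAllN fun y => fMem y X →ᶠ fLt y (.len X)).sentence,
    (fAllS fun X => fAllN fun y => fEq (y + 1) (.len X) →ᶠ fMem y X).sentence,
    (fAllS fun X => fAllS fun Y =>
      (fEq (.len X) (.len Y) ∧ᶠ fAllLt (.len X) fun i => fMem i X ↔ᶠ fMem i Y) →ᶠ
        fStrEq X Y).sentence }

/-- `∃ X (|X| ≤ y ∧ ∀ z < y (X(z) ↔ φ))`. -/
def compFormula (φ : Formula) (z y X : ℕ) : Formula :=
  .exStr X (.and (.numLe (.len X) (.var y))
    (.allNum z (.imp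
      (.and (.numLe (.var z) (.var y)) (.neg (.numEq (.var z) (.var y))))
      (.and (.imp (.mem (.var z) X) φ) (.imp φ (.mem (.var z) X))))))

/-- The comprehension scheme for `Σ₀ᴮ` formulas `φ`, in which `X` is not free. -/
def sigma0BComp : Set Formula :=
  {ψ | ∃ (φ : Formula) (z y X : ℕ),
    IsSigma0B φ ∧ y ≠ z ∧ ¬ φ.FreeStr X ∧ ψ = compFormula φ z y X}

/-! ## Arrays, binary natural numbers and integers -/

/-- The pairing term `⟨s, t⟩ = (s + t)(s + t + 1) + 2t`. -/
def pr (s t : NTerm) : NTerm := (s + t) * (s + t + 1) + dbl t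

/-- `V` is row `i` of the array `X`: `V(j) ↔ X(⟨i, j⟩)`. -/
def isRow (i : NTerm) (X V : ℕ) : Fm :=
  fAllLt (.len X + .len V) fun j => fMem j V ↔ᶠ fMem (pr i j) X

/-- `V` is the entry `(i, j)` of the matrix `X`. -/
def isEntry (X : ℕ) (i j : NTerm) (V : ℕ) : Fm := isRow (pr i j) X V

/-- A carry reaches bit `i` in the binary addition `X + Y`. -/
def carry (X Y : ℕ) (i : NTerm) : Fm :=
  fExLt i fun k => (fMem k X ∧ᶠ fMem k Y) ∧ᶠ
    fAllLt i fun j => fLt k j →ᶠ (fMem j X ∨ᶠ fMem j Y)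

/-- `Z = X + Y` for binary numbers `∑_{i ∈ X} 2^i`: bit `i` of `Z` is the exclusive or of bit `i` of
`X`, bit `i` of `Y` and the carry. -/
def isAdd (X Y Z : ℕ) : Fm :=
  fAllLt (.len X + .len Y + .len Z) fun i =>
    fMem i Z ↔ᶠ ((fMem i X ↔ᶠ fMem i Y) ↔ᶠ carry X Y i)

/-- `S = 2^i · X`. -/
def isShift (X : ℕ) (i : NTerm) (S : ℕ) : Fm :=
  fAllLt (.len X + i + .len S) fun j =>
    fMem j S ↔ᶠ fExLt (.len X) fun k => fEq j (i + k) ∧ᶠ fMem k X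

/-- `Z = X · Y` for binary numbers, by the array `W` of the partial sums of
`∑_{i ∈ Y} 2^i · X`. -/
def isMul (X Y Z : ℕ) : Fm :=
  fExS fun W =>
    (fExS fun U => isRow 0 W U ∧ᶠ fEq (.len U) 0) ∧ᶠ
    (fAllLt (.len Y) fun i => fExS fun U => fExS fun V =>
      isRow i W U ∧ᶠ isRow (i + 1) W V ∧ᶠ
        ((fMem i Y ∧ᶠ fExS fun S => isShift X i S ∧ᶠ isAdd U S V) ∨ᶠ
          (fNot (fMem i Y) ∧ᶠ fStrEq U V))) ∧ᶠ
    isRow (.len Y) W Z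

/-- Integers are coded by sign (bit `0`, set for negative) and magnitude (the bits `1, 2, …`).
The only set that is not a code is `{0}`, which would be `-0`; so integers have unique codes. -/
def isInt (X : ℕ) : Fm := fNot (fEq (.len X) 1)

/-- `U` is the magnitude of the integer `X`. -/
def isMag (X U : ℕ) : Fm :=
  fAllLt (.len X + .len U) fun i => fMem i U ↔ᶠ fMem (i + 1) X

/-- `U` is the positive part of the integer `X`. -/
def isPos (X U : ℕ) : Fm :=
  (fNot (fMem 0 X) ∧ᶠ isMag X U) ∨ᶠ (fMem 0 X ∧ᶠ fEq (.len U) 0)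

/-- `U` is the negative part of the integer `X`. -/
def isNeg (X U : ℕ) : Fm :=
  (fMem 0 X ∧ᶠ isMag X U) ∨ᶠ (fNot (fMem 0 X) ∧ᶠ fEq (.len U) 0)

/-- The integer `0`. -/
def isIntZero (X : ℕ) : Fm := fEq (.len X) 0

/-- The integer `1`. -/
def isIntOne (X : ℕ) : Fm := fAllN fun i => fMem i X ↔ᶠ fEq i 1

/-- `Z = X + Y` for integers, as `X⁺ + Y⁺ + Z⁻ = X⁻ + Y⁻ + Z⁺`. -/
def isIntAdd (X Y Z : ℕ) : Fm :=
  (isInt X ∧ᶠ isInt Y ∧ᶠ isInt Z) ∧ᶠ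
  fExS fun Xp => fExS fun Xn => fExS fun Yp => fExS fun Yn => fExS fun Zp => fExS fun Zn =>
    (isPos X Xp ∧ᶠ isNeg X Xn ∧ᶠ isPos Y Yp ∧ᶠ isNeg Y Yn ∧ᶠ isPos Z Zp ∧ᶠ isNeg Z Zn) ∧ᶠ
    fExS fun P => fExS fun N => fExS fun T =>
      isAdd Xp Yp P ∧ᶠ isAdd Xn Yn N ∧ᶠ isAdd P Zn T ∧ᶠ isAdd N Zp T

/-- `Z = X · Y` for integers: the magnitudes are multiplied, and if the product is not `0`, it is
negative exactly if the signs differ. -/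
def isIntMul (X Y Z : ℕ) : Fm :=
  (isInt X ∧ᶠ isInt Y ∧ᶠ isInt Z) ∧ᶠ
  (fExS fun U => fExS fun V => fExS fun W =>
    isMag X U ∧ᶠ isMag Y V ∧ᶠ isMag Z W ∧ᶠ isMul U V W) ∧ᶠ
  (isIntZero Z ∨ᶠ (fMem 0 Z ↔ᶠ fNot (fMem 0 X ↔ᶠ fMem 0 Y)))

/-- `Z = -X` for integers. -/
def isIntOpp (X Z : ℕ) : Fm := fExS fun O => isIntZero O ∧ᶠ isIntAdd X Z O

/-! ## Integer matrices

An `a × b` matrix is an array with entries at the indices `⟨i, j⟩`, `i < a`, `j < b`; what the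
string holds at other positions is ignored. Vectors are matrices with one row or one column. -/

/-- `X` is an `a × b` matrix of integers. -/
def isMatrix (a b : NTerm) (X : ℕ) : Fm :=
  fAllLt a fun i => fAllLt b fun j => fExS fun V => isEntry X i j V ∧ᶠ isInt V

/-- `Z = X · Y` for an `a × b` matrix `X` and a `b × c` matrix `Y`; the array `W` holds the partial
sums `W_{i,j,k} = ∑_{l < k} X_{i,l} Y_{l,j}`. -/
def isMatMul (a b c : NTerm) (X Y Z : ℕ) : Fm :=
  fExS fun W => fAllLt a fun i => fAllLt c fun j =>
    (fExS fun O => isRow (pr (pr i j) 0) W O ∧ᶠ isIntZero O) ∧ᶠ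
    (fAllLt b fun k =>
      fExS fun x => fExS fun y => fExS fun p => fExS fun w => fExS fun w' =>
        isEntry X i k x ∧ᶠ isEntry Y k j y ∧ᶠ isIntMul x y p ∧ᶠ
        isRow (pr (pr i j) k) W w ∧ᶠ isRow (pr (pr i j) (k + 1)) W w' ∧ᶠ isIntAdd w p w') ∧ᶠ
    (fExS fun z => isEntry Z i j z ∧ᶠ isRow (pr (pr i j) b) W z)

/-- `X` is the `m × m` identity matrix. -/
def isIdentity (m : NTerm) (X : ℕ) : Fm :=
  fAllLt m fun i => fAllLt m fun j => fExS fun V => isEntry X i j V ∧ᶠ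
    ((fEq i j ∧ᶠ isIntOne V) ∨ᶠ (fNot (fEq i j) ∧ᶠ isIntZero V))

/-- `Y = X^n` for an `m × m` matrix `X`; the array `P` holds the powers `X^0, …, X^n`. -/
def isMatPow (m : NTerm) (X : ℕ) (n : NTerm) (Y : ℕ) : Fm :=
  fExS fun P =>
    (fExS fun I => isRow 0 P I ∧ᶠ isIdentity m I) ∧ᶠ
    (fAllLt n fun t => fExS fun U => fExS fun V =>
      isRow t P U ∧ᶠ isRow (t + 1) P V ∧ᶠ isMatMul m m m U X V) ∧ᶠ
    isRow n P Y

/-! ## The theory V#L -/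

/-- String Multiplication: `∀ X, Y ∃ Z (Z = X · Y)`. -/
def stringMultiplication : Formula :=
  (fAllS fun X => fAllS fun Y => fExS fun Z => isMul X Y Z).sentence

/-- Matrix Powering: every power of a square matrix of integers exists. -/
def matrixPowering : Formula :=
  (fAllN fun m => fAllS fun X => isMatrix m m X →ᶠ
    fAllN fun n => fExS fun Y => isMatPow m X n Y).sentence

/-- The axioms of `V#L`. -/
def VSharpL : Set Formula :=
  twoBasic ∪ sigma0BComp ∪ {stringMultiplication, matrixPowering}

/-! ## Pfaffian coefficients

Indices start at `0`. A vector of coefficients `(q_m, q_{m-1}, …, q_0)` is a column; so its entry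
`(i, 0)` is `q_{m-i}`. -/

/-- `A` is a skew symmetric `s × s` matrix of integers. -/
def isSkew (s : NTerm) (A : ℕ) : Fm :=
  isMatrix s s A ∧ᶠ fAllLt s fun i => fAllLt s fun j => fExS fun x => fExS fun y =>
    isEntry A i j x ∧ᶠ isEntry A j i y ∧ᶠ isIntOpp x y

/-- `J` is the `2n × 2n` block diagonal matrix with `n` diagonal blocks `(0, 1; -1, 0)`. -/
def isJ (n : NTerm) (J : ℕ) : Fm :=
  fAllLt (dbl n) fun i => fAllLt (dbl n) fun j => fExS fun V => isEntry J i j V ∧ᶠ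
    ((fExLt n fun k => fEq i (dbl k) ∧ᶠ fEq j (dbl k + 1) ∧ᶠ isIntOne V) ∨ᶠ
     (fExLt n fun k => fEq i (dbl k + 1) ∧ᶠ fEq j (dbl k) ∧ᶠ
        fExS fun O => isIntOne O ∧ᶠ isIntOpp O V) ∨ᶠ
     ((fNot (fExLt n fun k => (fEq i (dbl k) ∧ᶠ fEq j (dbl k + 1)) ∨ᶠ
        (fEq i (dbl k + 1) ∧ᶠ fEq j (dbl k)))) ∧ᶠ isIntZero V))

/-- `B` is the `a × b` block of `A` whose upper left corner is at position `(i₀, j₀)` of `A`. -/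
def isBlock (i₀ j₀ a b : NTerm) (A B : ℕ) : Fm :=
  fAllLt a fun i => fAllLt b fun j => fExS fun V =>
    isEntry A (i₀ + i) (j₀ + j) V ∧ᶠ isEntry B i j V

/-- The integer `c` is `R (X^k) S` for a row `R` of length `s`, an `s × s` matrix `X` and a column
`S` of length `s`. -/
def isRowPowCol (s : NTerm) (R X : ℕ) (k : NTerm) (S c : ℕ) : Fm :=
  fExS fun Y => fExS fun U => fExS fun C =>
    isMatPow s X k Y ∧ᶠ isMatMul 1 s s R Y U ∧ᶠ isMatMul 1 s 1 U S C ∧ᶠ isEntry C 0 0 c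

/-- `P` is the `(r+2) × (r+1)` matrix `P_A` of the PB algorithm for a `2(r+1) × 2(r+1)` matrix
`A = (0, a₁₂, R; -a₁₂, 0, -Sᵗ; -Rᵗ, S, M)`: it is `0` above the diagonal and `1` on the diagonal, it
is `a₁₂` at the positions `(j+1, j)` and `RJ(MJ)^k S` at the positions `(j+2+k, j)`. -/
def isPBMatrix (r : NTerm) (A P : ℕ) : Fm :=
  fExS fun R => fExS fun S => fExS fun M => fExS fun J => fExS fun RJ => fExS fun MJ =>
    (isBlock 0 (1 + 1) 1 (dbl r) A R ∧ᶠ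
      isBlock (1 + 1) 1 (dbl r) 1 A S ∧ᶠ
      isBlock (1 + 1) (1 + 1) (dbl r) (dbl r) A M ∧ᶠ
      isJ r J ∧ᶠ
      isMatMul 1 (dbl r) (dbl r) R J RJ ∧ᶠ
      isMatMul (dbl r) (dbl r) (dbl r) M J MJ) ∧ᶠ
    fAllLt (r + 1 + 1) fun i => fAllLt (r + 1) fun j => fExS fun V => isEntry P i j V ∧ᶠ
      ((fLt i j ∧ᶠ isIntZero V) ∨ᶠ
       (fEq i j ∧ᶠ isIntOne V) ∨ᶠ
       (fEq i (j + 1) ∧ᶠ isEntry A 0 1 V) ∨ᶠ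
       (fExN fun k => fEq i (j + 1 + 1 + k) ∧ᶠ isRowPowCol (dbl r) RJ MJ k S V))

/-- PB algorithm: `Q` is the vector `(p_n, …, p_0)` of Pfaffian coefficients of the `2n × 2n` matrix
`A`, `n ≥ 1`. Row `r` of the array `F` is the vector of coefficients of the lower right
`2r × 2r` block of `A`, for `1 ≤ r ≤ n`: it is `(1, a₁₂)` if `r = 1`, and the vector for `r + 1` is
`P_B` times the vector for `r`, where `B` is the lower right `2(r+1) × 2(r+1)` block. -/
def isPBCoeffs (n : NTerm) (A Q : ℕ) : Fm :=
  fExS fun F =>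
    (fAllN fun t => fEq (t + 1) n →ᶠ
      fExS fun f => fExS fun x => fExS fun y =>
        isRow 1 F f ∧ᶠ isEntry f 0 0 x ∧ᶠ isIntOne x ∧ᶠ
        isEntry f 1 0 y ∧ᶠ isEntry A (dbl t) (dbl t + 1) y) ∧ᶠ
    (fAllN fun r => fAllN fun t => (fLe 1 r ∧ᶠ fEq (t + (r + 1)) n) →ᶠ
      fExS fun B => fExS fun P => fExS fun f => fExS fun g =>
        isBlock (dbl t) (dbl t) (dbl (r + 1)) (dbl (r + 1)) A B ∧ᶠ
        isPBMatrix r B P ∧ᶠ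
        isRow r F f ∧ᶠ isRow (r + 1) F g ∧ᶠ
        isMatMul (r + 1 + 1) (r + 1) 1 P f g) ∧ᶠ
    isRow n F Q

/-- `T` is the `(m+1) × l` matrix of the pairs algorithm for two `(s+1) × (s+1)` matrices
`A = (0, R; -Rᵗ, M)` and `B = (0, -Sᵗ; S, N)`: it is `0` above the diagonal and `1` on the diagonal,
and it is `-R(NM)^k S` at the positions `(j+1+k, j)`. -/
def isPairsMatrix (s m l : NTerm) (A B T : ℕ) : Fm :=
  fExS fun R => fExS fun S => fExS fun M => fExS fun N => fExS fun NM =>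
    (isBlock 0 1 1 s A R ∧ᶠ
      isBlock 1 0 s 1 B S ∧ᶠ
      isBlock 1 1 s s A M ∧ᶠ
      isBlock 1 1 s s B N ∧ᶠ
      isMatMul s s s N M NM) ∧ᶠ
    fAllLt (m + 1) fun i => fAllLt l fun j => fExS fun V => isEntry T i j V ∧ᶠ
      ((fLt i j ∧ᶠ isIntZero V) ∨ᶠ
       (fEq i j ∧ᶠ isIntOne V) ∨ᶠ
       (fExN fun k => fEq i (j + 1 + k) ∧ᶠ
          fExS fun c => isRowPowCol s R NM k S c ∧ᶠ isIntOpp c V))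

/-- Pairs algorithm: `Q` is the vector `(q_m, …, q_0)`, `m = ⌊n/2⌋`, of P-coefficients of the pair
`A, B` of `n × n` matrices, `n ≥ 1`. Row `s` of the array `G` is the vector of P-coefficients of the
lower right `s × s` blocks, for `1 ≤ s ≤ n`: it is `(1)` if `s = 1`, and the vector for `s + 1` is
the `(m+1) × l` matrix of the two lower right `(s+1) × (s+1)` blocks times the vector for `s`,
where `m = ⌊(s+1)/2⌋`, and `l = m` or `l = m + 1` according as `s + 1` is even or odd. -/
def isPairsCoeffs (n : NTerm) (A B Q : ℕ) : Fm :=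
  fExS fun G =>
    (fExS fun f => fExS fun x => isRow 1 G f ∧ᶠ isEntry f 0 0 x ∧ᶠ isIntOne x) ∧ᶠ
    (fAllN fun s => fAllN fun t => (fLe 1 s ∧ᶠ fEq (t + (s + 1)) n) →ᶠ
      fExN fun m => fExN fun l =>
        ((fEq (s + 1) (dbl m) ∧ᶠ fEq l m) ∨ᶠ (fEq (s + 1) (dbl m + 1) ∧ᶠ fEq l (m + 1))) ∧ᶠ
        fExS fun A' => fExS fun B' => fExS fun T => fExS fun f => fExS fun g =>
          isBlock t t (s + 1) (s + 1) A A' ∧ᶠ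
          isBlock t t (s + 1) (s + 1) B B' ∧ᶠ
          isPairsMatrix s m l A' B' T ∧ᶠ
          isRow s G f ∧ᶠ isRow (s + 1) G g ∧ᶠ
          isMatMul (m + 1) l 1 T f g) ∧ᶠ
    isRow n G Q

/-- The columns `Q` and `Q'` of length `m` are equal. -/
def isEqualColumn (m : NTerm) (Q Q' : ℕ) : Fm :=
  fAllLt m fun i => fExS fun V => isEntry Q i 0 V ∧ᶠ isEntry Q' i 0 V

end VSharp

open VSharp

/-! A formula is a theorem of V#L exactly if it holds in all models of the axioms, so one model `M`
is fixed and the two algorithms are studied inside it.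

The algebraic core is this. Let A = (0, a, R; -a, 0, -ᵗS; -ᵗR, S, M) have size 2(r+1). The pairs
algorithm for A and J removes one row and one column at a time. At this even size it meets the row
(a, R), the matrix M' = (0, -ᵗS; S, M), the column ᵗ(-1, 0, …, 0) and the matrix N' = diag(0, J_r).
Since the first row and the first column of N' vanish, (a, R)(N'M')^(k+1) = RJ(MJ)^k (S | M), and
minus its product with the column is RJ(MJ)^k S. Likewise minus the product of (a, R) and the column
is a. So the Toeplitz matrix of the pairs algorithm is the matrix P_A of the PB algorithm
(`IsPBColumn.pairsMatrix_iff`). At odd size the first column of the remaining block of J is zero, so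
the Toeplitz matrix is the identity (`pairsMatrix_one_iff`). Hence odd steps change nothing, even
steps are PB steps, and both algorithms run through one table u_0 = (1), u_(r+1) = P u_r
(`IsCoeffTable`): the pairs algorithm has the vector u_⌊s/2⌋ at size s.

The rest is to do this with the means of V#L, where induction and comprehension are available only
for predicates whose bounded parts are strings. Such predicates, and functions with values in
numbers, strings or integers that have such a description, are called coded. Closure of codedness
under Boolean operations, bounded quantifiers, substitution, arithmetic and sums is arranged as type
class instances, so that most side conditions are found by instance search.

2-BASIC and `Coded.induction` make the numbers an ordered semiring, and carry arguments make the
strings, as binary numbers, a cancellative commutative monoid. String Multiplication gives single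
products, but commutativity and associativity are proved by induction along the bits of a factor and
need whole coded families of products. These are entries of the square of a sparse matrix, so Matrix
Powering supplies them (`exists_products`). The integers are then the ring of differences
`DiffRing`.

Matrix Powering is used in the same spirit twice more: families of sums are entries of a matrix
square (`exists_isPsum`), and a linear recursion with a different matrix at each step is read off
from the powers of one layered matrix (`exists_linear_recursion`). The latter yields the vectors
RJ(MJ)^k for all blocks at once and then the table itself (`exists_coeffTable`). Existence of both
vectors follows from the table, and their equality from induction showing that every computation
agrees with it. -/

namespace VSharp

/-- A structure that satisfies the axioms of `V#L`. -/
class IsModel (M : Struc.{u, v}) : Prop where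
  models : ∀ ψ ∈ VSharpL, M.Models ψ

variable {M : Struc.{u, v}}

instance : Zero M.Num := ⟨M.zero⟩
instance : One M.Num := ⟨M.one⟩
instance : Add M.Num := ⟨M.add⟩
instance : Mul M.Num := ⟨M.mul⟩
instance : LE M.Num := ⟨M.le⟩
instance : LT M.Num := ⟨fun x y => x ≤ y ∧ x ≠ y⟩
instance : Nonempty M.Str := M.nonempty_str

/-! ### Satisfaction of the formula builders. -/

section Semantics

variable (ν : ℕ → M.Num) (σ : ℕ → M.Str) (s t : NTerm) (f g : Fm) (d e X Y x : ℕ)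

theorem eval_var : (NTerm.var x).eval M ν σ = ν x := rfl
theorem eval_zero : (0 : NTerm).eval M ν σ = 0 := rfl
theorem eval_one : (1 : NTerm).eval M ν σ = 1 := rfl
theorem eval_add : (s + t).eval M ν σ = s.eval M ν σ + t.eval M ν σ := rfl
theorem eval_mul : (s * t).eval M ν σ = s.eval M ν σ * t.eval M ν σ := rfl
theorem eval_len : (NTerm.len X).eval M ν σ = M.len (σ X) := rfl

theorem sat_fEq : Sat M ν σ (fEq s t d e) ↔ s.eval M ν σ = t.eval M ν σ := Iff.rfl
theorem sat_fLe : Sat M ν σ (fLe s t d e) ↔ s.eval M ν σ ≤ t.eval M ν σ := Iff.rfl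
theorem sat_fLt : Sat M ν σ (fLt s t d e) ↔ s.eval M ν σ < t.eval M ν σ := Iff.rfl
theorem sat_fStrEq : Sat M ν σ (fStrEq X Y d e) ↔ σ X = σ Y := Iff.rfl
theorem sat_fMem : Sat M ν σ (fMem t X d e) ↔ M.mem (t.eval M ν σ) (σ X) := Iff.rfl
theorem sat_fNot : Sat M ν σ (fNot f d e) ↔ ¬ Sat M ν σ (f d e) := Iff.rfl
theorem sat_fAnd : Sat M ν σ ((f ∧ᶠ g) d e) ↔ Sat M ν σ (f d e) ∧ Sat M ν σ (g d e) := Iff.rfl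
theorem sat_fOr : Sat M ν σ ((f ∨ᶠ g) d e) ↔ Sat M ν σ (f d e) ∨ Sat M ν σ (g d e) := Iff.rfl
theorem sat_fImp : Sat M ν σ ((f →ᶠ g) d e) ↔ (Sat M ν σ (f d e) → Sat M ν σ (g d e)) := Iff.rfl
theorem sat_fIff : Sat M ν σ ((f ↔ᶠ g) d e) ↔ (Sat M ν σ (f d e) ↔ Sat M ν σ (g d e)) :=
  iff_iff_implies_and_implies.symm

variable (F : NTerm → Fm) (G : ℕ → Fm)

theorem sat_fAllN : Sat M ν σ (fAllN F d e) ↔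
    ∀ a : M.Num, Sat M (Function.update ν d a) σ (F (.var d) (d + 1) e) := Iff.rfl
theorem sat_fExN : Sat M ν σ (fExN F d e) ↔
    ∃ a : M.Num, Sat M (Function.update ν d a) σ (F (.var d) (d + 1) e) := Iff.rfl
theorem sat_fAllS : Sat M ν σ (fAllS G d e) ↔
    ∀ a : M.Str, Sat M ν (Function.update σ e a) (G e d (e + 1)) := Iff.rfl
theorem sat_fExS : Sat M ν σ (fExS G d e) ↔
    ∃ a : M.Str, Sat M ν (Function.update σ e a) (G e d (e + 1)) := Iff.rfl

end Semantics

variable [IsModel M]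

theorem sat_twoBasic {φ : Formula} (h : φ ∈ twoBasic) (ν : ℕ → M.Num) (σ : ℕ → M.Str) :
    Sat M ν σ φ :=
  IsModel.models φ (Or.inl (Or.inl h)) ν σ

variable (M) in
/-- An arbitrary assignment of the string variables. -/
noncomputable def anyStr : ℕ → M.Str := fun _ => Classical.arbitrary _

variable (x y z : M.Num) (X Y : M.Str)

/-! ### The axioms 2-BASIC in a model. -/

namespace Ax

theorem succ_ne_zero : x + 1 ≠ 0 := by
  have h := sat_twoBasic (M := M) (Or.inl rfl) (fun _ => 0) (anyStr M) x
  exact h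
theorem succ_inj (h : x + 1 = y + 1) : x = y :=
  sat_twoBasic (M := M) (Or.inr (Or.inl rfl)) (fun _ => 0) (anyStr M) x y h
theorem add_zero : x + 0 = x :=
  sat_twoBasic (M := M) (Or.inr (Or.inr (Or.inl rfl))) (fun _ => 0) (anyStr M) x
theorem add_succ : x + (y + 1) = x + y + 1 :=
  sat_twoBasic (M := M) (Or.inr (Or.inr (Or.inr (Or.inl rfl)))) (fun _ => 0) (anyStr M) x y
theorem mul_zero : x * 0 = 0 :=
  sat_twoBasic (M := M) (Or.inr (Or.inr (Or.inr (Or.inr (Or.inl rfl))))) (fun _ => 0) (anyStr M) x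
theorem mul_succ : x * (y + 1) = x * y + x :=
  sat_twoBasic (M := M) (Or.inr (Or.inr (Or.inr (Or.inr (Or.inr (Or.inl rfl))))))
    (fun _ => 0) (anyStr M) x y
theorem le_antisymm (h : x ≤ y) (h' : y ≤ x) : x = y :=
  sat_twoBasic (M := M) (Or.inr (Or.inr (Or.inr (Or.inr (Or.inr (Or.inr (Or.inl rfl)))))))
    (fun _ => 0) (anyStr M) x y ⟨h, h'⟩
theorem le_add : x ≤ x + y :=
  sat_twoBasic (M := M) (Or.inr (Or.inr (Or.inr (Or.inr (Or.inr (Or.inr (Or.inr (Or.inl rfl))))))))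
    (fun _ => 0) (anyStr M) x y
theorem zero_le : 0 ≤ x :=
  sat_twoBasic (M := M)
    (Or.inr (Or.inr (Or.inr (Or.inr (Or.inr (Or.inr (Or.inr (Or.inr (Or.inl rfl)))))))))
    (fun _ => 0) (anyStr M) x
theorem le_total : x ≤ y ∨ y ≤ x :=
  sat_twoBasic (M := M)
    (Or.inr (Or.inr (Or.inr (Or.inr (Or.inr (Or.inr (Or.inr (Or.inr (Or.inr (Or.inl rfl))))))))))
    (fun _ => 0) (anyStr M) x y
theorem le_iff_lt_succ : x ≤ y ↔ x < y + 1 :=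
  iff_iff_implies_and_implies.2 <| sat_twoBasic (M := M)
    (Or.inr (Or.inr (Or.inr (Or.inr (Or.inr (Or.inr (Or.inr (Or.inr (Or.inr (Or.inr
      (Or.inl rfl))))))))))) (fun _ => 0) (anyStr M) x y
theorem exists_pred (h : x ≠ 0) : ∃ y : M.Num, y ≤ x ∧ y + 1 = x :=
  sat_twoBasic (M := M)
    (Or.inr (Or.inr (Or.inr (Or.inr (Or.inr (Or.inr (Or.inr (Or.inr (Or.inr (Or.inr (Or.inr
      (Or.inl rfl)))))))))))) (fun _ => 0) (anyStr M) x h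
theorem lt_len (h : M.mem y X) : y < M.len X :=
  sat_twoBasic (M := M)
    (Or.inr (Or.inr (Or.inr (Or.inr (Or.inr (Or.inr (Or.inr (Or.inr (Or.inr (Or.inr (Or.inr (Or.inr
      (Or.inl rfl))))))))))))) (fun _ => 0) (anyStr M) X y h
theorem mem_of_len (h : y + 1 = M.len X) : M.mem y X :=
  sat_twoBasic (M := M)
    (Or.inr (Or.inr (Or.inr (Or.inr (Or.inr (Or.inr (Or.inr (Or.inr (Or.inr (Or.inr (Or.inr (Or.inr
      (Or.inr (Or.inl rfl)))))))))))))) (fun _ => 0) (anyStr M) X y h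
theorem ext_of_len (h : M.len X = M.len Y) (h' : ∀ i, i < M.len X → (M.mem i X ↔ M.mem i Y)) :
    X = Y :=
  sat_twoBasic (M := M)
    (Or.inr (Or.inr (Or.inr (Or.inr (Or.inr (Or.inr (Or.inr (Or.inr (Or.inr (Or.inr (Or.inr (Or.inr
      (Or.inr (Or.inr rfl)))))))))))))) (fun _ => 0) (anyStr M) X Y
      ⟨h, fun i hi => iff_iff_implies_and_implies.1 (h' i hi)⟩

end Ax

/-! ### Coded predicates and induction. -/

/-- A predicate on the numbers of a model is *coded* if every bounded part of it is a string. -/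
class Coded (P : M.Num → Prop) : Prop where
  exists_str : ∀ b, ∃ X : M.Str, ∀ z, z < b → (M.mem z X ↔ P z)

/-- The variables are fixed once for all uses: number variable 0 is the element, number variable 1
the bound, and string variable 0 the new set. Number parameters therefore start at 2, and string
parameters avoid 0. -/
theorem exists_comp (φ : Formula) (hφ : IsSigma0B φ) (hX : ¬ φ.FreeStr 0) (ν : ℕ → M.Num)
    (σ : ℕ → M.Str) (b : M.Num) : ∃ S : M.Str, M.len S ≤ b ∧ ∀ z, z < b →
      (M.mem z S ↔ Sat M (Function.update (Function.update ν 1 b) 0 z)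
        (Function.update σ 0 S) φ) := by
  obtain ⟨S, h1, h2⟩ := IsModel.models (M := M) (compFormula φ 0 1 0)
    (Or.inl (Or.inr ⟨φ, 0, 1, 0, hφ, by decide, hX, rfl⟩)) (Function.update ν 1 b) σ
  refine ⟨S, ?_, fun z hz => ?_⟩
  · have : M.le (M.len S) b := by simpa [Sat, NTerm.eval] using h1
    exact this
  · have := h2 z
    simp only [Sat, NTerm.eval, Function.update_self, ne_eq, one_ne_zero, not_false_eq_true,
      Function.update_of_ne] at this
    exact iff_iff_implies_and_implies.2 (this hz)

/-- The assignment of `a, b, c, d` to the variables `2, 3, 4, 5`. -/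
def asg {α : Type*} (a b c d : α) : ℕ → α
  | 2 => a
  | 3 => b
  | 4 => c
  | _ => d

theorem coded_of_sat (φ : Formula) (hφ : IsSigma0B φ) (hX : ¬ φ.FreeStr 0) (ν : ℕ → M.Num)
    (σ : ℕ → M.Str) {P : M.Num → Prop} (h : ∀ b z S, Sat M (Function.update (Function.update ν 1 b)
      0 z) (Function.update σ 0 S) φ ↔ P z) : Coded P := by
  refine ⟨fun b => ?_⟩
  obtain ⟨S, -, hS⟩ := exists_comp φ hφ hX ν σ b
  exact ⟨S, fun z hz => (hS z hz).trans (h b z S)⟩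

/-- If `P a` fails, comprehension gives the set `Y` of those `z ≤ a` up to which `P` holds
throughout. It contains `0`, so its length is some `y + 1`, and `y` is its largest element. As `y ≠
a`, the induction step puts `y + 1` into `Y`, against the length. No order theory is available yet,
so the inequalities are derived from the axioms. -/
theorem Coded.induction {P : M.Num → Prop} (hP : Coded P) (h0 : P 0)
    (hs : ∀ x, P x → P (x + 1)) (a : M.Num) : P a := by
  by_contra ha
  obtain ⟨X, hX⟩ := hP.exists_str (a + 1)
  obtain ⟨Y, hYl, hY⟩ := exists_comp (M := M)
    (.allNum 2 (.imp (.numLe (.var 2) (.var 0)) (.mem (.var 2) 1)))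
    (.allLe _ _ (by simp [NTerm.OccursNum]) (.mem _ _)) (by simp [Formula.FreeStr, NTerm.OccursStr])
    (fun _ => 0) (fun _ => X) (a + 1)
  simp only [Sat, NTerm.eval, Function.update_self, ne_eq, OfNat.zero_ne_ofNat, not_false_eq_true,
    Function.update_of_ne, one_ne_zero] at hY
  change ∀ z, _ → (_ ↔ ∀ i : M.Num, i ≤ z → M.mem i X) at hY
  have h0a : (0 : M.Num) < a + 1 := (Ax.le_iff_lt_succ _ _).1 (Ax.zero_le a)
  have h0Y : M.mem 0 Y := by
    rw [hY 0 h0a]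
    intro i hi
    obtain rfl := Ax.le_antisymm _ _ hi (Ax.zero_le i)
    exact (hX _ h0a).2 h0
  have hl : M.len Y ≠ 0 := by
    intro h
    have := Ax.lt_len _ _ h0Y
    rw [h] at this
    exact this.2 rfl
  obtain ⟨y, -, hy⟩ := Ax.exists_pred _ hl
  have hyY := Ax.mem_of_len _ _ hy
  have hya : y ≤ a := (Ax.le_iff_lt_succ _ _).2 (by
    have := Ax.lt_len _ _ hyY
    rw [← hy] at this
    rcases Ax.le_total y a with h | h
    · exact (Ax.le_iff_lt_succ _ _).1 h
    · rcases eq_or_ne a y with rfl | h'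
      · exact (Ax.le_iff_lt_succ _ _).1 h
      · rw [← hy] at hYl
        have h2 : a < y + 1 := (Ax.le_iff_lt_succ _ _).1 h
        have h3 : y + 1 = a + 1 ∨ y + 1 < a + 1 := by
          by_cases h : y + 1 = a + 1
          · exact Or.inl h
          · exact Or.inr ⟨hYl, h⟩
        rcases h3 with h3 | h3
        · exact absurd (Ax.succ_inj _ _ h3).symm h'
        · exact absurd (Ax.le_antisymm _ _ ((Ax.le_iff_lt_succ _ _).2 h3) h2.1).symm h2.2)
  have hya1 := (Ax.le_iff_lt_succ _ _).1 hya
  have hall := (hY y hya1).1 hyY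
  have hle : y ≤ y := (Ax.le_total y y).elim id id
  have hPy : P y := (hX y hya1).1 (hall y hle)
  have hne : y ≠ a := fun h => ha (h ▸ hPy)
  have hy1 : y + 1 ≤ a := by
    rcases Ax.le_total (y + 1) a with h | h
    · exact h
    · by_cases h' : a = y + 1
      · rw [h']; exact (Ax.le_total _ _).elim id id
      · exact absurd (Ax.le_antisymm _ _ hya ((Ax.le_iff_lt_succ _ _).2 ⟨h, h'⟩)) hne
  have hy1a := (Ax.le_iff_lt_succ _ _).1 hy1
  have : M.mem (y + 1) Y := by
    rw [hY _ hy1a]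
    intro i hi
    by_cases h : i = y + 1
    · rw [h]
      exact (hX _ hy1a).2 (hs _ hPy)
    · exact hall i ((Ax.le_iff_lt_succ _ _).2 ⟨hi, h⟩)
  have := Ax.lt_len _ _ this
  rw [hy] at this
  exact this.2 rfl

/-- Induction on the truth of an equation between terms in the number variable `0`; the number
variable `1` must not occur. -/
theorem induction_eq (s t : NTerm) (ν : ℕ → M.Num) {p q : M.Num → M.Num}
    (hs : ∀ b z S, s.eval M (Function.update (Function.update ν 1 b) 0 z) (Function.update (anyStr M)
      0 S) = p z)
    (ht : ∀ b z S, t.eval M (Function.update (Function.update ν 1 b) 0 z) (Function.update (anyStr M)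
      0 S) = q z)
    (hX : ¬ (s.OccursStr 0 ∨ t.OccursStr 0))
    (h0 : p 0 = q 0) (h : ∀ x, p x = q x → p (x + 1) = q (x + 1)) (a : M.Num) : p a = q a := by
  refine Coded.induction (P := fun a => p a = q a) ?_ h0 h a
  refine coded_of_sat (.numEq s t) (.numEq _ _) hX ν (anyStr M) fun b z S => ?_
  simp only [Sat, hs, ht]

/-! ### The numbers as an ordered semiring. -/

namespace Ax

theorem add_assoc : x + y + z = x + (y + z) :=
  induction_eq (.add (.add (.var 2) (.var 3)) (.var 0)) (.add (.var 2) (.add (.var 3) (.var 0)))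
    (asg x y 0 0) (p := fun z => x + y + z) (q := fun z => x + (y + z))
    (fun _ _ _ => rfl) (fun _ _ _ => rfl) (by simp [NTerm.OccursStr])
    (by simp only [add_zero]) (fun z h => by simp only [add_succ, h]) z

theorem zero_add : 0 + x = x :=
  induction_eq (.add .zero (.var 0)) (.var 0) (asg 0 0 0 0) (p := fun x => 0 + x) (q := fun x => x)
    (fun _ _ _ => rfl) (fun _ _ _ => rfl) (by simp [NTerm.OccursStr])
    (add_zero _) (fun z h => by simp only [add_succ, h]) x

theorem succ_add : x + 1 + y = x + y + 1 :=
  induction_eq (.add (.add (.var 2) .one) (.var 0)) (.add (.add (.var 2) (.var 0)) .one)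
    (asg x 0 0 0) (p := fun y => x + 1 + y) (q := fun y => x + y + 1)
    (fun _ _ _ => rfl) (fun _ _ _ => rfl) (by simp [NTerm.OccursStr])
    (by simp only [add_zero]) (fun z h => by simp only [add_succ, h]) y

theorem add_comm : x + y = y + x :=
  induction_eq (.add (.var 2) (.var 0)) (.add (.var 0) (.var 2))
    (asg x 0 0 0) (p := fun y => x + y) (q := fun y => y + x)
    (fun _ _ _ => rfl) (fun _ _ _ => rfl) (by simp [NTerm.OccursStr])
    (by simp only [add_zero, zero_add]) (fun z h => by simp only [add_succ, succ_add, h]) y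

theorem zero_mul : 0 * x = 0 :=
  induction_eq (.mul .zero (.var 0)) .zero (asg 0 0 0 0) (p := fun x => 0 * x) (q := fun _ => 0)
    (fun _ _ _ => rfl) (fun _ _ _ => rfl) (by simp [NTerm.OccursStr])
    (mul_zero _) (fun z h => by simp only [mul_succ, h, add_zero]) x

theorem succ_mul : (x + 1) * y = x * y + y :=
  induction_eq (.mul (.add (.var 2) .one) (.var 0)) (.add (.mul (.var 2) (.var 0)) (.var 0))
    (asg x 0 0 0) (p := fun y => (x + 1) * y) (q := fun y => x * y + y)
    (fun _ _ _ => rfl) (fun _ _ _ => rfl) (by simp [NTerm.OccursStr])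
    (by simp only [mul_zero, add_zero])
    (fun z h => by
      rw [mul_succ, mul_succ, h, add_assoc, add_assoc, add_succ z, add_succ x, add_comm z x]) y

theorem mul_comm : x * y = y * x :=
  induction_eq (.mul (.var 2) (.var 0)) (.mul (.var 0) (.var 2))
    (asg x 0 0 0) (p := fun y => x * y) (q := fun y => y * x)
    (fun _ _ _ => rfl) (fun _ _ _ => rfl) (by simp [NTerm.OccursStr])
    (by simp only [mul_zero, zero_mul]) (fun z h => by simp only [mul_succ, succ_mul, h]) y

theorem mul_add : x * (y + z) = x * y + x * z :=
  induction_eq (.mul (.var 2) (.add (.var 3) (.var 0)))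
    (.add (.mul (.var 2) (.var 3)) (.mul (.var 2) (.var 0)))
    (asg x y 0 0) (p := fun z => x * (y + z)) (q := fun z => x * y + x * z)
    (fun _ _ _ => rfl) (fun _ _ _ => rfl) (by simp [NTerm.OccursStr])
    (by simp only [add_zero, mul_zero])
    (fun z h => by rw [add_succ, mul_succ, mul_succ, h, add_assoc]) z

theorem mul_assoc : x * y * z = x * (y * z) :=
  induction_eq (.mul (.mul (.var 2) (.var 3)) (.var 0)) (.mul (.var 2) (.mul (.var 3) (.var 0)))
    (asg x y 0 0) (p := fun z => x * y * z) (q := fun z => x * (y * z))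
    (fun _ _ _ => rfl) (fun _ _ _ => rfl) (by simp [NTerm.OccursStr])
    (by simp only [mul_zero]) (fun z h => by rw [mul_succ, mul_succ, h, mul_add]) z

theorem mul_one : x * 1 = x := by
  rw [← zero_add (1 : M.Num), mul_succ, mul_zero, zero_add]

theorem add_right_cancel (h : x + z = y + z) : x = y := by
  revert h
  refine Coded.induction (P := fun z => x + z = y + z → x = y) ?_ ?_ ?_ z
  · exact coded_of_sat (.imp (.numEq (.add (.var 2) (.var 0)) (.add (.var 3) (.var 0)))
      (.numEq (.var 2) (.var 3))) (.imp (.numEq _ _) (.numEq _ _))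
      (by simp [Formula.FreeStr, NTerm.OccursStr]) (asg x y 0 0) (anyStr M) fun _ _ _ => Iff.rfl
  · simp only [add_zero, imp_self]
  · intro z h h'
    rw [add_succ, add_succ] at h'
    exact h (succ_inj _ _ h')

theorem exists_add_of_le (h : x ≤ y) : ∃ c, y = x + c := by
  suffices h : ∃ c, c ≤ y ∧ (y = x + c ∨ x = y + c) by
    obtain ⟨c, -, h | h'⟩ := h
    · exact ⟨c, h⟩
    · refine ⟨0, ?_⟩
      rw [add_zero]
      exact le_antisymm _ _ (h' ▸ le_add y c) h
  -- Induction needs a bounded quantifier. The difference is taken in whichever direction it exists,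
  -- and `x + y` bounds it in both.
  have hgen : ∀ y : M.Num, ∃ c, c ≤ x + y ∧ (y = x + c ∨ x = y + c) := by
    intro y
    refine Coded.induction (P := fun y => ∃ c, c ≤ x + y ∧ (y = x + c ∨ x = y + c)) ?_ ?_ ?_ y
    · exact coded_of_sat (.exNum 4 (.and (.numLe (.var 4) (.add (.var 2) (.var 0)))
        (.or (.numEq (.var 0) (.add (.var 2) (.var 4))) (.numEq (.var 2) (.add (.var 0) (.var 4))))))
        (.exLe _ _ (by simp [NTerm.OccursNum]) (.or (.numEq _ _) (.numEq _ _)))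
        (by simp [Formula.FreeStr, NTerm.OccursStr]) (asg x 0 0 0) (anyStr M) fun _ _ _ => Iff.rfl
    · exact ⟨x, le_add _ _, Or.inr (zero_add x).symm⟩
    · rintro y ⟨c, hc, rfl | h⟩
      · refine ⟨c + 1, ?_, Or.inl (add_succ _ _).symm⟩
        rw [add_assoc x c 1, add_comm x (c + 1), add_comm x (c + 1 + x), add_assoc]
        exact le_add _ _
      · by_cases hc0 : c = 0
        · subst hc0
          refine ⟨1, ?_, Or.inl ?_⟩
          · rw [← add_assoc, add_comm]; exact le_add _ _
          · rw [h, add_zero]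
        · obtain ⟨c, -, rfl⟩ := exists_pred _ hc0
          refine ⟨c, ?_, Or.inr ?_⟩
          · rw [h, add_comm y, add_assoc, add_assoc]; exact le_add _ _
          · rw [h, succ_add, add_succ]
  obtain ⟨c, -, hc⟩ := hgen y
  rcases hc with rfl | h'
  · exact ⟨c, by rw [add_comm]; exact le_add _ _, Or.inl rfl⟩
  · refine ⟨0, zero_le _, Or.inl ?_⟩
    rw [add_zero]
    exact le_antisymm _ _ (h' ▸ le_add y c) h

end Ax

instance : CommSemiring M.Num where
  add_assoc := Ax.add_assoc
  zero_add := Ax.zero_add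
  add_zero := Ax.add_zero
  add_comm := Ax.add_comm
  nsmul := nsmulRec
  mul_assoc := Ax.mul_assoc
  one_mul x := (Ax.mul_comm _ _).trans (Ax.mul_one x)
  mul_one := Ax.mul_one
  mul_comm := Ax.mul_comm
  left_distrib := Ax.mul_add
  right_distrib x y z := by rw [Ax.mul_comm, Ax.mul_add, Ax.mul_comm z, Ax.mul_comm z]
  zero_mul := Ax.zero_mul
  mul_zero := Ax.mul_zero

instance : IsCancelAdd M.Num where
  add_right_cancel z x y h := Ax.add_right_cancel x y z h
  add_left_cancel z x y h := Ax.add_right_cancel x y z (by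
    simpa only [add_comm _ z] using h)

theorem Num.le_iff {x y : M.Num} : x ≤ y ↔ ∃ c, y = x + c :=
  ⟨Ax.exists_add_of_le x y, fun ⟨c, h⟩ => h ▸ Ax.le_add x c⟩

noncomputable instance : LinearOrder M.Num where
  le_refl x := (Ax.le_total x x).elim id id
  le_trans x y z h h' := by
    obtain ⟨c, rfl⟩ := Num.le_iff.1 h
    obtain ⟨d, rfl⟩ := Num.le_iff.1 h'
    exact Num.le_iff.2 ⟨c + d, add_assoc _ _ _⟩
  le_antisymm := Ax.le_antisymm
  le_total := Ax.le_total
  lt_iff_le_not_ge x y := ⟨fun h => ⟨h.1, fun h' => h.2 (Ax.le_antisymm _ _ h.1 h')⟩,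
    fun h => ⟨h.1, fun h' => h.2 (h' ▸ h.1)⟩⟩
  toDecidableLE := Classical.decRel _

instance : IsOrderedAddMonoid M.Num where
  add_le_add_left x y h z := by
    obtain ⟨c, rfl⟩ := Num.le_iff.1 h
    exact Num.le_iff.2 ⟨c, by rw [add_right_comm]⟩

instance : CanonicallyOrderedAdd M.Num where
  exists_add_of_le h := Num.le_iff.1 h
  le_add_self _ y := Num.le_iff.2 ⟨y, add_comm _ _⟩
  le_self_add _ y := Num.le_iff.2 ⟨y, rfl⟩

instance : Nontrivial M.Num := ⟨1, 0, fun h => Ax.succ_ne_zero (0 : M.Num) (by rw [zero_add, h])⟩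

theorem Num.lt_add_one_iff {x y : M.Num} : x < y + 1 ↔ x ≤ y := (Ax.le_iff_lt_succ x y).symm

theorem Num.add_one_le_iff {x y : M.Num} : x + 1 ≤ y ↔ x < y := by
  constructor
  · exact fun h => lt_of_lt_of_le (Num.lt_add_one_iff.2 le_rfl) h
  · intro h
    by_contra h'
    exact absurd (Num.lt_add_one_iff.1 (not_le.1 h')) (not_le.2 h)

theorem Num.mul_lt_mul {a b c : M.Num} (hc : 0 < c) (h : a < b) : a * c < b * c := by
  obtain ⟨c, rfl⟩ := Num.le_iff.1 (Num.add_one_le_iff.2 hc)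
  obtain ⟨d, rfl⟩ := Num.le_iff.1 (Num.add_one_le_iff.2 h)
  refine lt_of_lt_of_le (Num.lt_add_one_iff.2 le_rfl) (Num.le_iff.2 ⟨c + d + d * c, ?_⟩)
  ring

instance : IsStrictOrderedRing M.Num where
  zero_le_one := Ax.zero_le _
  add_le_add_left _ _ h c := by gcongr
  le_of_add_le_add_left a b c h := by
    obtain ⟨d, h⟩ := Num.le_iff.1 h
    rw [add_assoc] at h
    exact Num.le_iff.2 ⟨d, add_left_cancel h⟩
  mul_lt_mul_of_pos_left c hc a b h := by
    simpa only [mul_comm c] using Num.mul_lt_mul hc h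
  mul_lt_mul_of_pos_right c hc a b h := Num.mul_lt_mul hc h

end VSharp

/-! ### Pairing, and coded functions on the numbers. -/

namespace VSharp

variable {M : Struc.{u, v}}

/-- The pairing function. -/
def pair (x y : M.Num) : M.Num := (x + y) * (x + y + 1) + (1 + 1) * y

theorem eval_pr (ν : ℕ → M.Num) (σ : ℕ → M.Str) (s t : NTerm) :
    (pr s t).eval M ν σ = pair (s.eval M ν σ) (t.eval M ν σ) := rfl

/-- Below a given bound each coded predicate is a single string and each coded function has a string
as its graph. So a closure property needs only one fixed formula with these strings as parameters.
-/
theorem Coded.of_local {P : M.Num → Prop} (h : ∀ b, ∃ Q, Coded Q ∧ ∀ z, z < b → (P z ↔ Q z)) :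
    Coded P := by
  refine ⟨fun b => ?_⟩
  obtain ⟨Q, hQ, h⟩ := h b
  obtain ⟨X, hX⟩ := hQ.exists_str b
  exact ⟨X, fun z hz => (hX z hz).trans (h z hz).symm⟩

theorem Coded.congr {P Q : M.Num → Prop} (hP : Coded P) (h : ∀ z, P z ↔ Q z) : Coded Q :=
  (funext fun z => propext (h z) : P = Q) ▸ hP

variable [IsModel M]

theorem eval_dbl (ν : ℕ → M.Num) (σ : ℕ → M.Str) (t : NTerm) :
    (dbl t).eval M ν σ = t.eval M ν σ + t.eval M ν σ := by
  change (1 + 1 : M.Num) * t.eval M ν σ = _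
  rw [add_mul, one_mul]

theorem str_ext {X Y : M.Str} (h : ∀ i, M.mem i X ↔ M.mem i Y) : X = Y := by
  have key : ∀ {X Y : M.Str}, (∀ i, M.mem i X ↔ M.mem i Y) → M.len X ≤ M.len Y := by
    intro X Y h
    by_cases h0 : M.len X = 0
    · rw [h0]; exact zero_le
    · obtain ⟨y, -, hy⟩ := Ax.exists_pred _ h0
      rw [← hy, Num.add_one_le_iff]
      exact Ax.lt_len _ _ ((h y).1 (Ax.mem_of_len _ _ hy))
  exact Ax.ext_of_len _ _ (le_antisymm (key h) (key fun i => (h i).symm)) fun i _ => h i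

theorem len_le_iff {X : M.Str} {b : M.Num} : M.len X ≤ b ↔ ∀ i, M.mem i X → i < b := by
  refine ⟨fun h i hi => (Ax.lt_len _ _ hi).trans_le h, fun h => ?_⟩
  by_cases h0 : M.len X = 0
  · rw [h0]; exact zero_le
  · obtain ⟨y, -, hy⟩ := Ax.exists_pred _ h0
    rw [← hy, Num.add_one_le_iff]
    exact h _ (Ax.mem_of_len _ _ hy)

theorem len_eq_zero_iff {X : M.Str} : M.len X = 0 ↔ ∀ i, ¬ M.mem i X := by
  rw [← nonpos_iff_eq_zero, len_le_iff]
  simp only [not_lt_zero, imp_false]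

/-- The pairs with sum `s` get the values `s(s+1) + 2y`, `y ≤ s`, all below `(s+1)(s+2)`, where the
next diagonal begins. -/
theorem pair_lt_of_add_lt {x y x' y' : M.Num} (h : x + y < x' + y') : pair x y < pair x' y' := by
  obtain ⟨c, hc⟩ := Num.le_iff.1 (Num.add_one_le_iff.2 h)
  unfold pair
  rw [hc]
  refine Num.add_one_le_iff.1 (Num.le_iff.2 ⟨x + x + 1 + c * (x + y + x + y + c + 1 + 1 + 1)
    + (1 + 1) * y', ?_⟩)
  ring

theorem pair_lt_pair_iff {x y x' y' : M.Num} :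
    pair x y < pair x' y' ↔ x + y < x' + y' ∨ x + y = x' + y' ∧ y < y' := by
  rcases lt_trichotomy (x + y) (x' + y') with h | h | h
  · simp [pair_lt_of_add_lt h, h]
  · simp only [pair, h, lt_self_iff_false, true_and, false_or, add_lt_add_iff_left]
    exact mul_lt_mul_iff_right₀ (by positivity)
  · simp only [(pair_lt_of_add_lt h).not_gt, h.not_gt, h.ne', false_and, or_self]

theorem pair_inj {x y x' y' : M.Num} : pair x y = pair x' y' ↔ x = x' ∧ y = y' := by
  refine ⟨fun h => ?_, fun ⟨h, h'⟩ => h ▸ h' ▸ rfl⟩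
  have h1 := mt pair_lt_pair_iff.2 h.not_lt
  have h2 := mt pair_lt_pair_iff.2 h.symm.not_lt
  grind

theorem le_pair_left (x y : M.Num) : x ≤ pair x y := by
  refine Num.le_iff.2 ⟨x * x + (1 + 1) * x * y + y * y + y + (1 + 1) * y, ?_⟩
  unfold pair; ring

theorem le_pair_right (x y : M.Num) : y ≤ pair x y := by
  refine Num.le_iff.2 ⟨x * x + (1 + 1) * x * y + y * y + x + (1 + 1) * y, ?_⟩
  unfold pair; ring

theorem pair_lt_pair {x y b c : M.Num} (hx : x < b) (hy : y < c) : pair x y < pair b c :=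
  pair_lt_of_add_lt (add_lt_add hx hy)

open Classical in
/-- The first component of a pair, and `0` for a number that is not a pair. -/
noncomputable def fst (z : M.Num) : M.Num := if h : ∃ x y, z = pair x y then h.choose else 0

open Classical in
/-- The second component of a pair, and `0` for a number that is not a pair. -/
noncomputable def snd (z : M.Num) : M.Num :=
  if h : ∃ x y, z = pair x y then h.choose_spec.choose else 0

theorem fst_pair (x y : M.Num) : fst (pair x y) = x := by
  have h : ∃ x' y', pair x y = pair x' y' := ⟨x, y, rfl⟩
  rw [fst, dif_pos h]
  exact (pair_inj.1 h.choose_spec.choose_spec).1.symm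

theorem snd_pair (x y : M.Num) : snd (pair x y) = y := by
  have h : ∃ x' y', pair x y = pair x' y' := ⟨x, y, rfl⟩
  rw [snd, dif_pos h]
  exact (pair_inj.1 h.choose_spec.choose_spec).2.symm

theorem fst_le (z : M.Num) : fst z ≤ z := by
  by_cases h : ∃ x y, z = pair x y
  · obtain ⟨x, y, rfl⟩ := h
    rw [fst_pair]; exact le_pair_left _ _
  · rw [fst, dif_neg h]; exact zero_le

theorem snd_le (z : M.Num) : snd z ≤ z := by
  by_cases h : ∃ x y, z = pair x y
  · obtain ⟨x, y, rfl⟩ := h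
    rw [snd_pair]; exact le_pair_right _ _
  · rw [snd, dif_neg h]; exact zero_le

/-- A function on the numbers is *coded* if every bounded part of it is bounded, with a coded
graph. -/
class CodedNum (t : M.Num → M.Num) : Prop where
  bdd : ∀ b, ∃ c, ∀ x, x < b → t x < c
  graph : ∀ b c, ∃ T : M.Str, ∀ x, x < b → ∀ y, y < c → (M.mem (pair x y) T ↔ y = t x)

theorem CodedNum.exists_str (t : M.Num → M.Num) [CodedNum t] (b : M.Num) : ∃ (c : M.Num) (T : M.Str),
    (∀ x, x < b → t x ≤ c) ∧ ∀ x, x < b → ∀ y, y ≤ c → (M.mem (pair x y) T ↔ y = t x) := by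
  obtain ⟨c, hc⟩ := CodedNum.bdd (t := t) b
  obtain ⟨T, hT⟩ := CodedNum.graph (t := t) b (c + 1)
  exact ⟨c, T, fun x hx => (hc x hx).le, fun x hx y hy => hT x hx y (Num.lt_add_one_iff.2 hy)⟩

/-- Components of a pair are recovered by bounded quantifiers here, because `fst` and `snd` are not
yet known to be coded. -/
theorem CodedNum.of_local {t : M.Num → M.Num} (hb : ∀ b, ∃ c, ∀ x, x < b → t x < c)
    (h : ∀ b c, ∃ Q : M.Num → M.Num → Prop, (∀ x, x < b → ∀ y, y < c → (Q x y ↔ y = t x)) ∧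
      Coded fun w => ∃ x ≤ b, ∃ y ≤ c, w = pair x y ∧ Q x y) : CodedNum t := by
  refine ⟨hb, fun b c => ?_⟩
  obtain ⟨Q, hQ, hc⟩ := h b c
  obtain ⟨T, hT⟩ := hc.exists_str (pair b c)
  refine ⟨T, fun x hx y hy => ?_⟩
  rw [hT _ (pair_lt_pair hx hy), ← hQ x hx y hy]
  constructor
  · rintro ⟨x', -, y', -, h, h'⟩
    obtain ⟨rfl, rfl⟩ := pair_inj.1 h
    exact h'
  · exact fun h => ⟨x, hx.le, y, hy.le, rfl, h⟩

/-! ### Closure properties of coded predicates and functions. -/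

section Closure

variable {P Q : M.Num → Prop} {s t : M.Num → M.Num}

instance coded_mem (X : M.Str) : Coded fun z => M.mem z X := ⟨fun _ => ⟨X, fun _ _ => Iff.rfl⟩⟩

instance Coded.not [hP : Coded P] : Coded fun z => ¬ P z := by
  refine .of_local fun b => ?_
  obtain ⟨X, hX⟩ := hP.exists_str b
  exact ⟨fun z => ¬ M.mem z X, coded_of_sat (.neg (.mem (.var 0) 2)) (.neg (.mem _ _))
    (by simp [Formula.FreeStr, NTerm.OccursStr]) (fun _ => 0) (asg X X X X) fun _ _ _ => Iff.rfl,
    fun z hz => not_congr (hX z hz).symm⟩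

instance Coded.and [hP : Coded P] [hQ : Coded Q] : Coded fun z => P z ∧ Q z := by
  refine .of_local fun b => ?_
  obtain ⟨X, hX⟩ := hP.exists_str b
  obtain ⟨Y, hY⟩ := hQ.exists_str b
  exact ⟨fun z => M.mem z X ∧ M.mem z Y, coded_of_sat (.and (.mem (.var 0) 2) (.mem (.var 0) 3))
    (.and (.mem _ _) (.mem _ _))
    (by simp [Formula.FreeStr, NTerm.OccursStr]) (fun _ => 0) (asg X Y X X) fun _ _ _ => Iff.rfl,
    fun z hz => and_congr (hX z hz).symm (hY z hz).symm⟩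

instance Coded.or [Coded P] [Coded Q] : Coded fun z => P z ∨ Q z :=
  (inferInstance : Coded fun z => ¬ (¬ P z ∧ ¬ Q z)).congr fun _ => by tauto

instance Coded.imp [Coded P] [Coded Q] : Coded fun z => P z → Q z :=
  (inferInstance : Coded fun z => ¬ (P z ∧ ¬ Q z)).congr fun _ => by tauto

instance Coded.iff [Coded P] [Coded Q] : Coded fun z => P z ↔ Q z :=
  (inferInstance : Coded fun z => (P z → Q z) ∧ (Q z → P z)).congr fun _ => by tauto

instance Coded.const (p : Prop) : Coded fun _ : M.Num => p := by
  have : Coded fun _ : M.Num => True :=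
    coded_of_sat (.numEq .zero .zero) (.numEq _ _) (by simp [Formula.FreeStr, NTerm.OccursStr])
      (fun _ => 0) (anyStr M) fun _ _ _ => ⟨fun _ => trivial, fun _ => rfl⟩
  by_cases h : p
  · simpa only [h] using this
  · simpa only [h, not_true] using this.not

instance CodedNum.le [CodedNum s] [CodedNum t] : Coded fun z => s z ≤ t z := by
  refine .of_local fun b => ?_
  obtain ⟨c, S, hc, hS⟩ := CodedNum.exists_str s b
  obtain ⟨d, T, hd, hT⟩ := CodedNum.exists_str t b
  refine ⟨fun z => ∃ x ≤ c, M.mem (pair z x) S ∧ ∃ y ≤ d, M.mem (pair z y) T ∧ x ≤ y,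
    coded_of_sat (.exNum 6 (.and (.numLe (.var 6) (.var 2)) (.and (.mem (pr (.var 0) (.var 6)) 2)
      (.exNum 7 (.and (.numLe (.var 7) (.var 3)) (.and (.mem (pr (.var 0) (.var 7)) 3)
      (.numLe (.var 6) (.var 7))))))))
    (.exLe _ _ (by simp [NTerm.OccursNum]) (.and (.mem _ _) (.exLe _ _ (by simp [NTerm.OccursNum])
      (.and (.mem _ _) (.numLe _ _)))))
    (by simp [Formula.FreeStr, NTerm.OccursStr, pr, dbl])
    (asg c d 0 0) (asg S T S S) fun _ _ _ => Iff.rfl, fun z hz => ?_⟩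
  constructor
  · exact fun h => ⟨s z, hc z hz, (hS z hz _ (hc z hz)).2 rfl, t z, hd z hz,
      (hT z hz _ (hd z hz)).2 rfl, h⟩
  · rintro ⟨x, hx, hx', y, hy, hy', h⟩
    rwa [(hS z hz _ hx).1 hx', (hT z hz _ hy).1 hy'] at h

theorem Coded.comp (hP : Coded P) (t : M.Num → M.Num) [CodedNum t] : Coded fun z => P (t z) := by
  refine .of_local fun b => ?_
  obtain ⟨c, T, hc, hT⟩ := CodedNum.exists_str t b
  obtain ⟨X, hX⟩ := hP.exists_str (c + 1)
  refine ⟨fun z => ∃ x ≤ c, M.mem (pair z x) T ∧ M.mem x X,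
    coded_of_sat (.exNum 6 (.and (.numLe (.var 6) (.var 2)) (.and (.mem (pr (.var 0) (.var 6)) 2)
      (.mem (.var 6) 3))))
    (.exLe _ _ (by simp [NTerm.OccursNum]) (.and (.mem _ _) (.mem _ _)))
    (by simp [Formula.FreeStr, NTerm.OccursStr, pr, dbl])
    (asg c 0 0 0) (asg T X T T) fun _ _ _ => Iff.rfl, fun z hz => ?_⟩
  constructor
  · exact fun h => ⟨t z, hc z hz, (hT z hz _ (hc z hz)).2 rfl,
      (hX _ (Num.lt_add_one_iff.2 (hc z hz))).2 h⟩
  · rintro ⟨x, hx, hx', h⟩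
    rw [hX _ (Num.lt_add_one_iff.2 hx)] at h
    rwa [(hT z hz _ hx).1 hx'] at h

theorem CodedNum.comp (s : M.Num → M.Num) [CodedNum s] (t : M.Num → M.Num) [CodedNum t] :
    CodedNum fun z => s (t z) := by
  refine .of_local (fun b => ?_) fun b c => ?_
  · obtain ⟨c, hc⟩ := CodedNum.bdd (t := t) b
    obtain ⟨d, hd⟩ := CodedNum.bdd (t := s) c
    exact ⟨d, fun x hx => hd _ (hc x hx)⟩
  obtain ⟨d, T, hd, hT⟩ := CodedNum.exists_str t b
  obtain ⟨S, hS⟩ := CodedNum.graph (t := s) (d + 1) c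
  refine ⟨fun x y => ∃ z ≤ d, M.mem (pair x z) T ∧ M.mem (pair z y) S, fun x hx y hy => ?_,
    coded_of_sat (.exNum 6 (.and (.numLe (.var 6) (.var 2)) (.exNum 7 (.and (.numLe (.var 7) (.var 3))
      (.and (.numEq (.var 0) (pr (.var 6) (.var 7))) (.exNum 8 (.and (.numLe (.var 8) (.var 4))
      (.and (.mem (pr (.var 6) (.var 8)) 2) (.mem (pr (.var 8) (.var 7)) 3)))))))))
    (.exLe _ _ (by simp [NTerm.OccursNum]) (.exLe _ _ (by simp [NTerm.OccursNum]) (.and (.numEq _ _)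
      (.exLe _ _ (by simp [NTerm.OccursNum]) (.and (.mem _ _) (.mem _ _))))))
    (by simp [Formula.FreeStr, NTerm.OccursStr, pr, dbl])
    (asg b c d 0) (asg T S T T) fun _ _ _ => Iff.rfl⟩
  constructor
  · rintro ⟨z, hz, hz', h⟩
    rw [hS _ (Num.lt_add_one_iff.2 hz) _ hy] at h
    rwa [(hT x hx _ hz).1 hz'] at h
  · exact fun h => ⟨t x, hd x hx, (hT x hx _ (hd x hx)).2 rfl,
      (hS _ (Num.lt_add_one_iff.2 (hd x hx)) _ hy).2 h⟩

instance CodedNum.id : CodedNum fun z : M.Num => z := by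
  refine .of_local (fun b => ⟨b, fun _ h => h⟩) fun b c => ?_
  refine ⟨fun x y => y = x, fun _ _ _ _ => Iff.rfl,
    coded_of_sat (.exNum 6 (.and (.numLe (.var 6) (.var 2)) (.exNum 7 (.and (.numLe (.var 7) (.var 3))
      (.and (.numEq (.var 0) (pr (.var 6) (.var 7))) (.numEq (.var 7) (.var 6)))))))
    (.exLe _ _ (by simp [NTerm.OccursNum]) (.exLe _ _ (by simp [NTerm.OccursNum]) (.and (.numEq _ _)
      (.numEq _ _))))
    (by simp [Formula.FreeStr, NTerm.OccursStr, pr, dbl])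
    (asg b c 0 0) (anyStr M) fun _ _ _ => Iff.rfl⟩

instance CodedNum.const (a : M.Num) : CodedNum fun _ : M.Num => a := by
  refine .of_local (fun b => ⟨a + 1, fun _ h => Num.lt_add_one_iff.2 le_rfl⟩) fun b c => ?_
  refine ⟨fun x y => y = a, fun _ _ _ _ => Iff.rfl,
    coded_of_sat (.exNum 6 (.and (.numLe (.var 6) (.var 2)) (.exNum 7 (.and (.numLe (.var 7) (.var 3))
      (.and (.numEq (.var 0) (pr (.var 6) (.var 7))) (.numEq (.var 7) (.var 4)))))))
    (.exLe _ _ (by simp [NTerm.OccursNum]) (.exLe _ _ (by simp [NTerm.OccursNum]) (.and (.numEq _ _)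
      (.numEq _ _))))
    (by simp [Formula.FreeStr, NTerm.OccursStr, pr, dbl])
    (asg b c a 0) (anyStr M) fun _ _ _ => Iff.rfl⟩

instance CodedNum.add [CodedNum s] [CodedNum t] : CodedNum fun z => s z + t z := by
  refine .of_local (fun b => ?_) fun b c => ?_
  · obtain ⟨c, hc⟩ := CodedNum.bdd (t := s) b
    obtain ⟨d, hd⟩ := CodedNum.bdd (t := t) b
    exact ⟨c + d, fun x hx => add_lt_add (hc x hx) (hd x hx)⟩
  obtain ⟨c', S, hc, hS⟩ := CodedNum.exists_str s b
  obtain ⟨d, T, hd, hT⟩ := CodedNum.exists_str t b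
  refine ⟨fun x y => ∃ u ≤ c', M.mem (pair x u) S ∧ ∃ v ≤ d, M.mem (pair x v) T ∧ y = u + v,
    fun x hx y hy => ?_,
    coded_of_sat (.exNum 6 (.and (.numLe (.var 6) (.var 2)) (.exNum 7 (.and (.numLe (.var 7) (.var 3))
      (.and (.numEq (.var 0) (pr (.var 6) (.var 7))) (.exNum 8 (.and (.numLe (.var 8) (.var 4))
      (.and (.mem (pr (.var 6) (.var 8)) 2) (.exNum 9 (.and (.numLe (.var 9) (.var 5))
      (.and (.mem (pr (.var 6) (.var 9)) 3)
      (.numEq (.var 7) (.add (.var 8) (.var 9))))))))))))))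
    (.exLe _ _ (by simp [NTerm.OccursNum]) (.exLe _ _ (by simp [NTerm.OccursNum]) (.and (.numEq _ _)
      (.exLe _ _ (by simp [NTerm.OccursNum]) (.and (.mem _ _) (.exLe _ _ (by simp [NTerm.OccursNum])
      (.and (.mem _ _) (.numEq _ _))))))))
    (by simp [Formula.FreeStr, NTerm.OccursStr, pr, dbl])
    (asg b c c' d) (asg S T T T) fun _ _ _ => Iff.rfl⟩
  constructor
  · rintro ⟨u, hu, hu', v, hv, hv', h⟩
    rwa [(hS x hx _ hu).1 hu', (hT x hx _ hv).1 hv'] at h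
  · exact fun h => ⟨s x, hc x hx, (hS x hx _ (hc x hx)).2 rfl, t x, hd x hx,
      (hT x hx _ (hd x hx)).2 rfl, h⟩

instance CodedNum.mul [CodedNum s] [CodedNum t] : CodedNum fun z => s z * t z := by
  refine .of_local (fun b => ?_) fun b c => ?_
  · obtain ⟨c, hc⟩ := CodedNum.bdd (t := s) b
    obtain ⟨d, hd⟩ := CodedNum.bdd (t := t) b
    exact ⟨c * d, fun x hx => mul_lt_mul'' (hc x hx) (hd x hx) zero_le zero_le⟩
  obtain ⟨c', S, hc, hS⟩ := CodedNum.exists_str s b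
  obtain ⟨d, T, hd, hT⟩ := CodedNum.exists_str t b
  refine ⟨fun x y => ∃ u ≤ c', M.mem (pair x u) S ∧ ∃ v ≤ d, M.mem (pair x v) T ∧ y = u * v,
    fun x hx y hy => ?_,
    coded_of_sat (.exNum 6 (.and (.numLe (.var 6) (.var 2)) (.exNum 7 (.and (.numLe (.var 7) (.var 3))
      (.and (.numEq (.var 0) (pr (.var 6) (.var 7))) (.exNum 8 (.and (.numLe (.var 8) (.var 4))
      (.and (.mem (pr (.var 6) (.var 8)) 2) (.exNum 9 (.and (.numLe (.var 9) (.var 5))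
      (.and (.mem (pr (.var 6) (.var 9)) 3)
      (.numEq (.var 7) (.mul (.var 8) (.var 9))))))))))))))
    (.exLe _ _ (by simp [NTerm.OccursNum]) (.exLe _ _ (by simp [NTerm.OccursNum]) (.and (.numEq _ _)
      (.exLe _ _ (by simp [NTerm.OccursNum]) (.and (.mem _ _) (.exLe _ _ (by simp [NTerm.OccursNum])
      (.and (.mem _ _) (.numEq _ _))))))))
    (by simp [Formula.FreeStr, NTerm.OccursStr, pr, dbl])
    (asg b c c' d) (asg S T T T) fun _ _ _ => Iff.rfl⟩
  constructor
  · rintro ⟨u, hu, hu', v, hv, hv', h⟩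
    rwa [(hS x hx _ hu).1 hu', (hT x hx _ hv).1 hv'] at h
  · exact fun h => ⟨s x, hc x hx, (hS x hx _ (hc x hx)).2 rfl, t x, hd x hx,
      (hT x hx _ (hd x hx)).2 rfl, h⟩

instance CodedNum.prod [CodedNum s] [CodedNum t] : CodedNum fun z => pair (s z) (t z) := by
  unfold pair; infer_instance

/-- This form of the graph is bounded, since a pair is at least as large as its components. It
includes the default value `0` at numbers that are not pairs. -/
theorem eq_fst_iff {y z : M.Num} : y = fst z ↔ (∃ u ≤ z, ∃ v ≤ z, z = pair u v ∧ y = u) ∨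
    (¬ ∃ u ≤ z, ∃ v ≤ z, z = pair u v) ∧ y = 0 := by
  by_cases h : ∃ u v, z = pair u v
  · obtain ⟨u, v, rfl⟩ := h
    have h' : ∃ u' ≤ pair u v, ∃ v' ≤ pair u v, pair u v = pair u' v' :=
      ⟨u, le_pair_left _ _, v, le_pair_right _ _, rfl⟩
    rw [fst_pair, iff_true_intro h', not_true, false_and, or_false]
    constructor
    · exact fun h => ⟨u, le_pair_left _ _, v, le_pair_right _ _, rfl, h⟩
    · rintro ⟨u', -, v', -, h, rfl⟩
      exact (pair_inj.1 h).1.symm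
  · rw [fst, dif_neg h]
    constructor
    · exact fun hy => Or.inr ⟨fun ⟨u, _, v, _, h'⟩ => h ⟨u, v, h'⟩, hy⟩
    · rintro (⟨u, -, v, -, h', -⟩ | ⟨-, h'⟩)
      · exact absurd ⟨u, v, h'⟩ h
      · exact h'

theorem eq_snd_iff {y z : M.Num} : y = snd z ↔ (∃ u ≤ z, ∃ v ≤ z, z = pair u v ∧ y = v) ∨
    (¬ ∃ u ≤ z, ∃ v ≤ z, z = pair u v) ∧ y = 0 := by
  by_cases h : ∃ u v, z = pair u v
  · obtain ⟨u, v, rfl⟩ := h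
    have h' : ∃ u' ≤ pair u v, ∃ v' ≤ pair u v, pair u v = pair u' v' :=
      ⟨u, le_pair_left _ _, v, le_pair_right _ _, rfl⟩
    rw [snd_pair, iff_true_intro h', not_true, false_and, or_false]
    constructor
    · exact fun h => ⟨u, le_pair_left _ _, v, le_pair_right _ _, rfl, h⟩
    · rintro ⟨u', -, v', -, h, rfl⟩
      exact (pair_inj.1 h).2.symm
  · rw [snd, dif_neg h]
    constructor
    · exact fun hy => Or.inr ⟨fun ⟨u, _, v, _, h'⟩ => h ⟨u, v, h'⟩, hy⟩
    · rintro (⟨u, -, v, -, h', -⟩ | ⟨-, h'⟩)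
      · exact absurd ⟨u, v, h'⟩ h
      · exact h'

instance codedNum_fst : CodedNum (fst : M.Num → M.Num) := by
  refine .of_local (fun b => ⟨b, fun _ h => (fst_le _).trans_lt h⟩) fun b c => ?_
  refine ⟨_, fun x _ y _ => eq_fst_iff.symm,
    coded_of_sat (.exNum 6 (.and (.numLe (.var 6) (.var 2)) (.exNum 7 (.and (.numLe (.var 7) (.var 3))
      (.and (.numEq (.var 0) (pr (.var 6) (.var 7)))
      (.or (.exNum 8 (.and (.numLe (.var 8) (.var 6)) (.exNum 9 (.and (.numLe (.var 9) (.var 6))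
        (.and (.numEq (.var 6) (pr (.var 8) (.var 9))) (.numEq (.var 7) (.var 8)))))))
      (.and (.neg (.exNum 8 (.and (.numLe (.var 8) (.var 6)) (.exNum 9 (.and (.numLe (.var 9) (.var 6))
        (.numEq (.var 6) (pr (.var 8) (.var 9))))))))
        (.numEq (.var 7) .zero))))))))
    (.exLe _ _ (by simp [NTerm.OccursNum]) (.exLe _ _ (by simp [NTerm.OccursNum]) (.and (.numEq _ _)
      (.or (.exLe _ _ (by simp [NTerm.OccursNum]) (.exLe _ _ (by simp [NTerm.OccursNum])
      (.and (.numEq _ _) (.numEq _ _)))) (.and (.neg (.exLe _ _ (by simp [NTerm.OccursNum])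
      (.exLe _ _ (by simp [NTerm.OccursNum]) (.numEq _ _)))) (.numEq _ _))))))
    (by simp [Formula.FreeStr, NTerm.OccursStr, pr, dbl])
    (asg b c 0 0) (anyStr M) fun _ _ _ => Iff.rfl⟩

instance codedNum_snd : CodedNum (snd : M.Num → M.Num) := by
  refine .of_local (fun b => ⟨b, fun _ h => (snd_le _).trans_lt h⟩) fun b c => ?_
  refine ⟨_, fun x _ y _ => eq_snd_iff.symm,
    coded_of_sat (.exNum 6 (.and (.numLe (.var 6) (.var 2)) (.exNum 7 (.and (.numLe (.var 7) (.var 3))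
      (.and (.numEq (.var 0) (pr (.var 6) (.var 7)))
      (.or (.exNum 8 (.and (.numLe (.var 8) (.var 6)) (.exNum 9 (.and (.numLe (.var 9) (.var 6))
        (.and (.numEq (.var 6) (pr (.var 8) (.var 9))) (.numEq (.var 7) (.var 9)))))))
      (.and (.neg (.exNum 8 (.and (.numLe (.var 8) (.var 6)) (.exNum 9 (.and (.numLe (.var 9) (.var 6))
        (.numEq (.var 6) (pr (.var 8) (.var 9))))))))
        (.numEq (.var 7) .zero))))))))
    (.exLe _ _ (by simp [NTerm.OccursNum]) (.exLe _ _ (by simp [NTerm.OccursNum]) (.and (.numEq _ _)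
      (.or (.exLe _ _ (by simp [NTerm.OccursNum]) (.exLe _ _ (by simp [NTerm.OccursNum])
      (.and (.numEq _ _) (.numEq _ _)))) (.and (.neg (.exLe _ _ (by simp [NTerm.OccursNum])
      (.exLe _ _ (by simp [NTerm.OccursNum]) (.numEq _ _)))) (.numEq _ _))))))
    (by simp [Formula.FreeStr, NTerm.OccursStr, pr, dbl])
    (asg b c 0 0) (anyStr M) fun _ _ _ => Iff.rfl⟩

instance CodedNum.fst_comp [CodedNum t] : CodedNum fun z => fst (t z) :=
  .comp fst t

instance CodedNum.snd_comp [CodedNum t] : CodedNum fun z => snd (t z) :=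
  .comp snd t

instance CodedNum.lt [CodedNum s] [CodedNum t] : Coded fun z => s z < t z := by
  simp only [← not_le]; infer_instance

instance CodedNum.eq [CodedNum s] [CodedNum t] : Coded fun z => s z = t z := by
  simp only [le_antisymm_iff]; infer_instance

instance (a : M.Num) : CodedNum (pair a) :=
  CodedNum.prod (s := fun _ => a) (t := fun z => z)
instance (a : M.Num) : CodedNum (HAdd.hAdd a) := CodedNum.add (s := fun _ => a) (t := fun z => z)
instance (a : M.Num) : Coded (LE.le a) := CodedNum.le (s := fun _ => a) (t := fun z => z)
instance (a : M.Num) : Coded (LT.lt a) := CodedNum.lt (s := fun _ => a) (t := fun z => z)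

/-- A binary predicate is treated as a unary predicate of a pair. A constant bound suffices, since a
coded bounding function is itself bounded on each initial segment. -/
theorem coded_exists_le_const (c : M.Num) {P : M.Num → M.Num → Prop}
    (hP : Coded fun w => P (fst w) (snd w)) : Coded fun x => ∃ y ≤ c, P x y := by
  refine .of_local fun b => ?_
  obtain ⟨X, hX⟩ := hP.exists_str (pair b (c + 1))
  refine ⟨fun x => ∃ y ≤ c, M.mem (pair x y) X,
    coded_of_sat (.exNum 6 (.and (.numLe (.var 6) (.var 2)) (.mem (pr (.var 0) (.var 6)) 2)))
    (.exLe _ _ (by simp [NTerm.OccursNum]) (.mem _ _))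
    (by simp [Formula.FreeStr, NTerm.OccursStr, pr, dbl])
    (asg c 0 0 0) (asg X X X X) fun _ _ _ => Iff.rfl, fun x hx => exists_congr fun y =>
      and_congr_right fun hy => ?_⟩
  rw [hX _ (pair_lt_pair hx (Num.lt_add_one_iff.2 hy)), fst_pair, snd_pair]

variable {R : M.Num → M.Num → Prop}

instance Coded.exists_le [CodedNum t] [hR : Coded fun w => R (fst w) (snd w)] :
    Coded fun x => ∃ y, y ≤ t x ∧ R x y := by
  refine .of_local fun b => ?_
  obtain ⟨c, hc⟩ := CodedNum.bdd (t := t) b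
  refine ⟨fun x => ∃ y ≤ c, y ≤ t x ∧ R x y, coded_exists_le_const c ?_, fun x hx => ?_⟩
  · have := CodedNum.comp t (fst : M.Num → M.Num)
    infer_instance
  · exact exists_congr fun y => ⟨fun h => ⟨h.1.trans (hc x hx).le, h⟩, fun h => h.2⟩

instance Coded.exists_lt [CodedNum t] [hR : Coded fun w => R (fst w) (snd w)] :
    Coded fun x => ∃ y, y < t x ∧ R x y := by
  have := CodedNum.comp t (fst : M.Num → M.Num)
  exact (inferInstance : Coded fun x => ∃ y, y ≤ t x ∧ (y < t x ∧ R x y)).congr fun x =>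
    exists_congr fun y => ⟨fun h => h.2, fun h => ⟨h.1.le, h⟩⟩

instance Coded.forall_le [CodedNum t] [hR : Coded fun w => R (fst w) (snd w)] :
    Coded fun x => ∀ y, y ≤ t x → R x y :=
  (inferInstance : Coded fun x => ¬ ∃ y, y ≤ t x ∧ ¬ R x y).congr fun x => by
    simp only [not_exists, not_and, not_not]

instance Coded.forall_lt [CodedNum t] [hR : Coded fun w => R (fst w) (snd w)] :
    Coded fun x => ∀ y, y < t x → R x y :=
  (inferInstance : Coded fun x => ¬ ∃ y, y < t x ∧ ¬ R x y).congr fun x => by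
    simp only [not_exists, not_and, not_not]

end Closure

/-- To show that a function is coded it suffices to bound it and to define its graph. -/
theorem CodedNum.of_graph {t : M.Num → M.Num} (hb : ∀ b, ∃ c, ∀ x, x < b → t x < c)
    (h : Coded fun w => snd w = t (fst w)) : CodedNum t := by
  refine ⟨hb, fun b c => ?_⟩
  obtain ⟨T, hT⟩ := h.exists_str (pair b c)
  refine ⟨T, fun x hx y hy => ?_⟩
  rw [hT _ (pair_lt_pair hx hy), fst_pair, snd_pair]

end VSharp

/-! ### Coded functions with values in strings. -/

namespace VSharp

variable {M : Struc.{u, v}} [IsModel M]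

/-- A function from numbers to strings is *coded* if every bounded part of it is bounded, and its
bit graph is coded. -/
class CodedStr (s : M.Num → M.Str) : Prop where
  bdd : ∀ b, ∃ c, ∀ x, x < b → M.len (s x) ≤ c
  graph : Coded fun w => M.mem (snd w) (s (fst w))

open Classical in
/-- The string `{i < b | P i}`, for coded `P`. -/
noncomputable def mk (b : M.Num) (P : M.Num → Prop) : M.Str :=
  if h : ∃ X : M.Str, ∀ i, M.mem i X ↔ i < b ∧ P i then h.choose else Classical.arbitrary _

theorem mem_mk {b : M.Num} {P : M.Num → Prop} [hP : Coded P] {i : M.Num} :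
    M.mem i (mk b P) ↔ i < b ∧ P i := by
  have h : ∃ X : M.Str, ∀ i, M.mem i X ↔ i < b ∧ P i := by
    obtain ⟨X, hX⟩ := hP.exists_str b
    obtain ⟨S, hS, hS'⟩ := exists_comp (M := M) (.mem (.var 0) 2) (.mem _ _)
      (by simp [Formula.FreeStr, NTerm.OccursStr]) (fun _ => 0) (fun _ => X) b
    refine ⟨S, fun i => ⟨fun hi => ?_, fun hi => ?_⟩⟩
    · have hib := (Ax.lt_len _ _ hi).trans_le hS
      exact ⟨hib, (hX i hib).1 ((hS' i hib).1 hi)⟩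
    · exact (hS' i hi.1).2 ((hX i hi.1).2 hi.2)
  rw [mk, dif_pos h]
  exact h.choose_spec i

/-- The row `i` of the array `X`. -/
noncomputable def row (X : M.Str) (i : M.Num) : M.Str := mk (M.len X) fun j => M.mem (pair i j) X

theorem CodedStr.congr {s s' : M.Num → M.Str} (h : CodedStr s) (h' : ∀ z, s z = s' z) :
    CodedStr s' := (funext h' : s = s') ▸ h

section Instances

variable {s s' : M.Num → M.Str} {t : M.Num → M.Num} {P : M.Num → Prop}

instance CodedStr.const (X : M.Str) : CodedStr fun _ : M.Num => X :=
  ⟨fun _ => ⟨M.len X, fun _ _ => le_rfl⟩, (coded_mem X).comp snd⟩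

theorem CodedStr.comp (s : M.Num → M.Str) [hs : CodedStr s] (t : M.Num → M.Num) [CodedNum t] :
    CodedStr fun z => s (t z) := by
  refine ⟨fun b => ?_, ?_⟩
  · obtain ⟨c, hc⟩ := CodedNum.bdd (t := t) b
    obtain ⟨d, hd⟩ := CodedStr.bdd (s := s) c
    exact ⟨d, fun x hx => hd _ (hc x hx)⟩
  · have := CodedNum.comp t (fst : M.Num → M.Num)
    exact (hs.graph.comp fun w => pair (t (fst w)) (snd w)).congr fun w => by
      rw [fst_pair, snd_pair]

instance CodedStr.mem [hs : CodedStr s] [CodedNum t] : Coded fun z => M.mem (t z) (s z) :=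
  (hs.graph.comp fun w => pair w (t w)).congr fun w => by rw [fst_pair, snd_pair]

theorem CodedStr.of_local (h : ∀ b, ∃ s', CodedStr s' ∧ ∀ x, x < b → s x = s' x) : CodedStr s := by
  refine ⟨fun b => ?_, .of_local fun b => ?_⟩
  · obtain ⟨s', hs', h⟩ := h b
    obtain ⟨c, hc⟩ := CodedStr.bdd (s := s') b
    exact ⟨c, fun x hx => h x hx ▸ hc x hx⟩
  · obtain ⟨s', hs', h⟩ := h b
    exact ⟨_, hs'.graph, fun z hz => by rw [h _ ((fst_le z).trans_lt hz)]⟩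

instance codedStr_mk {P : M.Num → M.Num → Prop} [CodedNum t]
    [hP : Coded fun w => P (fst w) (snd w)] : CodedStr fun z => mk (t z) (P z) := by
  have hPz : ∀ z, Coded (P z) := fun z => (hP.comp fun w => pair z w).congr fun w => by
    rw [fst_pair, snd_pair]
  refine ⟨fun b => ?_, ?_⟩
  · obtain ⟨c, hc⟩ := CodedNum.bdd (t := t) b
    refine ⟨c, fun x hx => len_le_iff.2 fun i hi => ?_⟩
    rw [mem_mk] at hi
    exact hi.1.trans (hc x hx)
  · have := CodedNum.comp t (fst : M.Num → M.Num)
    simp only [mem_mk]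
    infer_instance

theorem mem_row {X : M.Str} {i j : M.Num} : M.mem j (row X i) ↔ M.mem (pair i j) X := by
  rw [row, mem_mk]
  exact ⟨fun h => h.2, fun h => ⟨(le_pair_right _ _).trans_lt (Ax.lt_len _ _ h), h⟩⟩

theorem len_row_le (X : M.Str) (i : M.Num) : M.len (row X i) ≤ M.len X :=
  len_le_iff.2 fun _ hj => (le_pair_right _ _).trans_lt (Ax.lt_len _ _ (mem_row.1 hj))

instance CodedStr.row [hs : CodedStr s] [CodedNum t] : CodedStr fun z => row (s z) (t z) := by
  refine ⟨fun b => ?_, ?_⟩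
  · obtain ⟨c, hc⟩ := CodedStr.bdd (s := s) b
    exact ⟨c, fun x hx => (len_row_le _ _).trans (hc x hx)⟩
  · have := CodedNum.comp t (fst : M.Num → M.Num)
    have := CodedStr.comp s (fst : M.Num → M.Num)
    simp only [mem_row]
    infer_instance

instance (X : M.Str) : CodedStr (row X) := CodedStr.row (s := fun _ => X) (t := fun z => z)

/-- Locally the lengths have a common bound, so equality of the strings becomes a bounded comparison
of bits. -/
instance CodedStr.eq [hs : CodedStr s] [hs' : CodedStr s'] : Coded fun z => s z = s' z := by
  refine .of_local fun b => ?_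
  obtain ⟨c, hc⟩ := CodedStr.bdd (s := s) b
  obtain ⟨c', hc'⟩ := CodedStr.bdd (s := s') b
  have := CodedStr.comp s (fst : M.Num → M.Num)
  have := CodedStr.comp s' (fst : M.Num → M.Num)
  refine ⟨fun z => ∀ i, i < c + c' → (M.mem i (s z) ↔ M.mem i (s' z)), inferInstance,
    fun z hz => ⟨fun h i _ => h ▸ Iff.rfl, fun h => str_ext fun i => ?_⟩⟩
  by_cases hi : i < c + c'
  · exact h i hi
  · constructor
    · exact fun h => absurd ((Ax.lt_len _ _ h).trans_le ((hc z hz).trans le_self_add)) hi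
    · exact fun h => absurd ((Ax.lt_len _ _ h).trans_le ((hc' z hz).trans le_add_self)) hi

/-- The length is the strict upper bound of the elements that is `0` or the successor of an element.
The quantifier over elements is restricted only so that the restriction can be replaced by any
larger local bound. -/
theorem eq_len_iff {X : M.Str} {y : M.Num} : y = M.len X ↔
    (∀ i, i < M.len X → M.mem i X → i < y) ∧ (y = 0 ∨ ∃ i, i < y ∧ y = i + 1 ∧ M.mem i X) := by
  constructor
  · rintro rfl
    refine ⟨fun i hi _ => hi, ?_⟩
    by_cases h0 : M.len X = 0
    · exact Or.inl h0
    · obtain ⟨y, -, hy⟩ := Ax.exists_pred _ h0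
      exact Or.inr ⟨y, hy ▸ Num.lt_add_one_iff.2 le_rfl, hy.symm, Ax.mem_of_len _ _ hy⟩
  · rintro ⟨h1, h2⟩
    refine le_antisymm ?_ (len_le_iff.2 fun i hi => h1 i (Ax.lt_len _ _ hi) hi)
    rcases h2 with rfl | ⟨i, -, rfl, h⟩
    · exact zero_le
    · exact Num.add_one_le_iff.2 (Ax.lt_len _ _ h)

instance CodedStr.len [hs : CodedStr s] : CodedNum fun z => M.len (s z) := by
  refine .of_graph (fun b => ?_) (.of_local fun b => ?_)
  · obtain ⟨c, hc⟩ := CodedStr.bdd (s := s) b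
    exact ⟨c + 1, fun x hx => Num.lt_add_one_iff.2 (hc x hx)⟩
  · obtain ⟨c, hc⟩ := CodedStr.bdd (s := s) b
    have := CodedStr.comp s (fst : M.Num → M.Num)
    have := CodedStr.comp s (fun w : M.Num => fst (fst w))
    refine ⟨fun w => (∀ i, i < c → M.mem i (s (fst w)) → i < snd w) ∧
      (snd w = 0 ∨ ∃ i, i < snd w ∧ snd w = i + 1 ∧ M.mem i (s (fst w))), inferInstance,
      fun z hz => eq_len_iff.trans (and_congr_left fun _ => forall_congr' fun i =>
        ⟨fun h _ hi => h (Ax.lt_len _ _ hi) hi, fun h hi => h ?_⟩)⟩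
    exact hi.trans_le (hc _ ((fst_le _).trans_lt hz))

instance CodedStr.ite {dec : ∀ z, Decidable (P z)} [hP : Coded P] [hs : CodedStr s] [hs' : CodedStr s'] :
    CodedStr fun z => if P z then s z else s' z := by
  refine ⟨fun b => ?_, ?_⟩
  · obtain ⟨c, hc⟩ := CodedStr.bdd (s := s) b
    obtain ⟨c', hc'⟩ := CodedStr.bdd (s := s') b
    refine ⟨c + c', fun x hx => ?_⟩
    split_ifs
    · exact (hc x hx).trans le_self_add
    · exact (hc' x hx).trans le_add_self
  · have := hP.comp fst
    have := CodedStr.comp s (fst : M.Num → M.Num)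
    have := CodedStr.comp s' (fst : M.Num → M.Num)
    refine (inferInstance : Coded fun w => (P (fst w) ∧ M.mem (snd w) (s (fst w))) ∨
      (¬ P (fst w) ∧ M.mem (snd w) (s' (fst w)))).congr fun w => ?_
    by_cases h : P (fst w) <;> simp [h]

end Instances

/-- Every bounded part of a coded function is an array. -/
theorem exists_array (s : M.Num → M.Str) [hs : CodedStr s] (b : M.Num) :
    ∃ W : M.Str, ∀ i, i < b → row W i = s i := by
  obtain ⟨c, hc⟩ := CodedStr.bdd (s := s) b
  have := CodedStr.comp s (fst : M.Num → M.Num)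
  refine ⟨mk (pair b c) fun w => M.mem (snd w) (s (fst w)), fun i hi => str_ext fun j => ?_⟩
  rw [mem_row, mem_mk, fst_pair, snd_pair]
  exact ⟨fun h => h.2, fun h => ⟨pair_lt_pair hi ((Ax.lt_len _ _ h).trans_le (hc i hi)), h⟩⟩

/-- A coded family of strings with two indices. -/
theorem exists_matrix (s : M.Num → M.Num → M.Str) [hs : CodedStr fun w => s (fst w) (snd w)]
    (a b : M.Num) : ∃ W : M.Str, ∀ i, i < a → ∀ j, j < b → row W (pair i j) = s i j := by
  obtain ⟨W, hW⟩ := exists_array (fun w => s (fst w) (snd w)) (pair a b)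
  exact ⟨W, fun i hi j hj => by rw [hW _ (pair_lt_pair hi hj), fst_pair, snd_pair]⟩

end VSharp

/-! ### Binary addition, subtraction and shifts. -/

namespace VSharp

variable {M : Struc.{u, v}}

/-- A carry reaches bit `i` in the binary addition `X + Y`. -/
def Carry (X Y : M.Str) (i : M.Num) : Prop :=
  ∃ k, k < i ∧ (M.mem k X ∧ M.mem k Y) ∧ ∀ j, j < i → k < j → M.mem j X ∨ M.mem j Y

/-- A borrow reaches bit `i` in the binary subtraction `X - Y`. -/
def Borrow (X Y : M.Str) (i : M.Num) : Prop :=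
  ∃ k, k < i ∧ (¬ M.mem k X ∧ M.mem k Y) ∧ ∀ j, j < i → k < j → ¬ M.mem j X ∨ M.mem j Y

variable [IsModel M]

instance {s s' : M.Num → M.Str} {t : M.Num → M.Num} [CodedStr s] [CodedStr s'] [CodedNum t] :
    Coded fun z => Carry (s z) (s' z) (t z) := by
  have := CodedNum.comp t (fst : M.Num → M.Num)
  have := CodedStr.comp s (fst : M.Num → M.Num)
  have := CodedStr.comp s' (fst : M.Num → M.Num)
  have := CodedNum.comp t (fun w : M.Num => fst (fst w))
  have := CodedStr.comp s (fun w : M.Num => fst (fst w))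
  have := CodedStr.comp s' (fun w : M.Num => fst (fst w))
  unfold Carry; infer_instance

instance {s s' : M.Num → M.Str} {t : M.Num → M.Num} [CodedStr s] [CodedStr s'] [CodedNum t] :
    Coded fun z => Borrow (s z) (s' z) (t z) := by
  have := CodedNum.comp t (fst : M.Num → M.Num)
  have := CodedStr.comp s (fst : M.Num → M.Num)
  have := CodedStr.comp s' (fst : M.Num → M.Num)
  have := CodedNum.comp t (fun w : M.Num => fst (fst w))
  have := CodedStr.comp s (fun w : M.Num => fst (fst w))
  have := CodedStr.comp s' (fun w : M.Num => fst (fst w))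
  unfold Borrow; infer_instance

instance (X Y : M.Str) : Coded (Carry X Y) :=
  (inferInstance : Coded fun z => Carry ((fun _ => X) z) ((fun _ => Y) z) z)
instance (X Y : M.Str) : Coded (Borrow X Y) :=
  (inferInstance : Coded fun z => Borrow ((fun _ => X) z) ((fun _ => Y) z) z)

noncomputable instance : Zero M.Str := ⟨mk 0 fun _ => False⟩
noncomputable instance : One M.Str := ⟨mk 1 fun _ => True⟩
noncomputable instance : Add M.Str :=
  ⟨fun X Y => mk (M.len X + M.len Y) fun i => (M.mem i X ↔ M.mem i Y) ↔ Carry X Y i⟩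

instance {s s' : M.Num → M.Str} [CodedStr s] [CodedStr s'] : CodedStr fun z => s z + s' z := by
  have := CodedStr.comp s (fst : M.Num → M.Num)
  have := CodedStr.comp s' (fst : M.Num → M.Num)
  exact codedStr_mk (P := fun z i => (M.mem i (s z) ↔ M.mem i (s' z)) ↔ Carry (s z) (s' z) i)

theorem not_mem_zero (i : M.Num) : ¬ M.mem i 0 := fun h => (mem_mk.1 h).2

theorem mem_one {i : M.Num} : M.mem i 1 ↔ i = 0 := by
  refine mem_mk.trans ?_
  rw [← zero_add (1 : M.Num), Num.lt_add_one_iff, nonpos_iff_eq_zero, and_true]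

theorem len_eq_zero {X : M.Str} : M.len X = 0 ↔ X = 0 :=
  len_eq_zero_iff.trans ⟨fun h => str_ext fun i => iff_of_false (h i) (not_mem_zero i),
    fun h i => h ▸ not_mem_zero i⟩

theorem not_carry_zero {X Y : M.Str} : ¬ Carry X Y 0 := fun ⟨_, h, _⟩ => absurd h not_lt_zero

theorem not_borrow_zero {X Y : M.Str} : ¬ Borrow X Y 0 := fun ⟨_, h, _⟩ => absurd h not_lt_zero

/-- Carry and borrow are both of the form "generated at some `k` and propagated at all later
places". This is the recursion along the bits that such a closed definition satisfies. -/
theorem exists_chain_succ {A B : M.Num → Prop} {i : M.Num} :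
    (∃ k, k < i + 1 ∧ A k ∧ ∀ j, j < i + 1 → k < j → B j) ↔
      A i ∨ (B i ∧ ∃ k, k < i ∧ A k ∧ ∀ j, j < i → k < j → B j) := by
  constructor
  · rintro ⟨k, hk, hk', h⟩
    rcases (Num.lt_add_one_iff.1 hk).eq_or_lt with rfl | hki
    · exact Or.inl hk'
    · exact Or.inr ⟨h i (Num.lt_add_one_iff.2 le_rfl) hki, k, hki, hk', fun j hj hkj =>
        h j (hj.trans (Num.lt_add_one_iff.2 le_rfl)) hkj⟩
  · rintro (h | ⟨hB, k, hk, hk', h⟩)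
    · exact ⟨i, Num.lt_add_one_iff.2 le_rfl, h, fun j hj hij =>
        absurd (Num.lt_add_one_iff.1 hj) hij.not_ge⟩
    · refine ⟨k, hk.trans (Num.lt_add_one_iff.2 le_rfl), hk', fun j hj hkj => ?_⟩
      rcases (Num.lt_add_one_iff.1 hj).eq_or_lt with rfl | hji
      · exact hB
      · exact h j hji hkj

theorem carry_succ {X Y : M.Str} {i : M.Num} : Carry X Y (i + 1) ↔
    (M.mem i X ∧ M.mem i Y) ∨ ((M.mem i X ∨ M.mem i Y) ∧ Carry X Y i) :=
  exists_chain_succ (A := fun i => M.mem i X ∧ M.mem i Y) (B := fun i => M.mem i X ∨ M.mem i Y)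

theorem borrow_succ {X Y : M.Str} {i : M.Num} : Borrow X Y (i + 1) ↔
    (¬ M.mem i X ∧ M.mem i Y) ∨ ((¬ M.mem i X ∨ M.mem i Y) ∧ Borrow X Y i) :=
  exists_chain_succ (A := fun i => ¬ M.mem i X ∧ M.mem i Y)
    (B := fun i => ¬ M.mem i X ∨ M.mem i Y)

theorem not_mem_of_len_le {X : M.Str} {i : M.Num} (h : M.len X ≤ i) : ¬ M.mem i X :=
  fun hi => absurd (Ax.lt_len _ _ hi) h.not_gt

/-- A carry into bit `i` requires bit `i - 1` in `X` or in `Y`, so one length is at least `i`. The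
other string contains the generating bit, so the lengths together exceed `i`. -/
theorem not_carry_of_le {X Y : M.Str} {i : M.Num} (h : M.len X + M.len Y ≤ i) : ¬ Carry X Y i := by
  rintro ⟨k, hk, ⟨hX, hY⟩, hj⟩
  have h1 := Ax.lt_len _ _ hX
  have h2 := Ax.lt_len _ _ hY
  obtain ⟨j, -, rfl⟩ := Ax.exists_pred i (pos_of_gt hk).ne'
  have hjk : k < j := by
    rcases (Num.lt_add_one_iff.1 hk).eq_or_lt with rfl | h'
    · have := Num.add_one_le_iff.2 h1
      have := Num.add_one_le_iff.2 h2
      have : (0 : M.Num) ≤ k := zero_le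
      have : (0 : M.Num) < 1 := one_pos
      grind
    · exact h'
  have := Num.add_one_le_iff.2 h1
  have := Num.add_one_le_iff.2 h2
  rcases hj j (Num.lt_add_one_iff.2 le_rfl) hjk with h' | h'
  · have := Num.add_one_le_iff.2 (Ax.lt_len _ _ h')
    have : (0 : M.Num) ≤ k := zero_le
    have : (0 : M.Num) < 1 := one_pos
    grind
  · have := Num.add_one_le_iff.2 (Ax.lt_len _ _ h')
    have : (0 : M.Num) ≤ k := zero_le
    have : (0 : M.Num) < 1 := one_pos
    grind

theorem mem_add {X Y : M.Str} {i : M.Num} :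
    M.mem i (X + Y) ↔ ((M.mem i X ↔ M.mem i Y) ↔ Carry X Y i) := by
  refine mem_mk.trans ⟨fun h => h.2, fun h => ⟨?_, h⟩⟩
  by_contra hi
  rw [not_lt] at hi
  have h1 := not_mem_of_len_le (le_self_add.trans hi)
  have h2 := not_mem_of_len_le (le_add_self.trans hi)
  exact not_carry_of_le hi (h.1 (iff_of_false h1 h2))

theorem carry_comm {X Y : M.Str} {i : M.Num} : Carry X Y i ↔ Carry Y X i := by
  simp only [Carry, and_comm, or_comm]

/-- In the two bracketings of `X + Y + Z` the individual carries differ, but the number of carries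
into each bit is the same. Conjunction and disjunction together determine the number of true ones
among two bits, and this invariant passes through induction. -/
theorem carry_add {X Y Z : M.Str} (i : M.Num) :
    ((Carry X Y i ∧ Carry (X + Y) Z i) ↔ (Carry Y Z i ∧ Carry X (Y + Z) i)) ∧
    ((Carry X Y i ∨ Carry (X + Y) Z i) ↔ (Carry Y Z i ∨ Carry X (Y + Z) i)) := by
  refine Coded.induction (P := fun i =>
    ((Carry X Y i ∧ Carry (X + Y) Z i) ↔ (Carry Y Z i ∧ Carry X (Y + Z) i)) ∧
    ((Carry X Y i ∨ Carry (X + Y) Z i) ↔ (Carry Y Z i ∨ Carry X (Y + Z) i)))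
    inferInstance ?_ ?_ i
  · simp only [not_carry_zero, and_self, or_self]
  · intro i
    simp only [carry_succ, mem_add]
    generalize M.mem i X = x, M.mem i Y = y, M.mem i Z = z, Carry X Y i = c1,
      Carry (X + Y) Z i = c2, Carry Y Z i = d1, Carry X (Y + Z) i = d2
    by_cases x <;> by_cases y <;> by_cases z <;> by_cases c1 <;> by_cases c2 <;> by_cases d1 <;>
      by_cases d2 <;> simp [*]

noncomputable instance : AddCommMonoid M.Str where
  add_assoc X Y Z := str_ext fun i => by
    have := carry_add (X := X) (Y := Y) (Z := Z) i
    simp only [mem_add]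
    generalize M.mem i X = x, M.mem i Y = y, M.mem i Z = z, Carry X Y i = c1,
      Carry (X + Y) Z i = c2, Carry Y Z i = d1, Carry X (Y + Z) i = d2 at this
    revert this
    by_cases x <;> by_cases y <;> by_cases z <;> by_cases c1 <;> by_cases c2 <;> by_cases d1 <;>
      by_cases d2 <;> simp [*]
  zero_add X := str_ext fun i => by
    have : ¬ Carry 0 X i := fun ⟨_, _, h, _⟩ => not_mem_zero _ h.1
    simp [mem_add, not_mem_zero, this]
  add_zero X := str_ext fun i => by
    have : ¬ Carry X 0 i := fun ⟨_, _, h, _⟩ => not_mem_zero _ h.2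
    simp [mem_add, not_mem_zero, this]
  add_comm X Y := str_ext fun i => by
    simp only [mem_add, carry_comm (X := X), iff_comm (a := M.mem i X)]
  nsmul := nsmulRec

theorem Str.add_left_cancel {X Y Z : M.Str} (h : X + Y = X + Z) : Y = Z := by
  have h' : ∀ i, M.mem i (X + Y) ↔ M.mem i (X + Z) := fun i => h ▸ Iff.rfl
  simp only [mem_add] at h'
  -- With equal carries into bit `i`, equal sum bits force equal bits of `Y` and `Z`, and so equal
  -- carries into the next bit.
  have key : ∀ i, (Carry X Y i ↔ Carry X Z i) := fun i => by
    refine Coded.induction (P := fun i => Carry X Y i ↔ Carry X Z i) inferInstance ?_ ?_ i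
    · simp only [not_carry_zero]
    · intro i hi
      have := h' i
      simp only [carry_succ]
      tauto
  exact str_ext fun i => by
    have := h' i
    have := key i
    tauto

instance : IsCancelAdd M.Str where
  add_left_cancel _ _ _ h := Str.add_left_cancel h
  add_right_cancel X Y Z h := Str.add_left_cancel (X := X) (by
    simpa only [add_comm X] using h)

theorem mem_add_of_disjoint {X Y : M.Str} (h : ∀ i, M.mem i X → ¬ M.mem i Y) {i : M.Num} :
    M.mem i (X + Y) ↔ M.mem i X ∨ M.mem i Y := by
  have : ¬ Carry X Y i := fun ⟨k, _, hk, _⟩ => h k hk.1 hk.2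
  have := h i
  rw [mem_add]
  tauto

theorem mem_succ_double {X : M.Str} {i : M.Num} : M.mem (i + 1) (X + X) ↔ M.mem i X := by
  simp only [mem_add, carry_succ]
  tauto

theorem not_mem_zero_double {X : M.Str} : ¬ M.mem 0 (X + X) := by
  simp only [mem_add, not_carry_zero]
  tauto

theorem eq_zero_or_succ (i : M.Num) : i = 0 ∨ ∃ j, i = j + 1 := by
  by_cases h : i = 0
  · exact Or.inl h
  · obtain ⟨j, -, hj⟩ := Ax.exists_pred _ h
    exact Or.inr ⟨j, hj.symm⟩

theorem mem_double_add_one {X : M.Str} {i : M.Num} :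
    M.mem i (X + X + 1) ↔ i = 0 ∨ M.mem i (X + X) := by
  rw [mem_add_of_disjoint, mem_one, or_comm]
  intro i h h'
  rw [mem_one] at h'
  exact not_mem_zero_double (h' ▸ h)

/-- The difference of two binary numbers, if it is not negative. -/
noncomputable def sub (X Y : M.Str) : M.Str :=
  mk (M.len X + M.len Y) fun i => (M.mem i X ↔ M.mem i Y) ↔ Borrow X Y i

/-- `X` is less than `Y` as a binary number. -/
def SLt (X Y : M.Str) : Prop := Borrow X Y (M.len X + M.len Y)

instance {s s' : M.Num → M.Str} [CodedStr s] [CodedStr s'] : CodedStr fun z => sub (s z) (s' z) := by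
  have := CodedStr.comp s (fst : M.Num → M.Num)
  have := CodedStr.comp s' (fst : M.Num → M.Num)
  unfold sub; infer_instance

instance {s s' : M.Num → M.Str} [CodedStr s] [CodedStr s'] : Coded fun z => SLt (s z) (s' z) := by
  unfold SLt; infer_instance

theorem not_slt_self (X : M.Str) : ¬ SLt X X := fun ⟨_, _, h, _⟩ => h.1 h.2

theorem not_slt_of_slt {X Y : M.Str} (h : SLt X Y) : ¬ SLt Y X := by
  have key : ∀ i, ¬ (Borrow X Y i ∧ Borrow Y X i) := fun i => by
    refine Coded.induction (P := fun i => ¬ (Borrow X Y i ∧ Borrow Y X i)) inferInstance ?_ ?_ i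
    · exact fun h => not_borrow_zero h.1
    · intro i
      simp only [borrow_succ]
      tauto
  intro h'
  rw [SLt, add_comm] at h'
  exact key _ ⟨h, h'⟩

/-- When `Y` is added back to the difference, the carries are exactly the borrows of the
subtraction. -/
theorem add_sub_of_not_slt {X Y : M.Str} (h : ¬ SLt X Y) : Y + sub X Y = X := by
  have hD : ∀ i, M.mem i (sub X Y) ↔
      i < M.len X + M.len Y ∧ ((M.mem i X ↔ M.mem i Y) ↔ Borrow X Y i) := fun i => mem_mk
  have key : ∀ i, i ≤ M.len X + M.len Y → (Carry Y (sub X Y) i ↔ Borrow X Y i) := fun i => by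
    refine Coded.induction (P := fun i => i ≤ M.len X + M.len Y →
      (Carry Y (sub X Y) i ↔ Borrow X Y i)) inferInstance ?_ ?_ i
    · simp only [not_borrow_zero, not_carry_zero, implies_true]
    · intro i h1 h2
      have h2 := Num.add_one_le_iff.1 h2
      have h1 := h1 h2.le
      simp only [borrow_succ, carry_succ, hD, h1]
      tauto
  -- Beyond `|X| + |Y|` all bits are zero, and by assumption no borrow leaves that range, so no
  -- carry starts there either.
  have key' : ∀ i, ¬ Carry Y (sub X Y) (M.len X + M.len Y + i) := fun i => by
    refine Coded.induction (P := fun i => ¬ Carry Y (sub X Y) (M.len X + M.len Y + i))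
      inferInstance ?_ ?_ i
    · rw [add_zero, key _ le_rfl]; exact h
    · intro i hi
      have h2 : ¬ M.mem (M.len X + M.len Y + i) Y :=
        not_mem_of_len_le (le_add_self.trans le_self_add)
      have h3 : ¬ M.len X + M.len Y + i < M.len X + M.len Y := not_lt.2 le_self_add
      rw [← add_assoc, carry_succ, hD]
      tauto
  refine str_ext fun i => ?_
  rw [mem_add, hD]
  rcases lt_or_ge i (M.len X + M.len Y) with hi | hi
  · rw [key _ hi.le]
    tauto
  · have h1 := not_mem_of_len_le (X := X) (le_self_add.trans hi)
    have h2 := not_mem_of_len_le (X := Y) (le_add_self.trans hi)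
    obtain ⟨j, rfl⟩ := Num.le_iff.1 hi
    have h3 := key' j
    have := hi.not_gt
    tauto

/-- `2 ^ i · X`. -/
noncomputable def shift (X : M.Str) (i : M.Num) : M.Str :=
  mk (M.len X + i) fun j => ∃ k, k < M.len X ∧ j = i + k ∧ M.mem k X

instance {s : M.Num → M.Str} {t : M.Num → M.Num} [CodedStr s] [CodedNum t] :
    CodedStr fun z => shift (s z) (t z) := by
  have := CodedNum.comp t (fun w : M.Num => fst (fst w))
  have := CodedStr.comp s (fst : M.Num → M.Num)
  have := CodedStr.comp s (fun w : M.Num => fst (fst w))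
  unfold shift; infer_instance

instance (X : M.Str) : CodedStr (shift X) :=
  (inferInstance : CodedStr fun z => shift ((fun _ => X) z) z)

theorem mem_shift {X : M.Str} {i j : M.Num} : M.mem j (shift X i) ↔ ∃ k, j = i + k ∧ M.mem k X := by
  refine mem_mk.trans ⟨fun ⟨_, k, _, h⟩ => ⟨k, h⟩, ?_⟩
  rintro ⟨k, rfl, h⟩
  have := Ax.lt_len _ _ h
  exact ⟨by rw [add_comm i]; gcongr, k, this, rfl, h⟩

theorem shift_zero (X : M.Str) : shift X 0 = X := str_ext fun i => by
  simp only [mem_shift, zero_add, exists_eq_left']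

theorem shift_succ (X : M.Str) (i : M.Num) : shift X (i + 1) = shift X i + shift X i :=
  str_ext fun j => by
    rcases eq_zero_or_succ j with rfl | ⟨j, rfl⟩
    · refine iff_of_false ?_ not_mem_zero_double
      rw [mem_shift]
      rintro ⟨k, h, -⟩
      exact Ax.succ_ne_zero (i + k) (by rw [h]; ring)
    · rw [mem_succ_double, mem_shift, mem_shift]
      refine exists_congr fun k => and_congr_left fun _ => ?_
      rw [add_right_comm, add_left_inj]

theorem shift_add (X Y : M.Str) (i : M.Num) : shift (X + Y) i = shift X i + shift Y i := by
  refine Coded.induction (P := fun i => shift (X + Y) i = shift X i + shift Y i) inferInstance ?_ ?_ i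
  · simp only [shift_zero]
  · intro i h
    rw [shift_succ, shift_succ, shift_succ, h]
    abel

end VSharp

/-! ### Fresh variables, and the semantics of the formulas for arrays and addition. -/

namespace VSharp

/-- A bound for the number variables of a term. -/
def NTerm.nb : NTerm → ℕ
  | .var x => x + 1
  | .zero => 0
  | .one => 0
  | .add s t => max s.nb t.nb
  | .mul s t => max s.nb t.nb
  | .len _ => 0

/-- A bound for the string variables of a term. -/
def NTerm.sb : NTerm → ℕ
  | .var _ => 0
  | .zero => 0
  | .one => 0
  | .add s t => max s.sb t.sb
  | .mul s t => max s.sb t.sb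
  | .len X => X + 1

theorem nb_var (x : ℕ) : (NTerm.var x).nb = x + 1 := rfl
theorem nb_zero : (0 : NTerm).nb = 0 := rfl
theorem nb_one : (1 : NTerm).nb = 0 := rfl
theorem nb_add (s t : NTerm) : (s + t).nb = max s.nb t.nb := rfl
theorem nb_mul (s t : NTerm) : (s * t).nb = max s.nb t.nb := rfl
theorem nb_len (X : ℕ) : (NTerm.len X).nb = 0 := rfl
theorem nb_pr (s t : NTerm) : (pr s t).nb = max s.nb t.nb := by
  simp only [pr, dbl, nb_add, nb_mul, nb_one]; omega
theorem nb_dbl (t : NTerm) : (dbl t).nb = t.nb := by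
  simp only [dbl, nb_add, nb_mul, nb_one]; omega
theorem sb_var (x : ℕ) : (NTerm.var x).sb = 0 := rfl
theorem sb_zero : (0 : NTerm).sb = 0 := rfl
theorem sb_one : (1 : NTerm).sb = 0 := rfl
theorem sb_add (s t : NTerm) : (s + t).sb = max s.sb t.sb := rfl
theorem sb_mul (s t : NTerm) : (s * t).sb = max s.sb t.sb := rfl
theorem sb_pr (s t : NTerm) : (pr s t).sb = max s.sb t.sb := by
  simp only [pr, dbl, sb_add, sb_mul, sb_one]; omega
theorem sb_dbl (t : NTerm) : (dbl t).sb = t.sb := by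
  simp only [dbl, sb_add, sb_mul, sb_one]; omega

variable {M : Struc.{u, v}}

/-- Bound variables are numbered by depth, so a term built outside a quantifier has all its
variables below the fresh index and keeps its value under the quantifier. -/
theorem eval_update_num {t : NTerm} {x : ℕ} (h : t.nb ≤ x) (ν : ℕ → M.Num) (σ : ℕ → M.Str)
    (a : M.Num) : t.eval M (Function.update ν x a) σ = t.eval M ν σ := by
  induction t with
  | var y =>
    have : y ≠ x := by simp only [NTerm.nb] at h; omega
    simp only [NTerm.eval, Function.update_of_ne this]
  | zero => rfl
  | one => rfl
  | add s t hs ht =>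
    simp only [NTerm.nb, max_le_iff] at h
    simp only [NTerm.eval, hs h.1, ht h.2]
  | mul s t hs ht =>
    simp only [NTerm.nb, max_le_iff] at h
    simp only [NTerm.eval, hs h.1, ht h.2]
  | len X => rfl

theorem eval_update_str {t : NTerm} {x : ℕ} (h : t.sb ≤ x) (ν : ℕ → M.Num) (σ : ℕ → M.Str)
    (a : M.Str) : t.eval M ν (Function.update σ x a) = t.eval M ν σ := by
  induction t with
  | var y => rfl
  | zero => rfl
  | one => rfl
  | add s t hs ht =>
    simp only [NTerm.sb, max_le_iff] at h
    simp only [NTerm.eval, hs h.1, ht h.2]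
  | mul s t hs ht =>
    simp only [NTerm.sb, max_le_iff] at h
    simp only [NTerm.eval, hs h.1, ht h.2]
  | len X =>
    have : X ≠ x := by simp only [NTerm.sb] at h; omega
    simp only [NTerm.eval, Function.update_of_ne this]

variable (ν : ℕ → M.Num) (σ : ℕ → M.Str) {d e : ℕ}

theorem sat_fAllLt {t : NTerm} (h : t.nb ≤ d) (F : NTerm → Fm) : Sat M ν σ (fAllLt t F d e) ↔
    ∀ a, a < t.eval M ν σ → Sat M (Function.update ν d a) σ (F (.var d) (d + 1) e) := by
  simp only [fAllLt, sat_fAllN, sat_fImp, sat_fLt, eval_update_num h, eval_var,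
    Function.update_self]

theorem sat_fExLt {t : NTerm} (h : t.nb ≤ d) (F : NTerm → Fm) : Sat M ν σ (fExLt t F d e) ↔
    ∃ a, a < t.eval M ν σ ∧ Sat M (Function.update ν d a) σ (F (.var d) (d + 1) e) := by
  simp only [fExLt, sat_fExN, sat_fAnd, sat_fLt, eval_update_num h, eval_var,
    Function.update_self]

variable [IsModel M]

/-- The formulas compare strings only below a sum of lengths. When that sum bounds both sides, this
is full equality, and each such formula defines the graph of an operation on strings. -/
theorem str_eq_iff_of_lt {X Y : M.Str} {b : M.Num} (hX : M.len X ≤ b) (hY : M.len Y ≤ b) :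
    (∀ i, i < b → (M.mem i X ↔ M.mem i Y)) ↔ X = Y := by
  refine ⟨fun h => str_ext fun i => ?_, fun h i _ => h ▸ Iff.rfl⟩
  rcases lt_or_ge i b with hi | hi
  · exact h i hi
  · exact iff_of_false (not_mem_of_len_le (hX.trans hi)) (not_mem_of_len_le (hY.trans hi))

theorem sat_isRow {i : NTerm} (hi : i.nb ≤ d) (X V : ℕ) :
    Sat M ν σ (isRow i X V d e) ↔ σ V = row (σ X) (i.eval M ν σ) := by
  rw [isRow, sat_fAllLt _ _ (by simp only [nb_add, nb_len]; omega)]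
  simp only [sat_fIff, sat_fMem, eval_pr, eval_var, Function.update_self, eval_update_num hi,
    eval_add, eval_len, ← mem_row]
  exact str_eq_iff_of_lt le_add_self ((len_row_le _ _).trans le_self_add)

/-- The entry `(i, j)` of the matrix `X`. -/
noncomputable def ent (X : M.Str) (i j : M.Num) : M.Str := row X (pair i j)

theorem sat_isEntry {i j : NTerm} (hi : i.nb ≤ d) (hj : j.nb ≤ d) (X V : ℕ) :
    Sat M ν σ (isEntry X i j V d e) ↔ σ V = ent (σ X) (i.eval M ν σ) (j.eval M ν σ) := by
  rw [isEntry, sat_isRow _ _ (by rw [nb_pr]; omega), eval_pr, ent]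

theorem sat_carry {i : NTerm} (hi : i.nb ≤ d) (X Y : ℕ) :
    Sat M ν σ (carry X Y i d e) ↔ Carry (σ X) (σ Y) (i.eval M ν σ) := by
  rw [carry, sat_fExLt _ _ hi]
  simp only [sat_fAnd, sat_fMem, sat_fAllLt _ _ (hi.trans (Nat.le_succ d)), sat_fImp, sat_fOr,
    sat_fLt, eval_var, Function.update_self, eval_update_num hi]
  simp only [Function.update_of_ne (show d ≠ d + 1 by omega), Function.update_self]
  rfl

theorem sat_isAdd (X Y Z : ℕ) : Sat M ν σ (isAdd X Y Z d e) ↔ σ Z = σ X + σ Y := by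
  rw [isAdd, sat_fAllLt _ _ (by simp only [nb_add, nb_len]; omega)]
  simp only [sat_fIff, sat_fMem, sat_carry _ _ (show (NTerm.var d).nb ≤ d + 1 from le_rfl), eval_var,
    Function.update_self, eval_add, eval_len, ← mem_add]
  refine str_eq_iff_of_lt le_add_self (le_trans (len_le_iff.2 fun i hi => ?_) le_self_add)
  exact (mem_mk.1 hi).1

theorem sat_isShift {i : NTerm} (hi : i.nb ≤ d) (X S : ℕ) :
    Sat M ν σ (isShift X i S d e) ↔ σ S = shift (σ X) (i.eval M ν σ) := by
  rw [isShift, sat_fAllLt _ _ (by simp only [nb_add, nb_len]; omega)]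
  have h : (NTerm.len X).nb ≤ d + 1 := Nat.zero_le _
  have hs : ∀ j, M.mem j (shift (σ X) (i.eval M ν σ)) ↔
      ∃ k, k < M.len (σ X) ∧ j = i.eval M ν σ + k ∧ M.mem k (σ X) := fun j => mem_shift.trans
    (exists_congr fun k => ⟨fun h => ⟨Ax.lt_len _ _ h.2, h⟩, fun h => h.2⟩)
  simp only [sat_fIff, sat_fMem, sat_fExLt _ _ h, sat_fAnd, sat_fEq, eval_var,
    Function.update_self, eval_add, eval_len, eval_update_num hi,
    eval_update_num (hi.trans (Nat.le_succ d)), Function.update_of_ne (show d ≠ d + 1 by omega),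
    ← hs]
  exact str_eq_iff_of_lt le_add_self ((len_le_iff.2 fun i hi => (mem_mk.1 hi).1).trans le_self_add)

/-- `W` is the array of the partial sums of `∑_{i ∈ Y} 2^i · X`. -/
def PartialSums (X Y W : M.Str) : Prop :=
  row W 0 = 0 ∧ ∀ i, i < M.len Y → M.mem i Y ∧ row W (i + 1) = row W i + shift X i ∨
    ¬ M.mem i Y ∧ row W i = row W (i + 1)

end VSharp

/-! ### Products of strings, and the semantics of the formulas for integers and matrices. -/

namespace VSharp

variable {M : Struc.{u, v}} [IsModel M] (ν : ℕ → M.Num) (σ : ℕ → M.Str) {d e : ℕ}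

theorem sat_isMul_partialSums {X Y Z : ℕ} (hX : X < e) (hY : Y < e) (hZ : Z < e) :
    Sat M ν σ (isMul X Y Z d e) ↔
      ∃ W, PartialSums (σ X) (σ Y) W ∧ σ Z = row W (M.len (σ Y)) := by
  simp (disch := first | omega | (simp only [nb_zero, nb_one, nb_add, nb_len, nb_var]; omega)) only
    [isMul, sat_fExS, sat_fAnd, sat_fOr, sat_fNot, sat_fEq, sat_isRow, sat_fAllLt, sat_isAdd,
    sat_isShift, sat_fMem, sat_fStrEq, Function.update_self, Function.update_of_ne, eval_var,
    eval_zero, eval_add, eval_one, eval_len, exists_eq_left, len_eq_zero, exists_and_left,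
    PartialSums, and_assoc]

theorem PartialSums.unique {X Y W W' : M.Str} (h : PartialSums X Y W) (h' : PartialSums X Y W')
    {i : M.Num} : i ≤ M.len Y → row W i = row W' i := by
  refine Coded.induction (P := fun i => i ≤ M.len Y → row W i = row W' i) inferInstance
    (fun _ => by rw [h.1, h'.1]) (fun i hi hi' => ?_) i
  have hi' := Num.add_one_le_iff.1 hi'
  have hi := hi hi'.le
  rcases h.2 i hi' with ⟨h1, h2⟩ | ⟨h1, h2⟩ <;> rcases h'.2 i hi' with ⟨h3, h4⟩ | ⟨h3, h4⟩
  · rw [h2, h4, hi]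
  · exact absurd h1 h3
  · exact absurd h3 h1
  · rw [← h2, ← h4, hi]

theorem exists_partialSums (X Y : M.Str) : ∃ W, PartialSums X Y W := by
  have h := IsModel.models (M := M) stringMultiplication (Or.inr (Or.inl rfl)) (fun _ => 0)
    (anyStr M) X Y
  obtain ⟨Z, h⟩ := h
  obtain ⟨W, hW, -⟩ := (sat_isMul_partialSums _ _ (by omega) (by omega) (by omega)).1 h
  exact ⟨W, hW⟩

noncomputable instance : Mul M.Str :=
  ⟨fun X Y => row (Classical.choose (exists_partialSums X Y)) (M.len Y)⟩

theorem PartialSums.mul_eq {X Y W : M.Str} (h : PartialSums X Y W) : X * Y = row W (M.len Y) :=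
  (Classical.choose_spec (exists_partialSums X Y)).unique h le_rfl

theorem sat_isMul {X Y Z : ℕ} (hX : X < e) (hY : Y < e) (hZ : Z < e) :
    Sat M ν σ (isMul X Y Z d e) ↔ σ Z = σ X * σ Y := by
  rw [sat_isMul_partialSums _ _ hX hY hZ]
  constructor
  · rintro ⟨W, hW, h⟩
    rw [h, hW.mul_eq]
  · intro h
    obtain ⟨W, hW⟩ := exists_partialSums (σ X) (σ Y)
    exact ⟨W, hW, by rw [h, hW.mul_eq]⟩

/-- The magnitude of the integer code `X`. -/
noncomputable def half (X : M.Str) : M.Str := mk (M.len X) fun i => M.mem (i + 1) X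

open Classical in
/-- The positive part of the integer code `X`. -/
noncomputable def posPart (X : M.Str) : M.Str := if M.mem 0 X then 0 else half X

open Classical in
/-- The negative part of the integer code `X`. -/
noncomputable def negPart (X : M.Str) : M.Str := if M.mem 0 X then half X else 0

instance {s : M.Num → M.Str} [CodedStr s] : CodedStr fun z => half (s z) := by
  have := CodedStr.comp s (fst : M.Num → M.Num)
  unfold half; infer_instance

instance {s : M.Num → M.Str} [CodedStr s] : CodedStr fun z => posPart (s z) := by
  unfold posPart; infer_instance

instance {s : M.Num → M.Str} [CodedStr s] : CodedStr fun z => negPart (s z) := by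
  unfold negPart; infer_instance

theorem mem_half {X : M.Str} {i : M.Num} : M.mem i (half X) ↔ M.mem (i + 1) X :=
  mem_mk.trans ⟨fun h => h.2, fun h =>
    ⟨(Num.lt_add_one_iff.2 le_rfl).trans (Ax.lt_len _ _ h), h⟩⟩

theorem half_double (X : M.Str) : half (X + X) = X := str_ext fun i => by
  rw [mem_half, mem_succ_double]

theorem half_double_add_one (X : M.Str) : half (X + X + 1) = X := str_ext fun i => by
  rw [mem_half, mem_double_add_one, mem_succ_double, or_iff_right (Ax.succ_ne_zero i)]

theorem eq_double_half {X : M.Str} (h : ¬ M.mem 0 X) : X = half X + half X := str_ext fun i => by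
  rcases eq_zero_or_succ i with rfl | ⟨i, rfl⟩
  · exact iff_of_false h not_mem_zero_double
  · rw [mem_succ_double, mem_half]

theorem eq_double_half_add_one {X : M.Str} (h : M.mem 0 X) : X = half X + half X + 1 :=
  str_ext fun i => by
    rcases eq_zero_or_succ i with rfl | ⟨i, rfl⟩
    · exact iff_of_true h (mem_double_add_one.2 (Or.inl rfl))
    · rw [mem_double_add_one, mem_succ_double, mem_half, or_iff_right (Ax.succ_ne_zero i)]

theorem len_eq_one {X : M.Str} : M.len X = 1 ↔ X = 1 := by
  constructor
  · intro h
    refine str_ext fun i => Iff.trans ?_ mem_one.symm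
    constructor
    swap
    · rintro rfl
      exact Ax.mem_of_len _ _ (by rw [h, zero_add])
    · intro hi
      have := Ax.lt_len _ _ hi
      rwa [h, ← zero_add (1 : M.Num), Num.lt_add_one_iff, nonpos_iff_eq_zero] at this
  · rintro rfl
    refine le_antisymm (len_le_iff.2 fun i hi => ?_) ?_
    · rw [mem_one.1 hi]; exact one_pos
    · rw [← zero_add (1 : M.Num), Num.add_one_le_iff]
      exact Ax.lt_len _ _ (mem_one.2 rfl)

/-- The semantics of `isIntAdd`. -/
def IntAdd (X Y Z : M.Str) : Prop := (X ≠ 1 ∧ Y ≠ 1 ∧ Z ≠ 1) ∧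
  posPart X + posPart Y + negPart Z = negPart X + negPart Y + posPart Z

/-- The semantics of `isIntMul`. -/
def IntMul (X Y Z : M.Str) : Prop := (X ≠ 1 ∧ Y ≠ 1 ∧ Z ≠ 1) ∧ half Z = half X * half Y ∧
  (Z = 0 ∨ (M.mem 0 Z ↔ ¬ (M.mem 0 X ↔ M.mem 0 Y)))

/-- The semantics of `isMatMul`. -/
def MatMul (a b c : M.Num) (X Y Z : M.Str) : Prop := ∃ W, ∀ i, i < a → ∀ j, j < c →
  row W (pair (pair i j) 0) = 0 ∧
  (∀ k, k < b → ∃ p, IntMul (ent X i k) (ent Y k j) p ∧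
    IntAdd (row W (pair (pair i j) k)) p (row W (pair (pair i j) (k + 1)))) ∧
  ent Z i j = row W (pair (pair i j) b)

/-- The semantics of `isIdentity`. -/
def IdMat (m : M.Num) (X : M.Str) : Prop := ∀ i, i < m → ∀ j, j < m →
  i = j ∧ ent X i j = 1 + 1 ∨ ¬ i = j ∧ ent X i j = 0

/-- The semantics of `isMatPow`. -/
def MatPow (m : M.Num) (X : M.Str) (n : M.Num) (Y : M.Str) : Prop := ∃ P, IdMat m (row P 0) ∧
  (∀ t, t < n → MatMul m m m (row P t) X (row P (t + 1))) ∧ Y = row P n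

/-- The semantics of `isMatrix`. -/
def IsMat (a b : M.Num) (X : M.Str) : Prop := ∀ i, i < a → ∀ j, j < b → ent X i j ≠ 1

theorem sat_isInt (X : ℕ) : Sat M ν σ (isInt X d e) ↔ σ X ≠ 1 := by
  exact not_congr len_eq_one

theorem sat_isMag (X U : ℕ) : Sat M ν σ (isMag X U d e) ↔ σ U = half (σ X) := by
  rw [isMag, sat_fAllLt _ _ (by simp only [nb_add, nb_len]; omega)]
  simp only [sat_fIff, sat_fMem, eval_var, Function.update_self, eval_add, eval_len, eval_one,
    ← mem_half]
  exact str_eq_iff_of_lt le_add_self ((len_le_iff.2 fun i hi => (mem_mk.1 hi).1).trans le_self_add)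

theorem sat_isPos (X U : ℕ) : Sat M ν σ (isPos X U d e) ↔ σ U = posPart (σ X) := by
  simp only [isPos, sat_fOr, sat_fAnd, sat_fNot, sat_fMem, sat_isMag, sat_fEq, eval_len, eval_zero,
    posPart, len_eq_zero]
  by_cases h : M.mem 0 (σ X) <;> simp [h]

theorem sat_isNeg (X U : ℕ) : Sat M ν σ (isNeg X U d e) ↔ σ U = negPart (σ X) := by
  simp only [isNeg, sat_fOr, sat_fAnd, sat_fNot, sat_fMem, sat_isMag, sat_fEq, eval_len, eval_zero,
    negPart, len_eq_zero]
  by_cases h : M.mem 0 (σ X) <;> simp [h]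

theorem sat_isIntZero (X : ℕ) : Sat M ν σ (isIntZero X d e) ↔ σ X = 0 := by
  simp only [isIntZero, sat_fEq, eval_len, eval_zero, len_eq_zero]

theorem sat_isIntOne (X : ℕ) : Sat M ν σ (isIntOne X d e) ↔ σ X = 1 + 1 := by
  simp only [isIntOne, sat_fAllN, sat_fIff, sat_fMem, sat_fEq, eval_one, eval_var,
    Function.update_self]
  have : ∀ i : M.Num, M.mem i (1 + 1) ↔ i = 1 := fun i => by
    rcases eq_zero_or_succ i with rfl | ⟨i, rfl⟩
    · exact iff_of_false not_mem_zero_double zero_ne_one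
    · rw [mem_succ_double, mem_one, add_eq_right]
  simp only [← this]
  exact ⟨str_ext, fun h i => h ▸ Iff.rfl⟩

theorem sat_isIntAdd {X Y Z : ℕ} (hX : X < e) (hY : Y < e) (hZ : Z < e) :
    Sat M ν σ (isIntAdd X Y Z d e) ↔ IntAdd (σ X) (σ Y) (σ Z) := by
  simp (disch := omega) only
    [isIntAdd, sat_isInt, sat_fExS, sat_fAnd, sat_isPos, sat_isNeg, sat_isAdd,
    Function.update_self, Function.update_of_ne, IntAdd, exists_and_left, exists_eq_left, and_assoc]

theorem sat_isIntMul {X Y Z : ℕ} (hX : X < e) (hY : Y < e) (hZ : Z < e) :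
    Sat M ν σ (isIntMul X Y Z d e) ↔ IntMul (σ X) (σ Y) (σ Z) := by
  simp (disch := omega) only
    [isIntMul, sat_isInt, sat_fExS, sat_fAnd, sat_fOr, sat_fIff, sat_fNot, sat_fMem, sat_isMag,
    sat_isIntZero, sat_isMul,
    Function.update_self, Function.update_of_ne, IntMul, exists_and_left, exists_eq_left, and_assoc,
    eval_zero]

theorem sat_isIntOpp {X Z : ℕ} (hX : X < e) (hZ : Z < e) :
    Sat M ν σ (isIntOpp X Z d e) ↔ IntAdd (σ X) (σ Z) 0 := by
  simp (disch := omega) only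
    [isIntOpp, sat_fExS, sat_fAnd, sat_isIntZero, sat_isIntAdd,
    Function.update_self, Function.update_of_ne, exists_eq_left]

theorem sat_isMatrix {a b : NTerm} {X : ℕ} (ha : a.nb ≤ d) (hb : b.nb ≤ d) (hX : X < e) :
    Sat M ν σ (isMatrix a b X d e) ↔ IsMat (a.eval M ν σ) (b.eval M ν σ) (σ X) := by
  simp (disch := first | omega | (simp only [nb_var]; omega)) only
    [isMatrix, sat_fAllLt, sat_fExS, sat_fAnd, sat_isEntry, sat_isInt, eval_var, eval_update_num,
    Function.update_self, Function.update_of_ne, exists_eq_left, IsMat]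

theorem sat_isMatMul {a b c : NTerm} {X Y Z : ℕ} (ha : a.nb ≤ d) (hb : b.nb ≤ d) (hc : c.nb ≤ d)
    (ha' : a.sb ≤ e) (hb' : b.sb ≤ e) (hc' : c.sb ≤ e) (hX : X < e) (hY : Y < e) (hZ : Z < e) :
    Sat M ν σ (isMatMul a b c X Y Z d e) ↔
      MatMul (a.eval M ν σ) (b.eval M ν σ) (c.eval M ν σ) (σ X) (σ Y) (σ Z) := by
  simp (disch := first | omega | (simp only [nb_var, nb_pr, nb_zero, nb_add, nb_one]; omega)) only
    [isMatMul, sat_fAllLt, sat_fExS, sat_fAnd, sat_isEntry, sat_isRow, sat_isIntZero, sat_isIntMul,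
    sat_isIntAdd, eval_var, eval_update_num, eval_update_str, eval_pr, eval_zero, eval_add, eval_one,
    Function.update_self, Function.update_of_ne, exists_eq_left, exists_and_left, MatMul]

theorem sat_isIdentity {m : NTerm} {X : ℕ} (hm : m.nb ≤ d) (hX : X < e) :
    Sat M ν σ (isIdentity m X d e) ↔ IdMat (m.eval M ν σ) (σ X) := by
  simp (disch := first | omega | (simp only [nb_var]; omega)) only
    [isIdentity, sat_fAllLt, sat_fExS, sat_fAnd, sat_fOr, sat_fEq, sat_fNot, sat_isEntry,
    sat_isIntZero, sat_isIntOne, eval_var, eval_update_num,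
    Function.update_self, Function.update_of_ne, exists_eq_left, IdMat]

theorem sat_isMatPow {m n : NTerm} {X Y : ℕ} (hm : m.nb ≤ d) (hn : n.nb ≤ d) (hm' : m.sb ≤ e)
    (hn' : n.sb ≤ e) (hX : X < e) (hY : Y < e) :
    Sat M ν σ (isMatPow m X n Y d e) ↔
      MatPow (m.eval M ν σ) (σ X) (n.eval M ν σ) (σ Y) := by
  simp (disch := first | omega | (simp only [nb_var, nb_zero, nb_add, nb_one]; omega)) only
    [isMatPow, sat_fAllLt, sat_fExS, sat_fAnd, sat_isRow, sat_isIdentity, sat_isMatMul,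
    eval_var, eval_update_num, eval_update_str, eval_zero, eval_add, eval_one,
    Function.update_self, Function.update_of_ne, exists_eq_left, exists_and_left, MatPow]

theorem exists_matPow {m : M.Num} {X : M.Str} (hX : IsMat m m X) (n : M.Num) :
    ∃ Y, MatPow m X n Y := by
  have h := IsModel.models (M := M) matrixPowering (Or.inr (Or.inr rfl)) (fun _ => 0)
    (anyStr M)
  have h := h m X ((sat_isMatrix _ _ (by simp only [nb_var]; omega) (by simp only [nb_var]; omega)
    (by omega)).2 hX) n
  obtain ⟨Y, h⟩ := h
  exact ⟨Y, (sat_isMatPow _ _ (by simp only [nb_var]; omega) (by simp only [nb_var]; omega)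
    (by simp only [sb_var]; omega) (by simp only [sb_var]; omega) (by omega) (by omega)).1 h⟩

end VSharp

/-! ### The strings as a commutative semiring. -/

namespace VSharp

variable {M : Struc.{u, v}} [IsModel M]

-- The partial sums are continued as a constant beyond `|Y|`. Two products with multipliers of
-- different lengths can then be compared at a common index.
open Classical in
theorem exists_partial_products (X Y : M.Str) : ∃ S : M.Num → M.Str, CodedStr S ∧ S 0 = 0 ∧
    (∀ i, S (i + 1) = S i + if M.mem i Y then shift X i else 0) ∧
    ∀ i, M.len Y ≤ i → S i = X * Y := by
  obtain ⟨W, hW⟩ := exists_partialSums X Y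
  refine ⟨fun i => if i ≤ M.len Y then row W i else row W (M.len Y), inferInstance, ?_, fun i => ?_,
    fun i hi => ?_⟩
  · simp only [zero_le, if_true, hW.1]
  · simp only [Num.add_one_le_iff]
    rcases lt_or_ge i (M.len Y) with hi | hi
    · rw [if_pos hi, if_pos hi.le]
      rcases hW.2 i hi with ⟨h, h'⟩ | ⟨h, h'⟩
      · rw [if_pos h, h']
      · rw [if_neg h, h', add_zero]
    · rw [if_neg hi.not_gt, if_neg (not_mem_of_len_le hi), add_zero]
      split_ifs with h
      · rw [le_antisymm h hi]
      · rfl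
  · rw [hW.mul_eq]
    dsimp only
    split_ifs with h
    · rw [le_antisymm h hi]
    · rfl

theorem Str.mul_add (X Y Z : M.Str) : X * (Y + Z) = X * Y + X * Z := by
  classical
  obtain ⟨S, hS, hS0, hS1, hS2⟩ := exists_partial_products X Y
  obtain ⟨T, hT, hT0, hT1, hT2⟩ := exists_partial_products X Z
  obtain ⟨U, hU, hU0, hU1, hU2⟩ := exists_partial_products X (Y + Z)
  -- The part of `Y + Z` below bit `i` is the sum of the parts of `Y` and `Z`, except for the carry
  -- into bit `i`, which has weight `2^i`.
  have key : ∀ i, U i + (if Carry Y Z i then shift X i else 0) = S i + T i := fun i => by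
    refine Coded.induction (P := fun i => U i + (if Carry Y Z i then shift X i else 0) = S i + T i)
      inferInstance ?_ ?_ i
    · simp only [not_carry_zero, if_false, hS0, hT0, hU0, add_zero]
    · intro i hi
      rw [hU1, hS1, hT1, add_add_add_comm (S i), ← hi, shift_succ]
      simp only [mem_add, carry_succ]
      by_cases h1 : M.mem i Y <;> by_cases h2 : M.mem i Z <;> by_cases h3 : Carry Y Z i <;>
        simp [h1, h2, h3] <;> abel
  have hlen : M.len (Y + Z) ≤ M.len Y + M.len Z := len_le_iff.2 fun i hi => (mem_mk.1 hi).1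
  have := key (M.len Y + M.len Z)
  rwa [if_neg (not_carry_of_le le_rfl), add_zero, hU2 _ hlen, hS2 _ le_self_add,
    hT2 _ le_add_self] at this

theorem Str.add_mul (X Y Z : M.Str) : (X + Y) * Z = X * Z + Y * Z := by
  classical
  obtain ⟨S, hS, hS0, hS1, hS2⟩ := exists_partial_products X Z
  obtain ⟨T, hT, hT0, hT1, hT2⟩ := exists_partial_products Y Z
  obtain ⟨U, hU, hU0, hU1, hU2⟩ := exists_partial_products (X + Y) Z
  have key : ∀ i, U i = S i + T i := fun i => by
    refine Coded.induction (P := fun i => U i = S i + T i) inferInstance ?_ ?_ i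
    · rw [hS0, hT0, hU0, add_zero]
    · intro i hi
      rw [hU1, hS1, hT1, hi, shift_add]
      split_ifs
      · abel
      · simp only [add_zero]
  rw [← hU2 _ le_rfl, ← hS2 _ le_rfl, ← hT2 _ le_rfl, key]

theorem Str.mul_zero (X : M.Str) : X * 0 = 0 := by
  have := Str.mul_add X 0 0
  rw [add_zero] at this
  exact (left_eq_add.1 this)

theorem Str.zero_mul (X : M.Str) : 0 * X = 0 := by
  have := Str.add_mul 0 0 X
  rw [add_zero] at this
  exact (left_eq_add.1 this)

theorem len_one : M.len (1 : M.Str) = 1 := len_eq_one.2 rfl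

theorem Str.mul_one (X : M.Str) : X * 1 = X := by
  obtain ⟨S, hS, hS0, hS1, hS2⟩ := exists_partial_products X 1
  have h := hS1 0
  rwa [zero_add, hS2 1 len_one.le, hS0, if_pos (mem_one.2 rfl), zero_add, shift_zero] at h

theorem Str.one_mul (X : M.Str) : 1 * X = X := by
  obtain ⟨S, hS, hS0, hS1, hS2⟩ := exists_partial_products 1 X
  have hm : ∀ i j, M.mem j (mk i fun j => M.mem j X) ↔ j < i ∧ M.mem j X := fun i j => mem_mk
  -- The `i`-th partial sum of `1 · X` consists of the bits of `X` below `i`. The next summand is a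
  -- single bit at `i`, so no carry arises.
  have key : ∀ i, S i = mk i fun j => M.mem j X := fun i => by
    refine Coded.induction (P := fun i => S i = mk i fun j => M.mem j X) inferInstance ?_ ?_ i
    · rw [hS0]
      exact str_ext fun j => iff_of_false (not_mem_zero j) fun h => not_lt_zero ((hm _ _).1 h).1
    · intro i hi
      have hs : ∀ j, M.mem j (shift 1 i) ↔ j = i := fun j => by
        simp only [mem_shift, mem_one, exists_eq_right, add_zero]
      rw [hS1, hi]
      refine str_ext fun j => ?_
      split_ifs with h
      · rw [mem_add_of_disjoint, hm, hm, hs, Num.lt_add_one_iff, le_iff_lt_or_eq]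
        · constructor
          · rintro (h' | rfl)
            · exact ⟨Or.inl h'.1, h'.2⟩
            · exact ⟨Or.inr rfl, h⟩
          · rintro ⟨h1 | h1, h2⟩
            · exact Or.inl ⟨h1, h2⟩
            · exact Or.inr h1
        · intro j hj hj'
          rw [hs] at hj'
          exact absurd ((hm _ _).1 hj).1 hj'.not_lt
      · rw [add_zero, hm, hm, Num.lt_add_one_iff, le_iff_lt_or_eq]
        exact ⟨fun h => ⟨Or.inl h.1, h.2⟩, fun ⟨h1, h2⟩ => ⟨h1.resolve_right fun h' => h (h' ▸ h2),
          h2⟩⟩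
  rw [← hS2 _ le_rfl, key]
  exact str_ext fun j => (hm _ _).trans ⟨fun h => h.2, fun h => ⟨Ax.lt_len _ _ h, h⟩⟩

theorem posPart_double (X : M.Str) : posPart (X + X) = X := by
  rw [posPart, if_neg not_mem_zero_double, half_double]

theorem negPart_double (X : M.Str) : negPart (X + X) = 0 := by
  rw [negPart, if_neg not_mem_zero_double]

theorem Str.eq_zero_of_add {X Y : M.Str} (h : X + Y = 0) : X = 0 := by
  by_contra h0
  have h1 : ∃ i, M.mem i X := by
    by_contra h'
    push Not at h'
    exact h0 (len_eq_zero.1 (len_eq_zero_iff.2 h'))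
  obtain ⟨i, hi⟩ := h1
  have key : ∀ j, Carry X Y (i + 1 + j) := fun j => by
    have hbit : ∀ i, ((M.mem i X ↔ M.mem i Y) ↔ Carry X Y i) → False := fun i hi =>
      not_mem_zero i (h ▸ mem_add.2 hi)
    refine Coded.induction (P := fun j => Carry X Y (i + 1 + j)) inferInstance ?_ ?_ j
    · rw [add_zero, carry_succ]
      have := hbit i
      tauto
    · intro j hj
      rw [← add_assoc, carry_succ]
      have := hbit (i + 1 + j)
      tauto
  exact not_carry_of_le le_add_self (key (M.len X + M.len Y))

theorem double_ne_one (X : M.Str) : X + X ≠ 1 := fun h =>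
  not_mem_zero_double (X := X) (h ▸ mem_one.2 rfl)

/-- A nonnegative integer `X` has the code `X + X`: sign bit `0`, and the magnitude moved up by one
bit. In this way Matrix Powering, an axiom about integers, is applied to binary numbers before the
ring of integers is available. -/
theorem IntAdd.eq_double {X Y Z : M.Str} (h : IntAdd (X + X) (Y + Y) Z) : Z = X + Y + (X + Y) := by
  obtain ⟨⟨-, -, hZ⟩, h⟩ := h
  simp only [posPart_double, negPart_double, zero_add] at h
  by_cases h0 : M.mem 0 Z
  · rw [posPart, negPart, if_pos h0, if_pos h0, add_comm] at h
    have := eq_double_half_add_one h0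
    rw [Str.eq_zero_of_add h, zero_add, zero_add] at this
    exact absurd this hZ
  · rw [posPart, negPart, if_neg h0, if_neg h0, add_zero] at h
    rw [h]
    exact eq_double_half h0

theorem IntMul.eq_double {X Y Z : M.Str} (h : IntMul (X + X) (Y + Y) Z) : Z = X * Y + X * Y := by
  obtain ⟨⟨-, -, hZ⟩, h, h'⟩ := h
  rw [half_double, half_double] at h
  simp only [not_mem_zero_double, not_true, iff_false] at h'
  rcases h' with rfl | h'
  · rw [← h]
    exact eq_double_half (not_mem_zero 0)
  · rw [← h]
    exact eq_double_half h'

/-- The product of the coded functions `f`, `g` is an entry of the square of the matrix with the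
entries `f p` at `(⟨0, p⟩, ⟨1, p⟩)` and `g p` at `(⟨1, p⟩, ⟨2, p⟩)`. -/
theorem exists_products (f g : M.Num → M.Str) [CodedStr f] [CodedStr g] (b : M.Num) :
    ∃ s : M.Num → M.Str, CodedStr s ∧ ∀ p, p < b → f p * g p = s p := by
  classical
  have hcoded : ∀ W : M.Str, CodedStr fun p => half (row W (pair (pair (pair 0 p) (pair (1 + 1) p))
      (pair 1 p + 1))) := fun _ => inferInstance
  have := CodedStr.comp f (snd : M.Num → M.Num)
  have := CodedStr.comp g (snd : M.Num → M.Num)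
  -- For each `p` there is one path from `⟨0, p⟩` through `⟨1, p⟩` to `⟨2, p⟩`, with weights `f p`
  -- and `g p`, and there are no other nonzero entries.
  let A : M.Num → M.Num → M.Str := fun i j =>
    if fst i = 0 ∧ j = pair 1 (snd i) then f (snd i) else
    if fst i = 1 ∧ j = pair (1 + 1) (snd i) then g (snd i) else 0
  have hA : CodedStr fun w => A (fst w) (snd w) := by
    have := CodedStr.comp f (fun w : M.Num => snd (fst w))
    have := CodedStr.comp g (fun w : M.Num => snd (fst w))
    simp only [A]
    infer_instance
  set N : M.Num := pair (1 + 1 + 1) b with hN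
  obtain ⟨X, hX⟩ := exists_matrix (fun i j => A i j + A i j) N N
  replace hX : ∀ i, i < N → ∀ j, j < N → ent X i j = A i j + A i j := hX
  obtain ⟨Y, P, hP0, hP, -⟩ := exists_matPow (m := N) (X := X)
    (fun i hi j hj => hX i hi j hj ▸ double_ne_one _) (1 + 1)
  have hlt : (0 : M.Num) < 1 + 1 := by positivity
  have hlt' : (1 : M.Num) < 1 + 1 := Num.lt_add_one_iff.2 le_rfl
  -- the first power
  obtain ⟨V, hV⟩ := hP 0 hlt
  rw [zero_add] at hV
  have hU : ∀ i, i < N → ∀ j, j < N → ent (row P 1) i j = A i j + A i j := by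
    intro i hi j hj
    obtain ⟨hV0, hV1, hV2⟩ := hV i hi j hj
    have key : ∀ k, k ≤ N → row V (pair (pair i j) k) = if i < k then A i j + A i j else 0 :=
      fun k => by
        refine Coded.induction (P := fun k => k ≤ N →
          row V (pair (pair i j) k) = if i < k then A i j + A i j else 0) inferInstance ?_ ?_ k
        · intro _
          rw [hV0, if_neg not_lt_zero]
        · intro k hk hkN
          have hkN := Num.add_one_le_iff.1 hkN
          have hk := hk hkN.le
          obtain ⟨p, hp, hp'⟩ := hV1 k hkN
          rw [hX k hkN j hj] at hp
          rcases hP0 i hi k hkN with ⟨rfl, h⟩ | ⟨h, h'⟩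
          · rw [h] at hp
            rw [hk, if_neg (lt_irrefl i), ← add_zero (0 : M.Str), hp.eq_double, Str.one_mul] at hp'
            rw [hp'.eq_double, zero_add, if_pos (Num.lt_add_one_iff.2 le_rfl)]
          · rw [h', ← add_zero (0 : M.Str)] at hp
            have h0 := hp.eq_double
            rw [Str.zero_mul] at h0
            rw [h0, hk, show (if i < k then A i j + A i j else 0) =
              (if i < k then A i j else 0) + if i < k then A i j else 0 by
                split_ifs <;> simp] at hp'
            rw [hp'.eq_double, add_zero]
            simp only [Num.lt_add_one_iff, le_iff_lt_or_eq, h, or_false]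
            split_ifs <;> simp
    rw [hV2, key N le_rfl, if_pos hi]
  -- the second power
  obtain ⟨W, hW⟩ := hP 1 hlt'
  -- The partial sum is read off just after index `⟨1, p⟩`, where the only nonzero term enters, so
  -- the remaining terms need not be examined. As part of one array it depends on `p` in a coded
  -- way.
  refine ⟨fun p => half (row W (pair (pair (pair 0 p) (pair (1 + 1) p)) (pair 1 p + 1))),
    hcoded W, fun p hp => ?_⟩
  have h0N : pair 0 p < N := pair_lt_pair (by positivity) hp
  have h1N : pair 1 p < N := pair_lt_pair (hlt'.trans (Num.lt_add_one_iff.2 le_rfl)) hp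
  have h2N : pair (1 + 1) p < N := pair_lt_pair (Num.lt_add_one_iff.2 le_rfl) hp
  obtain ⟨hW0, hW1, -⟩ := hW _ h0N _ h2N
  have hA1 : ∀ k, k ≠ pair 1 p → A (pair 0 p) k = 0 := fun k hk => by
    simp only [A, fst_pair, snd_pair, hk, and_false, if_false, zero_ne_one, false_and]
  have key : ∀ k, k ≤ pair 1 p → row W (pair (pair (pair 0 p) (pair (1 + 1) p)) k) = 0 := fun k => by
    refine Coded.induction (P := fun k => k ≤ pair 1 p →
      row W (pair (pair (pair 0 p) (pair (1 + 1) p)) k) = 0) inferInstance (fun _ => hW0) ?_ k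
    intro k hk hk'
    have hk' := Num.add_one_le_iff.1 hk'
    have hk := hk hk'.le
    have hkN := hk'.trans h1N
    obtain ⟨q, hq, hq'⟩ := hW1 k hkN
    rw [hU _ h0N k hkN, hX k hkN _ h2N, hA1 k hk'.ne] at hq
    have hq := hq.eq_double
    rw [Str.zero_mul] at hq
    rw [hk, hq, add_zero] at hq'
    have := IntAdd.eq_double (M := M) (X := 0) (Y := 0) (by rw [add_zero]; exact hq')
    simpa only [add_zero] using this
  obtain ⟨q, hq, hq'⟩ := hW1 _ h1N
  rw [hU _ h0N _ h1N, hX _ h1N _ h2N] at hq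
  have hq := hq.eq_double
  rw [key _ le_rfl, hq] at hq'
  have hq' := IntAdd.eq_double (M := M) (X := 0) (Y := A (pair 0 p) (pair 1 p) *
    A (pair 1 p) (pair (1 + 1) p)) (by rw [add_zero]; exact hq')
  simp only [hq', half_double, zero_add]
  simp only [A, fst_pair, snd_pair, true_and, if_true, one_ne_zero, false_and, if_false]

instance CodedStr.mul {f g : M.Num → M.Str} [CodedStr f] [CodedStr g] :
    CodedStr fun z => f z * g z := .of_local (exists_products f g)

/-- `X` without its `k` lowest bits. -/
noncomputable def drop (X : M.Str) (k : M.Num) : M.Str := mk (M.len X) fun i => M.mem (i + k) X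

instance (X : M.Str) : CodedStr (drop X) := by unfold drop; infer_instance

theorem mem_drop {X : M.Str} {i k : M.Num} : M.mem i (drop X k) ↔ M.mem (i + k) X :=
  mem_mk.trans ⟨fun h => h.2, fun h => ⟨le_self_add.trans_lt (Ax.lt_len _ _ h), h⟩⟩

/-- Induction on the number of remaining bits: `drop Y j` is twice `drop Y (j + 1)`, plus the bit of
`Y` at `j`. The assumption `hP` turns this into induction over numbers. For statements about
products it is met because products of coded functions are coded. -/
theorem binary_induction {P : M.Str → Prop} (Y : M.Str) (hP : Coded fun k => P (drop Y k))
    (h0 : P 0) (hd : ∀ U, P U → P (U + U)) (hs : ∀ U, P U → P (U + U + 1)) : P Y := by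
  have key : ∀ k j, j ≤ M.len Y → M.len Y ≤ j + k → P (drop Y j) := fun k => by
    have h0' : ∀ j, M.len Y ≤ j → P (drop Y j) := fun j hj => by
      rwa [show drop Y j = 0 from str_ext fun i =>
        iff_of_false (fun h => not_mem_of_len_le (hj.trans le_add_self) (mem_drop.1 h))
          (not_mem_zero i)]
    have := hP.comp snd
    refine Coded.induction (P := fun k => ∀ j, j ≤ M.len Y → M.len Y ≤ j + k → P (drop Y j))
      inferInstance (fun j _ hj => h0' j (by rwa [add_zero] at hj)) (fun k hk j hj hj' => ?_) k
    rcases hj.eq_or_lt with rfl | hj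
    · exact h0' _ le_rfl
    · have hPj := hk (j + 1) (Num.add_one_le_iff.2 hj) (by rwa [add_right_comm, add_assoc])
      have hh : half (drop Y j) = drop Y (j + 1) := str_ext fun i => by
        rw [mem_half, mem_drop, mem_drop, add_right_comm, add_assoc]
      by_cases hbit : M.mem 0 (drop Y j)
      · rw [eq_double_half_add_one hbit, hh]
        exact hs _ hPj
      · rw [eq_double_half hbit, hh]
        exact hd _ hPj
  have := key (M.len Y) 0 zero_le (by rw [zero_add])
  rwa [show drop Y 0 = Y from str_ext fun i => by rw [mem_drop, add_zero]] at this

theorem Str.mul_comm (X Y : M.Str) : X * Y = Y * X := by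
  refine binary_induction (P := fun Y => X * Y = Y * X) Y inferInstance ?_ ?_ ?_
  · rw [Str.mul_zero, Str.zero_mul]
  · intro U h
    rw [Str.mul_add, Str.add_mul, h]
  · intro U h
    rw [Str.mul_add, Str.add_mul, Str.mul_add, Str.add_mul, h, Str.mul_one, Str.one_mul]

theorem Str.mul_assoc (X Y Z : M.Str) : X * Y * Z = X * (Y * Z) := by
  refine binary_induction (P := fun Z => X * Y * Z = X * (Y * Z)) Z inferInstance ?_ ?_ ?_
  · simp only [Str.mul_zero]
  · intro U h
    simp only [Str.mul_add, h]
  · intro U h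
    simp only [Str.mul_add, h, Str.mul_one]

noncomputable instance : CommSemiring M.Str where
  left_distrib := Str.mul_add
  right_distrib := Str.add_mul
  zero_mul := Str.zero_mul
  mul_zero := Str.mul_zero
  mul_assoc := Str.mul_assoc
  one_mul := Str.one_mul
  mul_one := Str.mul_one
  mul_comm := Str.mul_comm

end VSharp

/-! ### The ring of integers and its codes. -/

namespace VSharp

section Grothendieck

variable (S : Type*) [CommSemiring S] [IsCancelAdd S]

/-- Pairs of elements of a cancellative semiring with the same difference. -/
def diffSetoid : Setoid (S × S) where
  r a b := a.1 + b.2 = b.1 + a.2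
  iseqv := {
    refl _ := rfl
    symm h := h.symm
    trans {a b c} h h' := by
      have : a.1 + c.2 + b.2 = c.1 + a.2 + b.2 := by linear_combination h + h'
      exact add_right_cancel this }

/-- The ring of differences of a cancellative commutative semiring. -/
def DiffRing : Type _ := Quotient (diffSetoid S)

variable {S}

namespace DiffRing

/-- The difference `a - b`. -/
def diff (a b : S) : DiffRing S := Quotient.mk (diffSetoid S) (a, b)

theorem diff_eq {a b c d : S} : diff a b = diff c d ↔ a + d = c + b := Quotient.eq (r := diffSetoid S)

theorem exists_diff (x : DiffRing S) : ∃ a b, x = diff a b :=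
  Quotient.inductionOn x fun p => ⟨p.1, p.2, rfl⟩

instance : Zero (DiffRing S) := ⟨diff 0 0⟩
instance : One (DiffRing S) := ⟨diff 1 0⟩
instance : Neg (DiffRing S) := ⟨Quotient.map (fun a => (a.2, a.1)) fun a b h => by
  change a.1 + b.2 = b.1 + a.2 at h
  change a.2 + b.1 = b.2 + a.1
  rw [add_comm, ← h, add_comm]⟩
instance : Add (DiffRing S) := ⟨Quotient.map₂ (fun a b => (a.1 + b.1, a.2 + b.2))
  fun a a' h b b' h' => by
    change a.1 + a'.2 = a'.1 + a.2 at h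
    change b.1 + b'.2 = b'.1 + b.2 at h'
    change a.1 + b.1 + (a'.2 + b'.2) = a'.1 + b'.1 + (a.2 + b.2)
    linear_combination h + h'⟩
instance : Mul (DiffRing S) := ⟨Quotient.map₂
  (fun a b => (a.1 * b.1 + a.2 * b.2, a.1 * b.2 + a.2 * b.1))
  fun a a' h b b' h' => by
    change a.1 + a'.2 = a'.1 + a.2 at h
    change b.1 + b'.2 = b'.1 + b.2 at h'
    change a.1 * b.1 + a.2 * b.2 + (a'.1 * b'.2 + a'.2 * b'.1) =
      a'.1 * b'.1 + a'.2 * b'.2 + (a.1 * b.2 + a.2 * b.1)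
    have h1 : (a.1 + a'.2) * b.1 + (a'.1 + a.2) * b.2 = (a'.1 + a.2) * b.1 + (a.1 + a'.2) * b.2 := by
      rw [h]
    have h2 : a'.1 * (b.1 + b'.2) + a'.2 * (b'.1 + b.2) = a'.1 * (b'.1 + b.2) + a'.2 * (b.1 + b'.2) := by
      rw [h']
    -- The mixed terms are added on both sides and cancelled, as the semiring has no subtraction.
    have : (a'.1 * b.2 + a'.2 * b.1 + a'.1 * b.1 + a'.2 * b.2) +
        (a.1 * b.1 + a.2 * b.2 + (a'.1 * b'.2 + a'.2 * b'.1)) =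
      (a'.1 * b.2 + a'.2 * b.1 + a'.1 * b.1 + a'.2 * b.2) +
        (a'.1 * b'.1 + a'.2 * b'.2 + (a.1 * b.2 + a.2 * b.1)) := by
      linear_combination h1 + h2
    exact add_left_cancel this⟩

theorem diff_add (a b c d : S) : diff a b + diff c d = diff (a + c) (b + d) := rfl
theorem diff_mul (a b c d : S) : diff a b * diff c d = diff (a * c + b * d) (a * d + b * c) := rfl
theorem neg_diff (a b : S) : -diff a b = diff b a := rfl
theorem zero_def : (0 : DiffRing S) = diff 0 0 := rfl
theorem one_def : (1 : DiffRing S) = diff 1 0 := rfl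

instance : CommRing (DiffRing S) where
  add_assoc x y z := by
    obtain ⟨a, b, rfl⟩ := exists_diff x
    obtain ⟨c, d, rfl⟩ := exists_diff y
    obtain ⟨e, f, rfl⟩ := exists_diff z
    simp only [diff_add, add_assoc]
  zero_add x := by
    obtain ⟨a, b, rfl⟩ := exists_diff x
    simp only [zero_def, diff_add, zero_add]
  add_zero x := by
    obtain ⟨a, b, rfl⟩ := exists_diff x
    simp only [zero_def, diff_add, add_zero]
  add_comm x y := by
    obtain ⟨a, b, rfl⟩ := exists_diff x
    obtain ⟨c, d, rfl⟩ := exists_diff y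
    rw [diff_add, diff_add, add_comm, add_comm b]
  nsmul := nsmulRec
  zsmul := zsmulRec
  neg_add_cancel x := by
    obtain ⟨a, b, rfl⟩ := exists_diff x
    rw [neg_diff, diff_add, zero_def, diff_eq]; ring
  mul_assoc x y z := by
    obtain ⟨a, b, rfl⟩ := exists_diff x
    obtain ⟨c, d, rfl⟩ := exists_diff y
    obtain ⟨e, f, rfl⟩ := exists_diff z
    simp only [diff_mul, diff_eq]; ring
  one_mul x := by
    obtain ⟨a, b, rfl⟩ := exists_diff x
    rw [one_def, diff_mul, diff_eq]; ring
  mul_one x := by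
    obtain ⟨a, b, rfl⟩ := exists_diff x
    rw [one_def, diff_mul, diff_eq]; ring
  mul_comm x y := by
    obtain ⟨a, b, rfl⟩ := exists_diff x
    obtain ⟨c, d, rfl⟩ := exists_diff y
    simp only [diff_mul, diff_eq]; ring
  left_distrib x y z := by
    obtain ⟨a, b, rfl⟩ := exists_diff x
    obtain ⟨c, d, rfl⟩ := exists_diff y
    obtain ⟨e, f, rfl⟩ := exists_diff z
    simp only [diff_add, diff_mul, diff_eq]; ring
  right_distrib x y z := by
    obtain ⟨a, b, rfl⟩ := exists_diff x
    obtain ⟨c, d, rfl⟩ := exists_diff y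
    obtain ⟨e, f, rfl⟩ := exists_diff z
    simp only [diff_add, diff_mul, diff_eq]; ring
  zero_mul x := by
    obtain ⟨a, b, rfl⟩ := exists_diff x
    rw [zero_def, diff_mul, diff_eq]; ring
  mul_zero x := by
    obtain ⟨a, b, rfl⟩ := exists_diff x
    rw [zero_def, diff_mul, diff_eq]; ring

end DiffRing

end Grothendieck

open DiffRing

variable {M : Struc.{u, v}} [IsModel M]

/-- The integer with the code `X`. -/
noncomputable def val (X : M.Str) : DiffRing M.Str := diff (posPart X) (negPart X)

open Classical in
/-- The code of the integer `a - b`. -/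
noncomputable def enc (a b : M.Str) : M.Str :=
  if SLt a b then sub b a + sub b a + 1 else sub a b + sub a b

theorem posPart_double_add_one (X : M.Str) : posPart (X + X + 1) = 0 := by
  rw [posPart, if_pos (mem_double_add_one.2 (Or.inl rfl))]

theorem negPart_double_add_one (X : M.Str) : negPart (X + X + 1) = X := by
  rw [negPart, if_pos (mem_double_add_one.2 (Or.inl rfl)), half_double_add_one]

theorem val_enc (a b : M.Str) : val (enc a b) = diff a b := by
  unfold enc val
  split_ifs with h
  · rw [posPart_double_add_one, negPart_double_add_one, diff_eq]
    have := add_sub_of_not_slt (not_slt_of_slt h)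
    rw [zero_add, this]
  · rw [posPart_double, negPart_double, diff_eq]
    have := add_sub_of_not_slt h
    rw [add_zero, add_comm, this]

theorem enc_ne_one (a b : M.Str) : enc a b ≠ 1 := by
  unfold enc
  split_ifs with h
  · intro h'
    have h1 : sub b a + sub b a = 0 := add_right_cancel (by rw [h', zero_add])
    have := add_sub_of_not_slt (not_slt_of_slt h)
    rw [Str.eq_zero_of_add h1, add_zero] at this
    exact not_slt_self _ (this ▸ h)
  · exact double_ne_one _

theorem val_inj {X Y : M.Str} (hX : X ≠ 1) (hY : Y ≠ 1) (h : val X = val Y) : X = Y := by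
  rw [val, val, diff_eq] at h
  have key : ∀ {X : M.Str}, half X = 0 → X ≠ 1 → X = 0 := fun {X} h0 h1 => by
    by_cases h : M.mem 0 X
    · exact absurd (by rw [eq_double_half_add_one h, h0, add_zero, zero_add]) h1
    · rw [eq_double_half h, h0, add_zero]
  unfold posPart negPart at h
  by_cases h1 : M.mem 0 X <;> by_cases h2 : M.mem 0 Y <;>
    simp only [h1, h2, if_true, if_false, zero_add, add_zero] at h
  · rw [eq_double_half_add_one h1, eq_double_half_add_one h2, h]
  -- With different signs the magnitudes have sum zero, so both vanish. As `-0` is not a code, both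
  -- codes are `0`.
  · have h3 := Str.eq_zero_of_add h.symm
    have h4 := Str.eq_zero_of_add ((add_comm _ _).trans h.symm)
    rw [key h3 hY, key h4 hX]
  · have h3 := Str.eq_zero_of_add h
    have h4 := Str.eq_zero_of_add ((add_comm _ _).trans h)
    rw [key h3 hX, key h4 hY]
  · rw [eq_double_half h1, eq_double_half h2, h]

/-- The code of an integer. -/
noncomputable def code (x : DiffRing M.Str) : M.Str :=
  enc (exists_diff x).choose (exists_diff x).choose_spec.choose

theorem val_code (x : DiffRing M.Str) : val (code x) = x :=
  (val_enc _ _).trans (exists_diff x).choose_spec.choose_spec.symm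

theorem code_ne_one (x : DiffRing M.Str) : code x ≠ 1 := enc_ne_one _ _

theorem code_val {X : M.Str} (h : X ≠ 1) : code (val X) = X :=
  val_inj (code_ne_one _) h (val_code _)

theorem code_diff (a b : M.Str) : code (diff a b) = enc a b :=
  val_inj (code_ne_one _) (enc_ne_one _ _) (by rw [val_code, val_enc])

theorem val_zero : val (0 : M.Str) = 0 := by
  have h1 := posPart_double (0 : M.Str)
  have h2 := negPart_double (0 : M.Str)
  rw [add_zero] at h1 h2
  rw [val, h1, h2]; rfl

theorem val_two : val (1 + 1 : M.Str) = 1 := by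
  rw [val, posPart_double, negPart_double]; rfl

theorem zero_ne_one_str : (0 : M.Str) ≠ 1 := fun h => not_mem_zero (0 : M.Num) (h ▸ mem_one.2 rfl)

theorem intAdd_iff {X Y Z : M.Str} :
    IntAdd X Y Z ↔ (X ≠ 1 ∧ Y ≠ 1 ∧ Z ≠ 1) ∧ val Z = val X + val Y := by
  rw [IntAdd, val, val, val, diff_add, diff_eq]
  refine and_congr_right fun _ => ⟨fun h => ?_, fun h => ?_⟩ <;> linear_combination -h

theorem val_eq (X : M.Str) : M.mem 0 X ∧ val X = -diff (half X) 0 ∨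
    ¬ M.mem 0 X ∧ val X = diff (half X) 0 := by
  by_cases h : M.mem 0 X
  · exact Or.inl ⟨h, by rw [val, posPart, negPart, if_pos h, if_pos h, neg_diff]⟩
  · exact Or.inr ⟨h, by rw [val, posPart, negPart, if_neg h, if_neg h]⟩

theorem IntMul.val_eq {X Y Z : M.Str} (h : IntMul X Y Z) : val Z = val X * val Y := by
  obtain ⟨-, h1, h2⟩ := h
  have hd : diff (half Z) 0 = diff (half X) 0 * diff (half Y) 0 := by
    rw [diff_mul, diff_eq, h1]; ring
  rcases h2 with rfl | h2
  · have h0 : diff (half (0 : M.Str)) 0 = (0 : DiffRing M.Str) := by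
      have := half_double (0 : M.Str)
      rw [add_zero] at this
      rw [this]; rfl
    rw [h0] at hd
    rw [val_zero]
    rcases VSharp.val_eq X with ⟨_, hX⟩ | ⟨_, hX⟩ <;> rcases VSharp.val_eq Y with ⟨_, hY⟩ | ⟨_, hY⟩ <;>
      rw [hX, hY] <;> first | linear_combination hd | linear_combination -hd
  · rcases VSharp.val_eq X with ⟨h3, hX⟩ | ⟨h3, hX⟩ <;> rcases VSharp.val_eq Y with ⟨h4, hY⟩ | ⟨h4, hY⟩ <;>
      rcases VSharp.val_eq Z with ⟨h5, hZ⟩ | ⟨h5, hZ⟩ <;> rw [hX, hY, hZ, hd] <;>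
      first | ring1 | (exfalso; tauto)

theorem exists_intMul {X Y : M.Str} (hX : X ≠ 1) (hY : Y ≠ 1) : ∃ Z, IntMul X Y Z := by
  by_cases h : M.mem 0 X ↔ M.mem 0 Y
  · refine ⟨half X * half Y + half X * half Y, ⟨hX, hY, double_ne_one _⟩, half_double _, Or.inr ?_⟩
    exact iff_of_false not_mem_zero_double (not_not.2 h)
  -- A zero product of integers with different signs must get the code `0`, because the set with
  -- negative sign and magnitude zero is not a code.
  · by_cases h0 : half X * half Y = 0
    · refine ⟨0, ⟨hX, hY, zero_ne_one_str⟩, ?_, Or.inl rfl⟩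
      have := half_double (0 : M.Str)
      rw [add_zero] at this
      rw [this, h0]
    · refine ⟨half X * half Y + half X * half Y + 1, ⟨hX, hY, fun h1 => h0 ?_⟩,
        half_double_add_one _, Or.inr (iff_of_true (mem_double_add_one.2 (Or.inl rfl)) h)⟩
      exact Str.eq_zero_of_add (add_right_cancel (b := (1 : M.Str)) (by rw [h1, zero_add]))

theorem intMul_iff {X Y Z : M.Str} :
    IntMul X Y Z ↔ (X ≠ 1 ∧ Y ≠ 1 ∧ Z ≠ 1) ∧ val Z = val X * val Y := by
  refine ⟨fun h => ⟨h.1, h.val_eq⟩, fun ⟨⟨hX, hY, hZ⟩, h⟩ => ?_⟩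
  obtain ⟨Z', hZ'⟩ := exists_intMul hX hY
  rwa [val_inj hZ hZ'.1.2.2 (h.trans hZ'.val_eq.symm)]

/-- An integer valued function on the numbers is *coded* if it is the difference of two coded
functions. -/
class CodedInt (f : M.Num → DiffRing M.Str) : Prop where
  exists_diff : ∃ p q : M.Num → M.Str, CodedStr p ∧ CodedStr q ∧ f = fun z => diff (p z) (q z)

section Instances

variable {f g : M.Num → DiffRing M.Str} {s : M.Num → M.Str} {P : M.Num → Prop}

instance CodedInt.code [hf : CodedInt f] : CodedStr fun z => code (f z) := by
  obtain ⟨p, q, hp, hq, rfl⟩ := hf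
  simp only [code_diff, enc]
  infer_instance

instance CodedInt.val [CodedStr s] : CodedInt fun z => val (s z) :=
  ⟨fun z => posPart (s z), fun z => negPart (s z), inferInstance, inferInstance, rfl⟩

instance CodedInt.const (a : DiffRing M.Str) : CodedInt fun _ : M.Num => a := by
  obtain ⟨x, y, rfl⟩ := DiffRing.exists_diff a
  exact ⟨fun _ => x, fun _ => y, inferInstance, inferInstance, rfl⟩

instance CodedInt.add [hf : CodedInt f] [hg : CodedInt g] : CodedInt fun z => f z + g z := by
  obtain ⟨p, q, hp, hq, rfl⟩ := hf
  obtain ⟨p', q', hp', hq', rfl⟩ := hg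
  exact ⟨fun z => p z + p' z, fun z => q z + q' z, inferInstance, inferInstance, rfl⟩

instance CodedInt.mul [hf : CodedInt f] [hg : CodedInt g] : CodedInt fun z => f z * g z := by
  obtain ⟨p, q, hp, hq, rfl⟩ := hf
  obtain ⟨p', q', hp', hq', rfl⟩ := hg
  exact ⟨fun z => p z * p' z + q z * q' z, fun z => p z * q' z + q z * p' z, inferInstance,
    inferInstance, rfl⟩

instance CodedInt.neg [hf : CodedInt f] : CodedInt fun z => - f z := by
  obtain ⟨p, q, hp, hq, rfl⟩ := hf
  exact ⟨fun z => q z, fun z => p z, inferInstance, inferInstance, rfl⟩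

instance CodedInt.sub [CodedInt f] [CodedInt g] : CodedInt fun z => f z - g z := by
  simp only [sub_eq_add_neg]; infer_instance

instance CodedInt.eq [CodedInt f] [CodedInt g] : Coded fun z => f z = g z :=
  (inferInstance : Coded fun z => VSharp.code (f z) = VSharp.code (g z)).congr fun z =>
    ⟨fun h => by rw [← val_code (f z), h, val_code], fun h => by rw [h]⟩

theorem CodedInt.of_code (h : CodedStr fun z => VSharp.code (f z)) : CodedInt f := by
  have := CodedInt.val (s := fun z => VSharp.code (f z))
  simpa only [val_code] using this

theorem CodedInt.of_local (h : ∀ b, ∃ g, CodedInt g ∧ ∀ x, x < b → f x = g x) : CodedInt f :=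
  .of_code <| .of_local fun b => by
    obtain ⟨g, hg, h⟩ := h b
    exact ⟨fun z => VSharp.code (g z), inferInstance, fun x hx => by rw [h x hx]⟩

theorem CodedInt.comp (f : M.Num → DiffRing M.Str) [CodedInt f] (t : M.Num → M.Num) [CodedNum t] :
    CodedInt fun z => f (t z) :=
  .of_code (CodedStr.comp (fun z => VSharp.code (f z)) t)

instance CodedInt.ite {dec : ∀ z, Decidable (P z)} [Coded P] [CodedInt f] [CodedInt g] :
    CodedInt fun z => if P z then f z else g z := by
  refine .of_code (CodedStr.congr
    (s := fun z => if P z then VSharp.code (f z) else VSharp.code (g z)) inferInstance fun z => ?_)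
  split_ifs <;> rfl

end Instances

theorem CodedInt.comp₂ (f : M.Num → M.Num → DiffRing M.Str)
    (h : CodedInt fun w => f (fst w) (snd w)) (s t : M.Num → M.Num) [CodedNum s] [CodedNum t] :
    CodedInt fun z => f (s z) (t z) := by
  have := CodedInt.comp (fun w => f (fst w) (snd w)) fun z => pair (s z) (t z)
  simpa only [fst_pair, snd_pair] using this

end VSharp

/-! ### Sums of coded families of integers. -/

namespace VSharp

open DiffRing

variable {M : Struc.{u, v}} [IsModel M]

section Sub

open Classical in
noncomputable instance : Sub M.Num := ⟨fun x y => if h : ∃ c, x = y + c then h.choose else 0⟩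

theorem Num.sub_spec {x y : M.Num} : x = y + (x - y) ∨ x < y ∧ x - y = 0 := by
  by_cases h : ∃ c, x = y + c
  · exact Or.inl (h.choose_spec.trans (congrArg (y + ·) (dif_pos h).symm))
  · exact Or.inr ⟨not_le.1 fun h' => h (Num.le_iff.1 h'), dif_neg h⟩

instance : OrderedSub M.Num where
  tsub_le_iff_right a b c := by
    rcases Num.sub_spec (x := a) (y := b) with h | ⟨h, h'⟩
    · constructor
      · intro h'
        rw [h, add_comm]
        gcongr
      · intro h'
        rw [h, add_comm] at h'
        exact le_of_add_le_add_right h'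
    · rw [h']
      exact iff_of_true zero_le (h.le.trans le_add_self)

theorem Num.eq_sub_iff {x y z : M.Num} : z = x - y ↔ x = y + z ∨ x < y ∧ z = 0 := by
  constructor
  · rintro rfl
    exact Num.sub_spec
  · rintro (rfl | ⟨h, rfl⟩)
    · exact (add_tsub_cancel_left _ _).symm
    · exact (tsub_eq_zero_of_le h.le).symm

instance CodedNum.sub {s t : M.Num → M.Num} [CodedNum s] [CodedNum t] :
    CodedNum fun z => s z - t z := by
  refine .of_graph (fun b => ?_) ?_
  · obtain ⟨c, hc⟩ := CodedNum.bdd (t := s) b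
    exact ⟨c, fun x hx => tsub_le_self.trans_lt (hc x hx)⟩
  · have := CodedNum.comp s (fst : M.Num → M.Num)
    have := CodedNum.comp t (fst : M.Num → M.Num)
    simp only [Num.eq_sub_iff]
    infer_instance

end Sub

/-- `S` is the sequence of the partial sums `∑_{l < k} f l`, as far as `k ≤ n`. -/
def IsPsum (f : M.Num → DiffRing M.Str) (n : M.Num) (S : M.Num → DiffRing M.Str) : Prop :=
  CodedInt S ∧ S 0 = 0 ∧ ∀ k, k < n → S (k + 1) = S k + f k

theorem IsPsum.unique {f : M.Num → DiffRing M.Str} {n n' : M.Num} {S S' : M.Num → DiffRing M.Str}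
    (h : IsPsum f n S) (h' : IsPsum f n' S') {k : M.Num} : k ≤ n → k ≤ n' → S k = S' k := by
  have := h.1
  have := h'.1
  refine Coded.induction (P := fun k => k ≤ n → k ≤ n' → S k = S' k) inferInstance ?_ ?_ k
  · intro _ _
    rw [h.2.1, h'.2.1]
  · intro k hk h1 h2
    rw [Num.add_one_le_iff] at h1 h2
    rw [h.2.2 k h1, h'.2.2 k h2, hk h1.le h2.le]

open Classical in
/-- The sum `∑_{l < n} f l`, computed in the model. -/
noncomputable def psum (f : M.Num → DiffRing M.Str) (n : M.Num) : DiffRing M.Str :=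
  if h : ∃ S, IsPsum f n S then h.choose n else 0

theorem IsPsum.psum_eq {f : M.Num → DiffRing M.Str} {n k : M.Num} {S : M.Num → DiffRing M.Str}
    (h : IsPsum f n S) (hk : k ≤ n) : psum f k = S k := by
  have h' : ∃ S, IsPsum f k S := ⟨S, h.1, h.2.1, fun l hl => h.2.2 l (hl.trans_le hk)⟩
  rw [psum, dif_pos h']
  exact h'.choose_spec.unique h le_rfl hk

/-- The entry `(i, j)` of the matrix `X` as an integer. -/
noncomputable def mat (X : M.Str) (i j : M.Num) : DiffRing M.Str := val (ent X i j)

instance {s : M.Num → M.Str} {t t' : M.Num → M.Num} [CodedStr s] [CodedNum t] [CodedNum t'] :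
    CodedStr fun z => ent (s z) (t z) (t' z) := by unfold ent; infer_instance
instance {s : M.Num → M.Str} {t t' : M.Num → M.Num} [CodedStr s] [CodedNum t] [CodedNum t'] :
    CodedInt fun z => mat (s z) (t z) (t' z) := by unfold mat; infer_instance
instance (X : M.Str) (i : M.Num) : CodedInt (mat X i) :=
  (inferInstance : CodedInt fun j => mat ((fun _ => X) j) ((fun _ => i) j) j)

theorem exists_mat (f : M.Num → M.Num → DiffRing M.Str) (hf : CodedInt fun w => f (fst w) (snd w))
    (a b : M.Num) : ∃ X : M.Str, (∀ i, i < a → ∀ j, j < b → ent X i j = code (f i j)) ∧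
      IsMat a b X ∧ ∀ i, i < a → ∀ j, j < b → mat X i j = f i j := by
  obtain ⟨X, hX⟩ := exists_matrix (fun i j => code (f i j)) a b
  exact ⟨X, hX, fun i hi j hj => (hX i hi j hj).trans_ne (code_ne_one _),
    fun i hi j hj => (congrArg val (hX i hi j hj)).trans (val_code _)⟩

theorem MatMul.exists_isPsum {a b c : M.Num} {X Y Z : M.Str} (h : MatMul a b c X Y Z) :
    ∃ W : M.Str, ∀ i, i < a → ∀ j, j < c →
      IsPsum (fun k => mat X i k * mat Y k j) b (fun k => val (row W (pair (pair i j) k))) ∧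
      ent Z i j = row W (pair (pair i j) b) ∧ row W (pair (pair i j) b) ≠ 1 ∧
      ∀ k, k < b → ent X i k ≠ 1 ∧ ent Y k j ≠ 1 := by
  obtain ⟨W, hW⟩ := h
  refine ⟨W, fun i hi j hj => ?_⟩
  obtain ⟨h0, h1, h2⟩ := hW i hi j hj
  refine ⟨⟨inferInstance, by simp only [h0, val_zero], fun k hk => ?_⟩, h2, ?_, fun k hk => ?_⟩
  · obtain ⟨p, hp, hp'⟩ := h1 k hk
    simp only [(intAdd_iff.1 hp').2, (intMul_iff.1 hp).2, mat]
  · rcases eq_zero_or_succ b with rfl | ⟨b, rfl⟩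
    · rw [h0]; exact zero_ne_one_str
    · obtain ⟨p, -, hp'⟩ := h1 b (Num.lt_add_one_iff.2 le_rfl)
      exact hp'.1.2.2
  · obtain ⟨p, hp, -⟩ := h1 k hk
    exact ⟨hp.1.1, hp.1.2.1⟩

theorem mat_idMat {m : M.Num} {X : M.Str} (h : IdMat m X) {i j : M.Num} (hi : i < m) (hj : j < m) :
    mat X i j = if i = j then 1 else 0 := by
  rcases h i hi j hj with ⟨h, h'⟩ | ⟨h, h'⟩
  · rw [mat, h', val_two, if_pos h]
  · rw [mat, h', val_zero, if_neg h]

/-- The partial sums in the square of a matrix. -/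
theorem exists_square (A : M.Num → M.Num → DiffRing M.Str) (hA : CodedInt fun w => A (fst w) (snd w))
    (N : M.Num) : ∃ W : M.Str, ∀ i, i < N → ∀ j, j < N →
      IsPsum (fun k => A i k * A k j) N (fun k => val (row W (pair (pair i j) k))) := by
  obtain ⟨X, -, hX, hXA⟩ := exists_mat A hA N N
  obtain ⟨Y, P, hP0, hP, -⟩ := exists_matPow hX (1 + 1)
  -- The first power is again evaluated along its partial sums: the row of the identity contributes
  -- the single term with `k = i`.
  have h1 : ∀ i, i < N → ∀ j, j < N → mat (row P 1) i j = A i j := by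
    intro i hi j hj
    have h01 := hP 0 (by positivity)
    rw [zero_add] at h01
    obtain ⟨W, hW⟩ := h01.exists_isPsum
    obtain ⟨⟨hWc, hW0, hW1⟩, hW2, -⟩ := hW i hi j hj
    beta_reduce at hW0 hW1
    have key : ∀ k, k ≤ N → val (row W (pair (pair i j) k)) = if i < k then A i j else 0 :=
      fun k => by
        refine Coded.induction (P := fun k => k ≤ N →
          val (row W (pair (pair i j) k)) = if i < k then A i j else 0) inferInstance ?_ ?_ k
        · intro _
          rw [hW0, if_neg not_lt_zero]
        · intro k hk hkN
          rw [Num.add_one_le_iff] at hkN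
          rw [hW1 k hkN, hk hkN.le, mat_idMat hP0 hi hkN, hXA k hkN j hj]
          simp only [Num.lt_add_one_iff, le_iff_lt_or_eq]
          by_cases h : i = k
          · subst h; simp
          · simp [h]
    rw [mat, hW2, key N le_rfl, if_pos hi]
  obtain ⟨W, hW⟩ := (hP 1 (Num.lt_add_one_iff.2 le_rfl)).exists_isPsum
  refine ⟨W, fun i hi j hj => ⟨inferInstance, (hW i hi j hj).1.2.1, fun k hk => ?_⟩⟩
  refine ((hW i hi j hj).1.2.2 k hk).trans ?_
  simp only [h1 i hi k hk, hXA k hk j hj]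

/-- One matrix square contains the partial sums for all parameters `p < a`. Having them in a single
array is what makes `psum` of a coded family coded again. -/
theorem exists_isPsum (f : M.Num → M.Num → DiffRing M.Str)
    (hf : CodedInt fun w => f (fst w) (snd w)) (a n : M.Num) : ∃ W : M.Str, ∀ p, p < a →
      IsPsum (f p) n fun k => val (row W (pair p k)) := by
  classical
  have hf' : ∀ (s t : M.Num → M.Num) [CodedNum s] [CodedNum t], CodedInt fun z => f (s z) (t z) :=
    CodedInt.comp₂ f hf
  -- Row `n + p` holds `f p` in the columns below `n`, and column `n + a` holds `1` in the rows
  -- below `n`. So the entry `(n + p, n + a)` of the square is the sum of `f p`, and its first `n`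
  -- partial sums are the required ones.
  obtain ⟨W, hW⟩ := exists_square (fun i j => if n ≤ i ∧ j < n then f (i - n) j else
    if i < n ∧ j = n + a then 1 else 0) inferInstance (n + a + 1)
  obtain ⟨V, hV⟩ := exists_array (fun w => row W (pair (pair (n + fst w) (n + a)) (snd w)))
    (pair a (n + 1))
  refine ⟨V, fun p hp => ?_⟩
  have hV' : ∀ k, k ≤ n → row V (pair p k) = row W (pair (pair (n + p) (n + a)) k) := fun k hk => by
    rw [hV _ (pair_lt_pair hp (Num.lt_add_one_iff.2 hk)), fst_pair, snd_pair]
  obtain ⟨-, h0, h1⟩ := hW (n + p) (by rw [Num.lt_add_one_iff]; gcongr) (n + a)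
    (Num.lt_add_one_iff.2 le_rfl)
  refine ⟨inferInstance, by simpa only [hV' 0 zero_le] using h0, fun k hk => ?_⟩
  have hkn : k < n + a + 1 := Num.lt_add_one_iff.2 (hk.le.trans le_self_add)
  have := h1 k hkn
  simp only [le_self_add, hk, and_self, if_true, add_tsub_cancel_left, hk.not_ge, false_and,
    if_false, mul_one] at this
  simp only [hV' k hk.le, hV' (k + 1) (Num.add_one_le_iff.2 hk), this]

instance {f : M.Num → M.Num → DiffRing M.Str} {t : M.Num → M.Num}
    [hf : CodedInt fun w => f (fst w) (snd w)] [CodedNum t] : CodedInt fun z => psum (f z) (t z) := by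
  refine .of_local fun b => ?_
  obtain ⟨n, hn⟩ := CodedNum.bdd (t := t) b
  obtain ⟨W, hW⟩ := exists_isPsum f hf b n
  exact ⟨fun z => val (row W (pair z (t z))), inferInstance, fun z hz =>
    (hW z hz).psum_eq (hn z hz).le⟩

section Psum

variable (f g : M.Num → DiffRing M.Str) [CodedInt f] [CodedInt g] (n : M.Num)

instance : CodedInt (psum f) := by
  have := CodedInt.comp f (snd : M.Num → M.Num)
  exact (inferInstance : CodedInt fun z => psum ((fun _ => f) z) z)

theorem isPsum_psum : IsPsum f n (psum f) := by
  have := CodedInt.comp f (snd : M.Num → M.Num)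
  obtain ⟨W, hW⟩ := exists_isPsum (fun _ => f) inferInstance 1 n
  have h := hW 0 one_pos
  refine ⟨inferInstance, ?_, fun k hk => ?_⟩
  · exact (h.psum_eq zero_le).trans h.2.1
  · rw [h.psum_eq hk.le, h.psum_eq (Num.add_one_le_iff.2 hk)]
    exact h.2.2 k hk

theorem psum_zero : psum f 0 = 0 := (isPsum_psum f 0).2.1

theorem psum_succ : psum f (n + 1) = psum f n + f n :=
  (isPsum_psum f (n + 1)).2.2 n (Num.lt_add_one_iff.2 le_rfl)

omit [CodedInt f] in
-- The tool for identities between sums: the other side, as a coded function of the upper limit,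
-- satisfies the same recursion, and the recursion has only one solution.
theorem psum_eq_of_succ (S : M.Num → DiffRing M.Str) [CodedInt S] (h0 : S 0 = 0)
    (h : ∀ k, k < n → S (k + 1) = S k + f k) : psum f n = S n :=
  IsPsum.psum_eq ⟨inferInstance, h0, h⟩ le_rfl

variable {f g n} in
omit [CodedInt f] in
theorem psum_congr (h : ∀ l, l < n → f l = g l) : psum f n = psum g n :=
  psum_eq_of_succ f n (psum g) (psum_zero g) fun k hk => by rw [psum_succ, h k hk]

theorem psum_add : psum (fun l => f l + g l) n = psum f n + psum g n :=
  psum_eq_of_succ _ n (fun n => psum f n + psum g n) (by rw [psum_zero, psum_zero, add_zero])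
    fun k _ => by rw [psum_succ, psum_succ]; ring

theorem psum_mul_left (c : DiffRing M.Str) : psum (fun l => c * f l) n = c * psum f n :=
  psum_eq_of_succ _ n (fun n => c * psum f n) (by rw [psum_zero, mul_zero])
    fun k _ => by rw [psum_succ, mul_add]

theorem psum_mul_right (c : DiffRing M.Str) : psum (fun l => f l * c) n = psum f n * c :=
  psum_eq_of_succ _ n (fun n => psum f n * c) (by rw [psum_zero, zero_mul])
    fun k _ => by rw [psum_succ, add_mul]

variable {f} in
theorem psum_eq_of_le {a b : M.Num} (hab : a ≤ b) (h : ∀ x, a ≤ x → x < b → f x = 0) :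
    psum f b = psum f a := by
  obtain ⟨c, rfl⟩ := Num.le_iff.1 hab
  have key : ∀ d, d ≤ c → psum f (a + d) = psum f a := fun d => by
    have := CodedInt.comp (psum f) fun d => a + d
    refine Coded.induction (P := fun d => d ≤ c → psum f (a + d) = psum f a) inferInstance ?_ ?_ d
    · intro _; rw [add_zero]
    · intro d hd hd'
      rw [Num.add_one_le_iff] at hd'
      rw [← add_assoc, psum_succ, hd hd'.le, h _ le_self_add (by gcongr), add_zero]
  exact key c le_rfl

variable {f n} in
theorem psum_eq_zero (h : ∀ x, x < n → f x = 0) : psum f n = 0 :=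
  (psum_eq_of_le zero_le fun x _ => h x).trans (psum_zero f)

variable {f n} in
theorem psum_eq_single {a : M.Num} (ha : a < n) (h : ∀ x, x < n → x ≠ a → f x = 0) :
    psum f n = f a := by
  rw [psum_eq_of_le (Num.add_one_le_iff.2 ha) fun x hx hx' => h x hx' (Num.add_one_le_iff.1 hx).ne',
    psum_succ, psum_eq_zero fun x hx => h x (hx.trans ha) hx.ne, zero_add]

theorem psum_succ' : psum f (n + 1) = f 0 + psum (fun l => f (l + 1)) n := by
  have := CodedInt.comp f fun l => l + (1 : M.Num)
  have := CodedInt.comp (psum f) fun l => l + (1 : M.Num)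
  rw [psum_eq_of_succ (fun l => f (l + 1)) n (fun n => psum f (n + 1) - f 0)]
  · ring
  · rw [psum_succ, psum_zero]; ring
  · intro k _
    rw [psum_succ f (k + 1)]; ring

theorem psum_comm (f : M.Num → M.Num → DiffRing M.Str) (hf : CodedInt fun w => f (fst w) (snd w))
    (m n : M.Num) :
    psum (fun i => psum (fun j => f i j) n) m = psum (fun j => psum (fun i => f i j) m) n := by
  have hf' : ∀ (s t : M.Num → M.Num) [CodedNum s] [CodedNum t], CodedInt fun z => f (s z) (t z) :=
    CodedInt.comp₂ f hf
  have hf₁ : ∀ a, CodedInt (f a) := fun a => hf' (fun _ => a) fun z => z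
  refine psum_eq_of_succ _ m (fun m => psum (fun j => psum (fun i => f i j) m) n) ?_ fun k _ => ?_
  · exact psum_eq_zero fun j _ => psum_zero _
  · rw [← psum_add]
    exact psum_congr fun j _ => psum_succ _ _

variable {f} in
-- Pairing is increasing in its second argument, so the nonzero terms are met in the order of `l`,
-- separated by zeros. This collapses a sum over all indices of a layered matrix to a sum over one
-- layer.
theorem psum_sparse {q N : M.Num} (hq : ∀ l, l < n → pair q l < N)
    (h : ∀ x, f x ≠ 0 → ∃ l, l < n ∧ x = pair q l) : psum f N = psum (fun l => f (pair q l)) n := by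
  have := CodedInt.comp f fun l : M.Num => pair q l
  have := CodedInt.comp (psum f) fun l => pair q l
  have hlt : ∀ {l l'}, pair q l < pair q l' ↔ l < l' := fun {l l'} => by
    simp only [pair_lt_pair_iff, add_lt_add_iff_left, add_right_inj]
    exact ⟨fun h => h.elim id And.right, Or.inl⟩
  have key : ∀ k, psum f (pair q k) = psum (fun l => f (pair q l)) k := fun k => by
    refine Coded.induction (P := fun k => psum f (pair q k) = psum (fun l => f (pair q l)) k)
      inferInstance ?_ ?_ k
    · rw [psum_zero]
      refine psum_eq_zero fun x hx => ?_
      by_contra h0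
      obtain ⟨l, -, rfl⟩ := h x h0
      exact not_lt_zero (hlt.1 hx)
    · intro k hk
      have hkk := Num.add_one_le_iff.2 (hlt.2 (Num.lt_add_one_iff.2 (le_refl k)))
      rw [psum_succ, ← hk, psum_eq_of_le hkk, psum_succ]
      intro x hx hx'
      by_contra h0
      obtain ⟨l, -, rfl⟩ := h x h0
      have h1 := hlt.1 (Num.add_one_le_iff.1 hx)
      exact (Num.lt_add_one_iff.1 (hlt.1 hx')).not_gt h1
  rw [← key]
  rcases le_total N (pair q n) with hN | hN
  · refine (psum_eq_of_le hN fun x hx _ => ?_).symm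
    by_contra h0
    obtain ⟨l, hl, rfl⟩ := h x h0
    exact (hq l hl).not_ge hx
  · refine psum_eq_of_le hN fun x hx _ => ?_
    by_contra h0
    obtain ⟨l, hl, rfl⟩ := h x h0
    exact (hlt.2 hl).not_ge hx

end Psum

end VSharp

/-! ### Matrix products and powers as sums, and linear recursion. -/

namespace VSharp

variable {M : Struc.{u, v}} [IsModel M]

theorem eq_code_iff {X : M.Str} {x : DiffRing M.Str} : X = code x ↔ X ≠ 1 ∧ val X = x :=
  ⟨by rintro rfl; exact ⟨code_ne_one _, val_code _⟩, fun ⟨h, h'⟩ => by rw [← h', code_val h]⟩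

theorem code_zero : code (0 : DiffRing M.Str) = 0 :=
  (eq_code_iff.2 ⟨zero_ne_one_str, val_zero⟩).symm

theorem code_one : code (1 : DiffRing M.Str) = 1 + 1 :=
  (eq_code_iff.2 ⟨double_ne_one _, val_two⟩).symm

theorem intAdd_zero_iff {X Y : M.Str} {x : DiffRing M.Str} (hX : X = code x) :
    IntAdd X Y 0 ↔ Y = code (-x) := by
  rw [intAdd_iff, eq_code_iff, val_zero, hX, val_code]
  constructor
  · rintro ⟨⟨-, h, -⟩, h'⟩
    exact ⟨h, by linear_combination -h'⟩
  · rintro ⟨h, h'⟩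
    exact ⟨⟨code_ne_one _, h, zero_ne_one_str⟩, by rw [h']; ring⟩

/-- `X` is the `a × b` matrix of the integers `f i j`. -/
def HasEntries (a b : M.Num) (X : M.Str) (f : M.Num → M.Num → DiffRing M.Str) : Prop :=
  ∀ i, i < a → ∀ j, j < b → ent X i j = code (f i j)

theorem IsMat.hasEntries {a b : M.Num} {X : M.Str} (h : IsMat a b X) : HasEntries a b X (mat X) :=
  fun i hi j hj => (code_val (h i hi j hj)).symm

section Matrices

variable {f g : M.Num → M.Num → DiffRing M.Str} {a b c : M.Num} {X Y Z : M.Str}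

theorem HasEntries.mat_eq (h : HasEntries a b X f) {i j : M.Num} (hi : i < a) (hj : j < b) :
    mat X i j = f i j := by rw [mat, h i hi j hj, val_code]

theorem HasEntries.isMat (h : HasEntries a b X f) : IsMat a b X :=
  fun i hi j hj => (h i hi j hj).trans_ne (code_ne_one _)

theorem HasEntries.congr (h : HasEntries a b X f)
    (hfg : ∀ i, i < a → ∀ j, j < b → f i j = g i j) : HasEntries a b X g :=
  fun i hi j hj => (h i hi j hj).trans (congrArg code (hfg i hi j hj))

theorem hasEntries_congr (hfg : ∀ i, i < a → ∀ j, j < b → f i j = g i j) :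
    HasEntries a b X f ↔ HasEntries a b X g :=
  ⟨fun h => h.congr hfg, fun h => h.congr fun i hi j hj => (hfg i hi j hj).symm⟩

theorem exists_hasEntries (f : M.Num → M.Num → DiffRing M.Str)
    [hf : CodedInt fun w => f (fst w) (snd w)] (a b : M.Num) : ∃ X, HasEntries a b X f := by
  obtain ⟨X, hX⟩ := exists_mat f hf a b
  exact ⟨X, hX.1⟩

/-- This trades the array of partial sums in the formula for `psum`: uniqueness of partial sums
gives one direction, and the array coded by all partial sums the other. Afterwards only the algebra
of sums is needed. -/
theorem matMul_iff [hf : CodedInt fun w => f (fst w) (snd w)]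
    [hg : CodedInt fun w => g (fst w) (snd w)] (hX : HasEntries a b X f) (hY : HasEntries b c Y g) :
    MatMul a b c X Y Z ↔ HasEntries a c Z fun i j => psum (fun k => f i k * g k j) b := by
  have hf' : ∀ (s t : M.Num → M.Num) [CodedNum s] [CodedNum t], CodedInt fun z => f (s z) (t z) :=
    CodedInt.comp₂ f hf
  have hg' : ∀ (s t : M.Num → M.Num) [CodedNum s] [CodedNum t], CodedInt fun z => g (s z) (t z) :=
    CodedInt.comp₂ g hg
  constructor
  · intro h
    obtain ⟨W, hW⟩ := h.exists_isPsum
    intro i hi j hj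
    obtain ⟨h1, h2, h3, -⟩ := hW i hi j hj
    rw [h2, ← code_val h3, ← h1.psum_eq le_rfl]
    congr 1
    exact psum_congr fun k hk => by rw [hX.mat_eq hi hk, hY.mat_eq hk hj]
  · intro h
    obtain ⟨W, hW⟩ := exists_array (fun w => code (psum (fun k =>
      f (fst (fst w)) k * g k (snd (fst w))) (snd w))) (pair (pair a c) (b + 1))
    have hW' : ∀ i, i < a → ∀ j, j < c → ∀ k, k ≤ b → row W (pair (pair i j) k) =
        code (psum (fun k => f i k * g k j) k) := fun i hi j hj k hk => by
      rw [hW _ (pair_lt_pair (pair_lt_pair hi hj) (Num.lt_add_one_iff.2 hk))]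
      simp only [fst_pair, snd_pair]
    refine ⟨W, fun i hi j hj => ⟨?_, fun k hk => ?_, ?_⟩⟩
    · rw [hW' i hi j hj 0 zero_le, psum_zero, code_zero]
    · refine ⟨code (f i k * g k j), ?_, ?_⟩
      · rw [hX i hi k hk, hY k hk j hj, intMul_iff]
        exact ⟨⟨code_ne_one _, code_ne_one _, code_ne_one _⟩, by simp only [val_code]⟩
      · rw [hW' i hi j hj k hk.le, hW' i hi j hj _ (Num.add_one_le_iff.2 hk), intAdd_iff]
        exact ⟨⟨code_ne_one _, code_ne_one _, code_ne_one _⟩, by simp only [val_code, psum_succ]⟩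
    · rw [h i hi j hj, hW' i hi j hj b le_rfl]

theorem IdMat.hasEntries {X : M.Str} (h : IdMat a X) :
    HasEntries a a X fun i j => open Classical in if i = j then 1 else 0 := by
  intro i hi j hj
  rcases h i hi j hj with ⟨h, h'⟩ | ⟨h, h'⟩
  · simp only [h', if_pos h, code_one]
  · simp only [h', if_neg h, code_zero]

theorem MatPow.hasEntries [hf : CodedInt fun w => f (fst w) (snd w)] (hX : HasEntries a a X f)
    {n : M.Num} (h : MatPow a X n Y) :
    ∃ P : M.Str, HasEntries a a Y (mat (row P n)) ∧
      (∀ i, i < a → ∀ j, j < a → mat (row P 0) i j = open Classical in if i = j then 1 else 0) ∧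
      ∀ t, t < n → ∀ i, i < a → ∀ j, j < a →
        mat (row P (t + 1)) i j = psum (fun l => mat (row P t) i l * f l j) a := by
  obtain ⟨P, h0, h1, rfl⟩ := h
  have hP : ∀ t, t ≤ n → IsMat a a (row P t) := by
    intro t ht
    rcases eq_zero_or_succ t with rfl | ⟨t, rfl⟩
    · exact h0.hasEntries.isMat
    · obtain ⟨W, hW⟩ := (h1 t (Num.add_one_le_iff.1 ht)).exists_isPsum
      intro i hi j hj
      exact (hW i hi j hj).2.1.trans_ne (hW i hi j hj).2.2.1
  refine ⟨P, (hP n le_rfl).hasEntries, fun i hi j hj => h0.hasEntries.mat_eq hi hj,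
    fun t ht i hi j hj => ?_⟩
  exact ((matMul_iff (hP t ht.le).hasEntries hX).1 (h1 t ht)).mat_eq hi hj

end Matrices

theorem psum_assoc (u : M.Num → DiffRing M.Str) (f : M.Num → M.Num → DiffRing M.Str)
    (g : M.Num → DiffRing M.Str) [CodedInt u] [hf : CodedInt fun w => f (fst w) (snd w)] [CodedInt g]
    (m n : M.Num) : psum (fun j => psum (fun i => u i * f i j) m * g j) n =
      psum (fun i => u i * psum (fun j => f i j * g j) n) m := by
  have hf' : ∀ (s t : M.Num → M.Num) [CodedNum s] [CodedNum t], CodedInt fun z => f (s z) (t z) :=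
    CodedInt.comp₂ f hf
  have hf₁ : ∀ i, CodedInt (f i) := fun i => hf' (fun _ => i) fun z => z
  have := CodedInt.comp g (snd : M.Num → M.Num)
  have := CodedInt.comp g (fst : M.Num → M.Num)
  have := CodedInt.comp u (snd : M.Num → M.Num)
  have := CodedInt.comp u (fst : M.Num → M.Num)
  simp only [← psum_mul_left, ← psum_mul_right]
  rw [psum_comm _ inferInstance]
  simp only [mul_assoc]

/-- The semantics of `isRowPowCol`. -/
def RowPowCol (s : M.Num) (R X : M.Str) (k : M.Num) (S c : M.Str) : Prop := ∃ Y U C,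
  MatPow s X k Y ∧ MatMul 1 s s R Y U ∧ MatMul 1 s 1 U S C ∧ c = ent C 0 0

/-- The formula forms the power of the matrix first, whereas the vectors `w t` apply the matrix
repeatedly to the row. Associativity of the products shows by induction that `w t` is the row times
the `t`-th power. -/
theorem rowPowCol_iff {R S : M.Num → DiffRing M.Str} {A w : M.Num → M.Num → DiffRing M.Str}
    [CodedInt R] [CodedInt S] [hA : CodedInt fun w => A (fst w) (snd w)]
    [hw : CodedInt fun z => w (fst z) (snd z)] {s k : M.Num} {R' X S' c : M.Str}
    (hR : HasEntries 1 s R' fun _ j => R j) (hX : HasEntries s s X A)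
    (hS : HasEntries s 1 S' fun i _ => S i) (h0 : ∀ j, j < s → w 0 j = R j)
    (h1 : ∀ t, t < k → ∀ j, j < s → w (t + 1) j = psum (fun l => w t l * A l j) s) :
    RowPowCol s R' X k S' c ↔ c = code (psum (fun j => w k j * S j) s) := by
  have := CodedInt.comp R (snd : M.Num → M.Num)
  have := CodedInt.comp S (fst : M.Num → M.Num)
  have hA' : ∀ (s t : M.Num → M.Num) [CodedNum s] [CodedNum t], CodedInt fun z => A (s z) (t z) :=
    CodedInt.comp₂ A hA
  have hw' : ∀ (s t : M.Num → M.Num) [CodedNum s] [CodedNum t], CodedInt fun z => w (s z) (t z) :=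
    CodedInt.comp₂ w hw
  have hw₁ : ∀ i, CodedInt (w i) := fun i => hw' (fun _ => i) fun z => z
  have key : ∀ Y, MatPow s X k Y → ∀ U, MatMul 1 s s R' Y U ↔ HasEntries 1 s U fun _ => w k := by
    intro Y hY U
    obtain ⟨P, hP, hP0, hP1⟩ := hY.hasEntries hX
    rw [matMul_iff hR hP]
    refine hasEntries_congr fun i _ j hj => ?_
    have : ∀ t, t ≤ k → ∀ j, j < s → psum (fun l => R l * mat (row P t) l j) s = w t j := fun t => by
      have := CodedInt.comp R (snd : M.Num → M.Num)
      refine Coded.induction (P := fun t => t ≤ k → ∀ j, j < s →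
        psum (fun l => R l * mat (row P t) l j) s = w t j) inferInstance ?_ ?_ t
      · intro _ j hj
        rw [psum_eq_single hj, hP0 j hj j hj, if_pos rfl, mul_one, h0 j hj]
        intro x hx hxj
        rw [hP0 x hx j hj, if_neg hxj, mul_zero]
      · intro t ih ht j hj
        rw [Num.add_one_le_iff] at ht
        rw [psum_congr fun l hl => by rw [hP1 t ht l hl j hj], ← psum_assoc, h1 t ht j hj]
        exact psum_congr fun l hl => by rw [ih ht.le l hl]
    exact this k le_rfl j hj
  have key' : ∀ U, HasEntries 1 s U (fun _ => w k) → ∀ C, MatMul 1 s 1 U S' C ↔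
      ent C 0 0 = code (psum (fun j => w k j * S j) s) := by
    intro U hU C
    rw [matMul_iff hU hS]
    refine ⟨fun h => h 0 one_pos 0 one_pos, fun h i hi j hj => ?_⟩
    rw [← zero_add (1 : M.Num), Num.lt_add_one_iff, nonpos_iff_eq_zero] at hi hj
    rw [hi, hj, h]
  constructor
  · rintro ⟨Y, U, C, hY, hU, hC, rfl⟩
    exact (key' U ((key Y hY U).1 hU) C).1 hC
  · rintro rfl
    obtain ⟨Y, hY⟩ := exists_matPow hX.isMat k
    obtain ⟨U, hU⟩ := exists_hasEntries (fun _ => w k) 1 s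
    obtain ⟨C, hC⟩ := exists_hasEntries (fun _ _ => psum (fun j => w k j * S j) s) 1 1
    have hC := hC 0 one_pos 0 one_pos
    exact ⟨Y, U, C, hY, (key Y hY U).2 hU, (key' U hU C).2 hC, hC.symm⟩

set_option synthInstance.maxHeartbeats 200000 in
set_option synthInstance.maxSize 1000 in
/-- Linear recursion: a family of vectors `v p k`, indexed by a parameter `p`, with given initial
vector, and with `v p (k + 1)` the product of `v p k` and the matrix `A p k`. -/
theorem exists_linear_recursion (v₀ : M.Num → M.Num → DiffRing M.Str)
    (A : M.Num → M.Num → M.Num → M.Num → DiffRing M.Str)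
    (hv₀ : CodedInt fun w => v₀ (fst w) (snd w))
    (hA : CodedInt fun w => A (fst (fst w)) (snd (fst w)) (fst (snd w)) (snd (snd w)))
    (a n m : M.Num) : ∃ v : M.Num → M.Num → M.Num → DiffRing M.Str,
      (∀ (r s t : M.Num → M.Num) [CodedNum r] [CodedNum s] [CodedNum t],
        CodedInt fun z => v (r z) (s z) (t z)) ∧
      (∀ p, p < a → ∀ j, j < m → v p 0 j = v₀ p j) ∧
      ∀ p, p < a → ∀ k, k < n → ∀ j, j < m → v p (k + 1) j = psum (fun l => v p k l * A p k l j) m := by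
  classical
  have hv₀' : ∀ (s t : M.Num → M.Num) [CodedNum s] [CodedNum t], CodedInt fun z => v₀ (s z) (t z) :=
    CodedInt.comp₂ v₀ hv₀
  have hA' : ∀ (q r s t : M.Num → M.Num) [CodedNum q] [CodedNum r] [CodedNum s] [CodedNum t],
      CodedInt fun z => A (q z) (r z) (s z) (t z) := fun q r s t _ _ _ _ => by
    have := CodedInt.comp (fun w => A (fst (fst w)) (snd (fst w)) (fst (snd w)) (snd (snd w)))
      fun z => pair (pair (q z) (r z)) (pair (s z) (t z))
    simpa only [fst_pair, snd_pair] using this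
  -- The indices are `⟨⟨p, k⟩, j⟩` with layers `k ≤ n + 1`. Layer `0` is a source: its index `j = 0`
  -- leads to layer `1` with the weights `v₀ p`. Layer `k + 1` leads to layer `k + 2` with the
  -- matrix `A p k`. The first condition excludes numbers that are not pairs, on which `fst` and
  -- `snd` take a default value.
  let B : M.Num → M.Num → DiffRing M.Str := fun x y =>
    if (x = pair (pair (fst (fst x)) (snd (fst x))) (snd x) ∧ snd x < m) ∧
      fst (fst y) = fst (fst x) ∧ snd (fst y) = snd (fst x) + 1 then
      (if snd (fst x) = 0 then if snd x = 0 then v₀ (fst (fst x)) (snd y) else 0 else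
      A (fst (fst x)) (snd (fst x) - 1) (snd x) (snd y)) else 0
  have hB : CodedInt fun w => B (fst w) (snd w) := by simp only [B]; infer_instance
  obtain ⟨X, hX⟩ := exists_hasEntries B (pair (pair a (n + 1 + 1)) m) (pair (pair a (n + 1 + 1)) m)
  obtain ⟨Y, hY⟩ := exists_matPow hX.isMat (n + 1)
  obtain ⟨P, -, hP0, hP1⟩ := hY.hasEntries hX
  have hlt : ∀ {p k j}, p < a → k ≤ n + 1 → j < m →
      pair (pair p k) j < pair (pair a (n + 1 + 1)) m := fun hp hk hj =>
    pair_lt_pair (pair_lt_pair hp (Num.lt_add_one_iff.2 hk)) hj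
  -- A column of layer `k + 1` has nonzero entries only in the rows of layer `k` with the same `p`.
  have step : ∀ p, p < a → ∀ k, k < n + 1 → ∀ j, j < m → ∀ j₀, j₀ < m →
      mat (row P (k + 1)) (pair (pair p 0) j₀) (pair (pair p (k + 1)) j) =
      psum (fun l => mat (row P k) (pair (pair p 0) j₀) (pair (pair p k) l) *
        B (pair (pair p k) l) (pair (pair p (k + 1)) j)) m := by
    intro p hp k hk j hj j₀ hj₀
    rw [hP1 k hk _ (hlt hp zero_le hj₀) _ (hlt hp (Num.add_one_le_iff.2 hk) hj)]
    have : ∀ y, CodedInt fun x => B x y := fun y => CodedInt.comp₂ B hB (fun x => x) fun _ => y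
    refine psum_sparse (n := m) (f := fun x => mat (row P k) (pair (pair p 0) j₀) x *
      B x (pair (pair p (k + 1)) j)) (q := pair p k) (fun l hl => hlt hp hk.le hl) fun x hx => ?_
    have hx := right_ne_zero_of_mul hx
    simp only [B, fst_pair, snd_pair, ne_eq, ite_eq_right_iff, not_forall] at hx
    obtain ⟨⟨⟨h1, h2⟩, h3, h4⟩, -⟩ := hx
    rw [add_left_inj] at h4
    exact ⟨snd x, h2, by rw [h3, h4]; exact h1⟩
  -- The vector `v p k` sits in layer `k + 1`. It is reached from the source by paths of length `k +
  -- 1`, so it is read off from that power.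
  refine ⟨fun p k j => mat (row P (k + 1)) (pair (pair p 0) 0) (pair (pair p (k + 1)) j),
    fun r s t _ _ _ => by beta_reduce; infer_instance, fun p hp j hj => ?_, fun p hp k hk j hj => ?_⟩
  · have hm : 0 < m := zero_le.trans_lt hj
    have := CodedInt.comp₂ v₀ hv₀ (fun _ => p) fun _ => j
    refine (step p hp 0 (add_pos_of_nonneg_of_pos zero_le one_pos) j hj 0 hm).trans ?_
    rw [psum_eq_single hm]
    · rw [hP0 _ (hlt hp zero_le hm) _ (hlt hp zero_le hm)]
      simp [B, hm, fst_pair, snd_pair]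
    · intro x hx hx0
      simp [B, hx0, fst_pair, snd_pair]
  · have hm : 0 < m := zero_le.trans_lt hj
    refine (step p hp (k + 1) (by gcongr) j hj 0 hm).trans ?_
    refine psum_congr fun l hl => ?_
    congr 1
    have : (k + 1 : M.Num) ≠ 0 := Ax.succ_ne_zero k
    simp [B, hl, this, fst_pair, snd_pair]

end VSharp

/-! ### Semantics of the formulas for the two algorithms. -/

namespace VSharp

variable {M : Struc.{u, v}} [IsModel M]

/-- The semantics of `isJ`. -/
def JMat (n : M.Num) (J : M.Str) : Prop := ∀ i, i < n + n → ∀ j, j < n + n →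
  (∃ k, k < n ∧ i = k + k ∧ j = k + k + 1 ∧ ent J i j = 1 + 1) ∨
  (∃ k, k < n ∧ i = k + k + 1 ∧ j = k + k ∧ IntAdd (1 + 1) (ent J i j) 0) ∨
  (¬ ∃ k, k < n ∧ (i = k + k ∧ j = k + k + 1 ∨ i = k + k + 1 ∧ j = k + k)) ∧ ent J i j = 0

/-- The semantics of `isBlock`. -/
def Block (i₀ j₀ a b : M.Num) (A B : M.Str) : Prop :=
  ∀ i, i < a → ∀ j, j < b → ent A (i₀ + i) (j₀ + j) = ent B i j

/-- The semantics of `isPBMatrix`. -/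
def PBMatrix (r : M.Num) (A P : M.Str) : Prop := ∃ R S X J RJ XJ,
  (Block 0 (1 + 1) 1 (r + r) A R ∧ Block (1 + 1) 1 (r + r) 1 A S ∧
    Block (1 + 1) (1 + 1) (r + r) (r + r) A X ∧ JMat r J ∧
    MatMul 1 (r + r) (r + r) R J RJ ∧ MatMul (r + r) (r + r) (r + r) X J XJ) ∧
  ∀ i, i < r + 1 + 1 → ∀ j, j < r + 1 →
    i < j ∧ ent P i j = 0 ∨ i = j ∧ ent P i j = 1 + 1 ∨ i = j + 1 ∧ ent P i j = ent A 0 1 ∨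
    ∃ k, i = j + 1 + 1 + k ∧ RowPowCol (r + r) RJ XJ k S (ent P i j)

/-- The semantics of `isPBCoeffs`. -/
def PBCoeffs (n : M.Num) (A Q : M.Str) : Prop := ∃ F,
  (∀ t, t + 1 = n → ent (row F 1) 0 0 = 1 + 1 ∧ ent (row F 1) 1 0 = ent A (t + t) (t + t + 1)) ∧
  (∀ r t, 1 ≤ r ∧ t + (r + 1) = n → ∃ B P,
    Block (t + t) (t + t) (r + 1 + (r + 1)) (r + 1 + (r + 1)) A B ∧ PBMatrix r B P ∧
    MatMul (r + 1 + 1) (r + 1) 1 P (row F r) (row F (r + 1))) ∧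
  Q = row F n

/-- The semantics of `isPairsMatrix`. -/
def PairsMatrix (s m l : M.Num) (A B T : M.Str) : Prop := ∃ R S X Y YX,
  (Block 0 1 1 s A R ∧ Block 1 0 s 1 B S ∧ Block 1 1 s s A X ∧ Block 1 1 s s B Y ∧
    MatMul s s s Y X YX) ∧
  ∀ i, i < m + 1 → ∀ j, j < l →
    i < j ∧ ent T i j = 0 ∨ i = j ∧ ent T i j = 1 + 1 ∨
    ∃ k, i = j + 1 + k ∧ ∃ c, RowPowCol s R YX k S c ∧ IntAdd c (ent T i j) 0

/-- The semantics of `isPairsCoeffs`. -/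
def PairsCoeffs (n : M.Num) (A B Q : M.Str) : Prop := ∃ G,
  ent (row G 1) 0 0 = 1 + 1 ∧
  (∀ s t, 1 ≤ s ∧ t + (s + 1) = n → ∃ m l,
    (s + 1 = m + m ∧ l = m ∨ s + 1 = m + m + 1 ∧ l = m + 1) ∧ ∃ A' B' T,
    Block t t (s + 1) (s + 1) A A' ∧ Block t t (s + 1) (s + 1) B B' ∧ PairsMatrix s m l A' B' T ∧
    MatMul (m + 1) l 1 T (row G s) (row G (s + 1))) ∧
  Q = row G n

section Sat

variable (ν : ℕ → M.Num) (σ : ℕ → M.Str) {d e : ℕ}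

theorem sat_isJ {n : NTerm} {J : ℕ} (hn : n.nb ≤ d) (hn' : n.sb ≤ e) (hJ : J < e) :
    Sat M ν σ (isJ n J d e) ↔ JMat (n.eval M ν σ) (σ J) := by
  simp (disch := first | omega |
      (simp only [nb_var, nb_pr, nb_zero, nb_add, nb_one, nb_dbl]; omega)) only
    [isJ, sat_fAllLt, sat_fExLt, sat_fExS, sat_fAnd, sat_fOr, sat_fEq, sat_fNot, sat_isEntry,
    sat_isIntZero, sat_isIntOne, sat_isIntOpp, eval_var, eval_update_num, eval_update_str, eval_dbl,
    eval_add, eval_one,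
    Function.update_self, Function.update_of_ne, exists_eq_left, JMat]

theorem sat_isBlock {i₀ j₀ a b : NTerm} {A B : ℕ} (hi : i₀.nb ≤ d) (hj : j₀.nb ≤ d) (ha : a.nb ≤ d)
    (hb : b.nb ≤ d) (hi' : i₀.sb ≤ e) (hj' : j₀.sb ≤ e) (hA : A < e) (hB : B < e) :
    Sat M ν σ (isBlock i₀ j₀ a b A B d e) ↔ Block (i₀.eval M ν σ) (j₀.eval M ν σ)
      (a.eval M ν σ) (b.eval M ν σ) (σ A) (σ B) := by
  simp (disch := first | omega |
      (simp only [nb_var, nb_pr, nb_zero, nb_add, nb_one, nb_dbl]; omega)) only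
    [isBlock, sat_fAllLt, sat_fExS, sat_fAnd, sat_isEntry,
    eval_var, eval_update_num, eval_update_str, eval_add,
    Function.update_self, Function.update_of_ne, exists_eq_left, Block]

theorem sat_isRowPowCol {s k : NTerm} {R X S c : ℕ} (hs : s.nb ≤ d) (hk : k.nb ≤ d)
    (hs' : s.sb ≤ e) (hk' : k.sb ≤ e) (hR : R < e) (hX : X < e) (hS : S < e) (hc : c < e) :
    Sat M ν σ (isRowPowCol s R X k S c d e) ↔ RowPowCol (s.eval M ν σ) (σ R) (σ X)
      (k.eval M ν σ) (σ S) (σ c) := by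
  simp (disch := first | omega |
      (simp only [nb_var, nb_pr, nb_zero, nb_add, nb_one, nb_dbl, sb_one]; omega)) only
    [isRowPowCol, sat_fExS, sat_fAnd, sat_isEntry, sat_isMatPow, sat_isMatMul,
    eval_update_str, eval_zero, eval_one,
    Function.update_self, Function.update_of_ne, RowPowCol]

theorem sat_isPBMatrix {r : NTerm} {A P : ℕ} (hr : r.nb ≤ d) (hr' : r.sb ≤ e) (hA : A < e)
    (hP : P < e) :
    Sat M ν σ (isPBMatrix r A P d e) ↔ PBMatrix (r.eval M ν σ) (σ A) (σ P) := by
  simp (disch := first | omega |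
      (simp only [nb_var, nb_pr, nb_zero, nb_add, nb_one, nb_dbl, sb_one, sb_zero, sb_add, sb_dbl,
        sb_var]; omega)) only
    [isPBMatrix, sat_fExS, sat_fAnd, sat_isEntry, sat_isMatMul, sat_isBlock, sat_isJ, sat_fAllLt,
    sat_fOr, sat_fLt, sat_fEq, sat_isIntZero, sat_isIntOne, sat_isRowPowCol, sat_fExN,
    eval_update_str, eval_update_num, eval_zero, eval_one, eval_add, eval_dbl, eval_var,
    Function.update_self, Function.update_of_ne, exists_eq_left, PBMatrix]

theorem sat_isPairsMatrix {s m l : NTerm} {A B T : ℕ} (hs : s.nb ≤ d) (hm : m.nb ≤ d)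
    (hl : l.nb ≤ d) (hs' : s.sb ≤ e) (hm' : m.sb ≤ e) (hl' : l.sb ≤ e) (hA : A < e) (hB : B < e)
    (hT : T < e) :
    Sat M ν σ (isPairsMatrix s m l A B T d e) ↔ PairsMatrix (s.eval M ν σ) (m.eval M ν σ)
      (l.eval M ν σ) (σ A) (σ B) (σ T) := by
  simp (disch := first | omega |
      (simp only [nb_var, nb_pr, nb_zero, nb_add, nb_one, nb_dbl, sb_one, sb_zero, sb_add, sb_dbl,
        sb_var]; omega)) only
    [isPairsMatrix, sat_fExS, sat_fAnd, sat_isEntry, sat_isMatMul, sat_isBlock, sat_fAllLt,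
    sat_fOr, sat_fLt, sat_fEq, sat_isIntZero, sat_isIntOne, sat_isIntOpp, sat_isRowPowCol, sat_fExN,
    eval_update_str, eval_update_num, eval_zero, eval_one, eval_add, eval_var,
    Function.update_self, Function.update_of_ne, exists_eq_left, PairsMatrix]

theorem sat_isPBCoeffs {n : NTerm} {A Q : ℕ} (hn : n.nb ≤ d) (hn' : n.sb ≤ e) (hA : A < e)
    (hQ : Q < e) :
    Sat M ν σ (isPBCoeffs n A Q d e) ↔ PBCoeffs (n.eval M ν σ) (σ A) (σ Q) := by
  simp (disch := first | omega |
      (simp only [nb_var, nb_pr, nb_zero, nb_add, nb_one, nb_dbl, sb_one, sb_zero, sb_add, sb_dbl,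
        sb_var]; omega)) only
    [isPBCoeffs, sat_fExS, sat_fAnd, sat_isEntry, sat_isMatMul, sat_isBlock, sat_isPBMatrix,
    sat_isRow, sat_fAllN, sat_fImp, sat_fLe, sat_fEq, sat_isIntOne,
    eval_update_str, eval_update_num, eval_zero, eval_one, eval_add, eval_dbl, eval_var,
    Function.update_self, Function.update_of_ne, exists_eq_left, exists_and_left, PBCoeffs]

theorem sat_isPairsCoeffs {n : NTerm} {A B Q : ℕ} (hn : n.nb ≤ d) (hn' : n.sb ≤ e) (hA : A < e)
    (hB : B < e) (hQ : Q < e) :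
    Sat M ν σ (isPairsCoeffs n A B Q d e) ↔ PairsCoeffs (n.eval M ν σ) (σ A) (σ B) (σ Q) := by
  simp (disch := first | omega |
      (simp only [nb_var, nb_pr, nb_zero, nb_add, nb_one, nb_dbl, sb_one, sb_zero, sb_add, sb_dbl,
        sb_var]; omega)) only
    [isPairsCoeffs, sat_fExS, sat_fExN, sat_fAnd, sat_fOr, sat_isEntry, sat_isMatMul, sat_isBlock,
    sat_isPairsMatrix, sat_isRow, sat_fAllN, sat_fImp, sat_fLe, sat_fEq, sat_isIntOne,
    eval_update_str, eval_update_num, eval_zero, eval_one, eval_add, eval_dbl, eval_var,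
    Function.update_self, Function.update_of_ne, exists_eq_left, exists_and_left, PairsCoeffs]

theorem sat_isEqualColumn {m : NTerm} {Q Q' : ℕ} (hm : m.nb ≤ d) (hQ : Q < e) (hQ' : Q' < e) :
    Sat M ν σ (isEqualColumn m Q Q' d e) ↔
      ∀ i, i < m.eval M ν σ → ent (σ Q) i 0 = ent (σ Q') i 0 := by
  simp (disch := first | omega | (simp only [nb_var, nb_zero]; omega)) only
    [isEqualColumn, sat_fAllLt, sat_fExS, sat_fAnd, sat_isEntry, eval_zero, eval_var,
    Function.update_self, Function.update_of_ne, exists_eq_left]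

end Sat

end VSharp

/-! ### Parity, the matrix J, blocks and Toeplitz matrices. -/

namespace VSharp

variable {M : Struc.{u, v}} [IsModel M]

section Even

instance : Coded (Even : M.Num → Prop) := (inferInstance : Coded fun z : M.Num => ∃ k, k ≤ z ∧ z = k + k).congr
  fun _ => exists_congr fun _ => ⟨fun h => h.2, fun h => ⟨h ▸ le_self_add, h⟩⟩

instance {s : M.Num → M.Num} [CodedNum s] : Coded fun z => Even (s z) :=
  (inferInstance : Coded (Even : M.Num → Prop)).comp s

theorem Num.even_double_add {o i : M.Num} : Even (o + o + i) ↔ Even i := by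
  constructor
  · rintro ⟨k, hk⟩
    rcases le_or_gt o k with h | h
    · obtain ⟨c, rfl⟩ := Num.le_iff.1 h
      exact ⟨c, add_left_cancel (a := o + o) (by rw [hk]; ring)⟩
    · exact absurd hk (ne_of_gt ((add_lt_add h h).trans_le le_self_add))
  · rintro ⟨k, rfl⟩
    exact ⟨o + k, by ring⟩

theorem Num.not_even_one : ¬ Even (1 : M.Num) := by
  rintro ⟨k, hk⟩
  rcases eq_zero_or_succ k with rfl | ⟨k, rfl⟩
  · exact one_ne_zero (hk.trans (add_zero 0))
  · have : (0 : M.Num) = k + k + 1 := add_left_cancel (a := 1) (by rw [add_zero]; conv_lhs => rw [hk]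
                                                                   ring)
    exact Ax.succ_ne_zero _ this.symm

theorem Num.even_or (i : M.Num) : Even i ∨ Even (i + 1) := by
  refine Coded.induction (P := fun i => Even i ∨ Even (i + (1 : M.Num))) inferInstance (Or.inl ⟨0, by simp⟩)
    (fun i hi => ?_) i
  rcases hi with ⟨k, rfl⟩ | h
  · exact Or.inr ⟨k + 1, by ring⟩
  · exact Or.inl h

theorem Num.double_lt {k n : M.Num} (h : k + k < n + n) : k < n :=
  lt_of_not_ge fun h' => (add_le_add h' h').not_gt h

theorem Num.double_inj {k n : M.Num} (h : k + k = n + n) : k = n :=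
  le_antisymm (le_of_not_gt fun h' => (add_lt_add h' h').ne' h)
    (le_of_not_gt fun h' => (add_lt_add h' h').ne h)

end Even

open Classical in
/-- The entries of the block diagonal matrix with the blocks `(0, 1; -1, 0)`. -/
noncomputable def jEntry (i j : M.Num) : DiffRing M.Str :=
  if Even i ∧ j = i + 1 then 1 else if Even j ∧ i = j + 1 then -1 else 0

instance {s t : M.Num → M.Num} [CodedNum s] [CodedNum t] : CodedInt fun z => jEntry (s z) (t z) := by
  unfold jEntry; infer_instance

open Classical in
theorem jMat_iff {n : M.Num} {J : M.Str} : JMat n J ↔ HasEntries (n + n) (n + n) J jEntry := by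
  refine forall_congr' fun i => forall_congr' fun hi => forall_congr' fun j => forall_congr' fun hj => ?_
  have e1 : (∃ k, k < n ∧ i = k + k ∧ j = k + k + 1 ∧ ent J i j = 1 + 1) ↔
      (Even i ∧ j = i + 1) ∧ ent J i j = code 1 := by
    rw [code_one]
    constructor
    · rintro ⟨k, -, rfl, rfl, h⟩; exact ⟨⟨⟨k, rfl⟩, rfl⟩, h⟩
    · rintro ⟨⟨⟨k, rfl⟩, rfl⟩, h⟩; exact ⟨k, Num.double_lt hi, rfl, rfl, h⟩
  have e2 : (∃ k, k < n ∧ i = k + k + 1 ∧ j = k + k ∧ IntAdd (1 + 1) (ent J i j) 0) ↔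
      (Even j ∧ i = j + 1) ∧ ent J i j = code (-1) := by
    rw [intAdd_zero_iff code_one.symm]
    constructor
    · rintro ⟨k, -, rfl, rfl, h⟩; exact ⟨⟨⟨k, rfl⟩, rfl⟩, h⟩
    · rintro ⟨⟨⟨k, rfl⟩, rfl⟩, h⟩; exact ⟨k, Num.double_lt hj, rfl, rfl, h⟩
  have e3 : (∃ k, k < n ∧ (i = k + k ∧ j = k + k + 1 ∨ i = k + k + 1 ∧ j = k + k)) ↔
      (Even i ∧ j = i + 1) ∨ (Even j ∧ i = j + 1) := by
    constructor
    · rintro ⟨k, -, ⟨rfl, rfl⟩ | ⟨rfl, rfl⟩⟩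
      · exact Or.inl ⟨⟨k, rfl⟩, rfl⟩
      · exact Or.inr ⟨⟨k, rfl⟩, rfl⟩
    · rintro (⟨⟨k, rfl⟩, rfl⟩ | ⟨⟨k, rfl⟩, rfl⟩)
      · exact ⟨k, Num.double_lt hi, Or.inl ⟨rfl, rfl⟩⟩
      · exact ⟨k, Num.double_lt hj, Or.inr ⟨rfl, rfl⟩⟩
  have e4 : Even i ∧ j = i + 1 → ¬ (Even j ∧ i = j + 1) := fun h h' =>
    (lt_asymm (a := i) (b := j) (h.2 ▸ Num.lt_add_one_iff.2 le_rfl))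
      (h'.2 ▸ Num.lt_add_one_iff.2 le_rfl)
  rw [e1, e2, e3, jEntry, ← code_zero]
  have aux : ∀ (p q : Prop) [Decidable p] [Decidable q], (p → ¬ q) → ∀ V x y z : M.Str,
      (p ∧ V = x ∨ q ∧ V = y ∨ ¬ (p ∨ q) ∧ V = z ↔ V = if p then x else if q then y else z) := by
    intro p q _ _ h V x y z
    by_cases hp : p
    · simp [hp, h hp]
    · by_cases hq : q <;> simp [hp, hq]
  rw [aux _ _ e4, apply_ite code, apply_ite code]

-- An even shift carries diagonal `2 × 2` blocks to diagonal `2 × 2` blocks, so the lower right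
-- blocks of J of even size are again of the form J.
open Classical in
theorem jEntry_double_add (o i j : M.Num) : jEntry (o + o + i) (o + o + j) = jEntry i j := by
  have h : ∀ {i j : M.Num}, Even (o + o + i) ∧ o + o + j = o + o + i + 1 ↔ Even i ∧ j = i + 1 :=
    fun {i j} => by rw [Num.even_double_add, add_assoc (o + o), add_right_inj]
  simp only [jEntry, h]

/-- This and the next two lemmas describe J as the pairs algorithm sees it. At even size the column
split off is `ᵗ(-1, 0, …, 0)`, and the remaining matrix has first row and first column zero. That
first column is also the one split off at the following odd size. -/
theorem jEntry_col_zero (i : M.Num) : jEntry (1 + i) 0 = if i = 0 then -1 else 0 := by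
  have h : (0 : M.Num) ≠ 1 + i + 1 := (Ax.succ_ne_zero _).symm
  have h' : 1 + i = 0 + 1 ↔ i = 0 := by rw [zero_add, add_eq_left]
  simp only [jEntry, h, h', and_false, if_false, show Even (0 : M.Num) from ⟨0, (add_zero 0).symm⟩,
    true_and]

theorem jEntry_row_one (j : M.Num) : jEntry 1 (1 + j) = 0 := by
  have h : (1 : M.Num) ≠ 1 + j + 1 := by
    rw [add_assoc, ne_eq, left_eq_add]
    exact Ax.succ_ne_zero _
  simp only [jEntry, Num.not_even_one, h, false_and, and_false, if_false]

theorem jEntry_col_one (i : M.Num) : jEntry (1 + 1 + i) 1 = 0 := by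
  have h : (1 : M.Num) ≠ 1 + 1 + i + 1 := by
    rw [add_assoc, add_assoc, ne_eq, left_eq_add]
    exact (add_pos_of_pos_of_nonneg one_pos zero_le).ne'
  simp only [jEntry, Num.not_even_one, h, false_and, and_false, if_false]

theorem block_iff {f : M.Num → M.Num → DiffRing M.Str} {i₀ j₀ a b a' b' : M.Num} {A B : M.Str}
    (hA : HasEntries a' b' A f) (ha : i₀ + a ≤ a') (hb : j₀ + b ≤ b') :
    Block i₀ j₀ a b A B ↔ HasEntries a b B fun i j => f (i₀ + i) (j₀ + j) := by
  refine forall_congr' fun i => forall_congr' fun hi => forall_congr' fun j => forall_congr' fun hj => ?_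
  rw [hA _ ((add_lt_add_iff_left _).2 hi |>.trans_le ha) _
    ((add_lt_add_iff_left _).2 hj |>.trans_le hb)]
  exact eq_comm

theorem exists_translate (f : M.Num → M.Num → DiffRing M.Str)
    [hf : CodedInt fun w => f (fst w) (snd w)] (i₀ j₀ a b : M.Num) :
    ∃ B, HasEntries a b B fun i j => f (i₀ + i) (j₀ + j) := by
  have := CodedInt.comp₂ f hf (fun w => i₀ + fst w) fun w => j₀ + snd w
  exact exists_hasEntries _ a b

open Classical in
/-- The entries of the lower triangular Toeplitz matrix with first column `c`. -/
noncomputable def toeplitz (c : M.Num → DiffRing M.Str) (i j : M.Num) : DiffRing M.Str :=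
  if i < j then 0 else c (i - j)

/-- Both algorithms give the entries of their matrices by cases, with the entries below the diagonal
described by a formula. Here `Q k` stands for the description of the entry at distance `k + 1` below
the diagonal. -/
theorem toeplitz_entry_iff {c : M.Num → DiffRing M.Str} {Q : M.Num → Prop} {i j : M.Num} {V : M.Str}
    (h0 : c 0 = 1) (hQ : ∀ k, i = j + 1 + k → (Q k ↔ V = code (c (k + 1)))) :
    (i < j ∧ V = 0 ∨ i = j ∧ V = 1 + 1 ∨ ∃ k, i = j + 1 + k ∧ Q k) ↔ V = code (toeplitz c i j) := by
  rcases lt_or_ge i j with h | h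
  · rw [toeplitz, if_pos h, code_zero]
    constructor
    · rintro (h' | h' | ⟨k, h', -⟩)
      · exact h'.2
      · exact absurd h'.1 h.ne
      · exact absurd (h' ▸ h) (by rw [add_assoc]; exact le_self_add.not_gt)
    · exact fun h' => Or.inl ⟨h, h'⟩
  · obtain ⟨d, rfl⟩ := Num.le_iff.1 h
    rw [toeplitz, if_neg h.not_gt, add_tsub_cancel_left]
    rcases eq_zero_or_succ d with rfl | ⟨k, rfl⟩
    · rw [h0, code_one]
      constructor
      · rintro (h' | h' | ⟨k, h', -⟩)
        · exact absurd h'.1 h.not_gt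
        · exact h'.2
        · rw [add_assoc, add_right_inj] at h'
          exact absurd h' (add_pos_of_pos_of_nonneg one_pos zero_le).ne
      · exact fun h' => Or.inr (Or.inl ⟨add_zero _, h'⟩)
    · have hk : j + (k + 1) = j + 1 + k := by ring
      rw [← hQ k hk]
      constructor
      · rintro (h' | h' | ⟨k', h', h2⟩)
        · exact absurd h'.1 h.not_gt
        · exact absurd (add_eq_left.1 h'.1) (Ax.succ_ne_zero k)
        · rw [hk, add_right_inj] at h'
          exact h' ▸ h2
      · exact fun h' => Or.inr (Or.inr ⟨k, hk, h'⟩)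

instance {c : M.Num → DiffRing M.Str} {s t : M.Num → M.Num} [CodedInt c] [CodedNum s] [CodedNum t] :
    CodedInt fun z => toeplitz c (s z) (t z) := by
  have := CodedInt.comp c fun z => s z - t z
  unfold toeplitz; infer_instance

end VSharp

/-! ### The matrix of the PB algorithm. -/

namespace VSharp

variable {M : Struc.{u, v}} [IsModel M]

theorem Num.lt_one_iff {i : M.Num} : i < 1 ↔ i = 0 := by
  rw [← zero_add (1 : M.Num), Num.lt_add_one_iff, nonpos_iff_eq_zero]

/-- The vectors `z k = R J (M J)^k` and the first column `c` of the matrix of the PB algorithm for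
the matrix `(0, a₁₂, R; -a₁₂, 0, -Sᵗ; -Rᵗ, S, M)` with the entries `f i j`. -/
structure IsPBColumn (r : M.Num) (f z : M.Num → M.Num → DiffRing M.Str) (c : M.Num → DiffRing M.Str) :
    Prop where
  coded_f : CodedInt fun w => f (fst w) (snd w)
  coded_z : CodedInt fun w => z (fst w) (snd w)
  coded_c : CodedInt c
  row_zero : ∀ j, j < r + r → z 0 j = psum (fun l => f 0 (1 + 1 + l) * jEntry l j) (r + r)
  row_succ : ∀ k, k < r → ∀ j, j < r + r → z (k + 1) j =
    psum (fun l => z k l * psum (fun i => f (1 + 1 + l) (1 + 1 + i) * jEntry i j) (r + r)) (r + r)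
  zero : c 0 = 1
  one : c 1 = f 0 1
  add_two : ∀ k, k < r → c (k + 1 + 1) = psum (fun j => z k j * f (1 + 1 + j) 1) (r + r)

section

variable {r : M.Num} {f z : M.Num → M.Num → DiffRing M.Str} {c : M.Num → DiffRing M.Str}
  {A B P : M.Str}

/-- The formula quantifies over strings for the blocks, which are determined only at the positions
of their entries. So the equivalence is shown for every choice of these strings, and then some
choice is produced. -/
theorem IsPBColumn.pbMatrix_iff (h : IsPBColumn r f z c)
    (hA : HasEntries (r + 1 + (r + 1)) (r + 1 + (r + 1)) A f) :
    PBMatrix r A P ↔ HasEntries (r + 1 + 1) (r + 1) P (toeplitz c) := by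
  have := h.coded_f
  have := h.coded_z
  have := h.coded_c
  have hf : ∀ (s t : M.Num → M.Num) [CodedNum s] [CodedNum t], CodedInt fun z => f (s z) (t z) :=
    CodedInt.comp₂ f h.coded_f
  have hz : ∀ (s t : M.Num → M.Num) [CodedNum s] [CodedNum t], CodedInt fun w => z (s w) (t w) :=
    CodedInt.comp₂ z h.coded_z
  have hz₁ : ∀ i, CodedInt (z i) := fun i => hz (fun _ => i) fun z => z
  have hd : 1 + 1 + (r + r) = r + 1 + (r + 1) := by ring
  have h1 : 0 + 1 ≤ r + 1 + (r + 1) := by rw [← add_assoc]; exact add_le_add zero_le le_rfl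
  have h2 : 1 + 1 ≤ r + 1 + (r + 1) := hd ▸ le_self_add
  have hR := fun R => block_iff (B := R) hA h1 hd.le
  have hS := fun S => block_iff (B := S) hA hd.le h2
  have hX := fun X => block_iff (B := X) hA hd.le hd.le
  have hJ := fun J => jMat_iff (M := M) (n := r) (J := J)
  have key : ∀ R S X J RJ XJ, (Block 0 (1 + 1) 1 (r + r) A R ∧ Block (1 + 1) 1 (r + r) 1 A S ∧
      Block (1 + 1) (1 + 1) (r + r) (r + r) A X ∧ JMat r J ∧
      MatMul 1 (r + r) (r + r) R J RJ ∧ MatMul (r + r) (r + r) (r + r) X J XJ) →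
      ((∀ i, i < r + 1 + 1 → ∀ j, j < r + 1 →
        i < j ∧ ent P i j = 0 ∨ i = j ∧ ent P i j = 1 + 1 ∨ i = j + 1 ∧ ent P i j = ent A 0 1 ∨
        ∃ k, i = j + 1 + 1 + k ∧ RowPowCol (r + r) RJ XJ k S (ent P i j)) ↔
      HasEntries (r + 1 + 1) (r + 1) P (toeplitz c)) := by
    rintro R S X J RJ XJ ⟨hR', hS', hX', hJ', hRJ, hXJ⟩
    rw [hR] at hR'
    rw [hS] at hS'
    rw [hX] at hX'
    rw [hJ] at hJ'
    rw [matMul_iff hR' hJ'] at hRJ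
    rw [matMul_iff hX' hJ'] at hXJ
    replace hRJ : HasEntries 1 (r + r) RJ fun _ j => z 0 j := hRJ.congr fun i hi j hj => by
      rw [Num.lt_one_iff.1 hi, zero_add, h.row_zero j hj]
    replace hS' : HasEntries (r + r) 1 S fun i _ => f (1 + 1 + i) 1 := hS'.congr fun i hi j hj => by
      rw [Num.lt_one_iff.1 hj, add_zero]
    refine forall_congr' fun i => forall_congr' fun hi => forall_congr' fun j =>
      forall_congr' fun hj => ?_
    -- The case `a₁₂` and the cases `RJ(MJ)^k' S` are merged into one description, with `k = 0` for
    -- the former and `k = k' + 1` for the latter.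
    rw [← toeplitz_entry_iff (Q := fun k => k = 0 ∧ ent P i j = ent A 0 1 ∨
      ∃ k', k = k' + 1 ∧ RowPowCol (r + r) RJ XJ k' S (ent P i j)) h.zero]
    · refine or_congr_right (or_congr_right ?_)
      constructor
      · rintro (⟨rfl, h'⟩ | ⟨k, rfl, h'⟩)
        · exact ⟨0, (add_zero _).symm, Or.inl ⟨rfl, h'⟩⟩
        · exact ⟨k + 1, by ring, Or.inr ⟨k, rfl, h'⟩⟩
      · rintro ⟨k, rfl, ⟨rfl, h'⟩ | ⟨k, rfl, h'⟩⟩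
        · exact Or.inl ⟨add_zero _, h'⟩
        · exact Or.inr ⟨k, by ring, h'⟩
    · intro k hk
      rcases eq_zero_or_succ k with rfl | ⟨k, rfl⟩
      · have : ∀ k : M.Num, 0 ≠ k + 1 := fun k => (Ax.succ_ne_zero k).symm
        simp only [true_and, this, false_and, exists_false, or_false, zero_add, h.one]
        rw [hA 0 (h1.trans_lt' (by rw [zero_add]; exact one_pos)) 1
          (h2.trans_lt' (Num.lt_add_one_iff.2 le_rfl))]
      · have hkr : k < r := by
          rw [hk] at hi
          have : k + 1 + 1 ≤ j + 1 + (k + 1) := by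
            rw [show j + 1 + (k + 1) = k + 1 + 1 + j by ring]; exact le_self_add
          exact (add_lt_add_iff_right _).1 ((add_lt_add_iff_right _).1 (this.trans_lt hi))
        simp only [Ax.succ_ne_zero k, false_and, false_or, add_left_inj, exists_eq_left']
        rw [rowPowCol_iff (w := z) hRJ hXJ hS' (fun _ _ => rfl) fun t ht j hj =>
          h.row_succ t (ht.trans hkr) j hj, h.add_two k hkr]
  constructor
  · rintro ⟨R, S, X, J, RJ, XJ, h, h'⟩
    exact (key R S X J RJ XJ h).1 h'
  · intro h
    obtain ⟨R, hR'⟩ := exists_translate f 0 (1 + 1) 1 (r + r)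
    obtain ⟨S, hS'⟩ := exists_translate f (1 + 1) 1 (r + r) 1
    obtain ⟨X, hX'⟩ := exists_translate f (1 + 1) (1 + 1) (r + r) (r + r)
    obtain ⟨J, hJ'⟩ := exists_hasEntries (M := M) jEntry (r + r) (r + r)
    obtain ⟨RJ, hRJ⟩ := exists_hasEntries (fun i j => psum (fun k => f (0 + i) (1 + 1 + k) *
      jEntry k j) (r + r)) 1 (r + r)
    obtain ⟨XJ, hXJ⟩ := exists_hasEntries (fun i j => psum (fun k => f (1 + 1 + i) (1 + 1 + k) *
      jEntry k j) (r + r)) (r + r) (r + r)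
    exact ⟨R, S, X, J, RJ, XJ, (and_iff_left_of_imp fun hb => (key R S X J RJ XJ hb).2 h).2
      ⟨(hR R).2 hR', (hS S).2 hS', (hX X).2 hX', (hJ J).2 hJ', (matMul_iff hR' hJ').2 hRJ,
      (matMul_iff hX' hJ').2 hXJ⟩⟩

end

end VSharp

/-! ### The matrix of the pairs algorithm, and its agreement with the PB matrix. -/

namespace VSharp

variable {M : Struc.{u, v}} [IsModel M]

/-- The matrix of the pairs algorithm for matrices with the entries `f i j` and `g i j`, where
`w k` is the row `R (N M)^k`. -/
theorem pairsMatrix_iff {f g w : M.Num → M.Num → DiffRing M.Str} {c : M.Num → DiffRing M.Str}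
    [hf : CodedInt fun w => f (fst w) (snd w)] [hg : CodedInt fun w => g (fst w) (snd w)]
    [hw : CodedInt fun z => w (fst z) (snd z)] {s m l : M.Num} {A B T : M.Str}
    (hA : HasEntries (s + 1) (s + 1) A f) (hB : HasEntries (s + 1) (s + 1) B g)
    (hw0 : ∀ j, j < s → w 0 j = f 0 (1 + j))
    (hw1 : ∀ k, k + 1 < m → ∀ j, j < s → w (k + 1) j =
      psum (fun l => w k l * psum (fun i => g (1 + l) (1 + i) * f (1 + i) (1 + j)) s) s)
    (hc0 : c 0 = 1) (hc : ∀ k, k < m → c (k + 1) = -psum (fun j => w k j * g (1 + j) 0) s) :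
    PairsMatrix s m l A B T ↔ HasEntries (m + 1) l T (toeplitz c) := by
  have hf' : ∀ (s t : M.Num → M.Num) [CodedNum s] [CodedNum t], CodedInt fun z => f (s z) (t z) :=
    CodedInt.comp₂ f hf
  have hg' : ∀ (s t : M.Num → M.Num) [CodedNum s] [CodedNum t], CodedInt fun z => g (s z) (t z) :=
    CodedInt.comp₂ g hg
  have hw' : ∀ (s t : M.Num → M.Num) [CodedNum s] [CodedNum t], CodedInt fun z => w (s z) (t z) :=
    CodedInt.comp₂ w hw
  have hw₁ : ∀ i, CodedInt (w i) := fun i => hw' (fun _ => i) fun z => z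
  have h1 : 1 + s ≤ s + 1 := (add_comm 1 s).le
  have h2 : 0 + 1 ≤ s + 1 := add_le_add zero_le le_rfl
  have h3 : 0 + s ≤ s + 1 := by rw [zero_add]; exact le_self_add
  have hR := fun R => block_iff (B := R) hA h2 h1
  have hS := fun S => block_iff (B := S) hB h1 h2
  have hX := fun X => block_iff (B := X) hA h1 h1
  have hY := fun Y => block_iff (B := Y) hB h1 h1
  have key : ∀ R S X Y YX, (Block 0 1 1 s A R ∧ Block 1 0 s 1 B S ∧ Block 1 1 s s A X ∧
      Block 1 1 s s B Y ∧ MatMul s s s Y X YX) →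
      ((∀ i, i < m + 1 → ∀ j, j < l →
        i < j ∧ ent T i j = 0 ∨ i = j ∧ ent T i j = 1 + 1 ∨
        ∃ k, i = j + 1 + k ∧ ∃ c, RowPowCol s R YX k S c ∧ IntAdd c (ent T i j) 0) ↔
      HasEntries (m + 1) l T (toeplitz c)) := by
    rintro R S X Y YX ⟨hR', hS', hX', hY', hYX⟩
    rw [hR] at hR'
    rw [hS] at hS'
    rw [hX] at hX'
    rw [hY] at hY'
    rw [matMul_iff hY' hX'] at hYX
    replace hR' : HasEntries 1 s R fun _ j => f 0 (1 + j) := hR'.congr fun i hi j hj => by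
      rw [Num.lt_one_iff.1 hi, zero_add]
    replace hS' : HasEntries s 1 S fun i _ => g (1 + i) 0 := hS'.congr fun i hi j hj => by
      rw [Num.lt_one_iff.1 hj, add_zero]
    refine forall_congr' fun i => forall_congr' fun hi => forall_congr' fun j =>
      forall_congr' fun hj => toeplitz_entry_iff hc0 fun k hk => ?_
    have hkm : k < m := by
      rw [hk, add_assoc, add_comm 1 k, ← add_assoc, add_lt_add_iff_right] at hi
      exact le_add_self.trans_lt hi
    have h' : ∀ C, RowPowCol s R YX k S C ↔ C = _ := fun C => rowPowCol_iff hR' hYX hS' hw0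
      fun t ht => hw1 t ((Num.add_one_le_iff.2 ht).trans_lt hkm)
    simp only [h', exists_eq_left]
    rw [intAdd_zero_iff rfl, hc k hkm]
  constructor
  · rintro ⟨R, S, X, Y, YX, h, h'⟩
    exact (key R S X Y YX h).1 h'
  · intro h
    obtain ⟨R, hR'⟩ := exists_translate f 0 1 1 s
    obtain ⟨S, hS'⟩ := exists_translate g 1 0 s 1
    obtain ⟨X, hX'⟩ := exists_translate f 1 1 s s
    obtain ⟨Y, hY'⟩ := exists_translate g 1 1 s s
    obtain ⟨YX, hYX⟩ := exists_hasEntries (fun i j => psum (fun k => g (1 + i) (1 + k) *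
      f (1 + k) (1 + j)) s) s s
    exact ⟨R, S, X, Y, YX, (and_iff_left_of_imp fun hb => (key R S X Y YX hb).2 h).2
      ⟨(hR R).2 hR', (hS S).2 hS', (hX X).2 hX', (hY Y).2 hY', (matMul_iff hY' hX').2 hYX⟩⟩

-- The heart of the proof. With `N' = diag(0, J)` and `M' = (0, -ᵗS; S, M)`, the product `N'M'` has
-- first row zero and the remaining rows `J(S | M)`. So applying it to `(a₁₂, R)` repeatedly gives
-- `RJ(MJ)^k (S | M)`. Minus the product with `ᵗ(-1, 0, …, 0)` extracts the first coordinate,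
-- `RJ(MJ)^k S`.
open Classical in
theorem IsPBColumn.pairsMatrix_iff {r : M.Num} {f z : M.Num → M.Num → DiffRing M.Str}
    {c : M.Num → DiffRing M.Str} {A B T : M.Str} (h : IsPBColumn r f z c)
    (hA : HasEntries (r + r + 1 + 1) (r + r + 1 + 1) A f)
    (hB : HasEntries (r + r + 1 + 1) (r + r + 1 + 1) B jEntry) :
    PairsMatrix (r + r + 1) (r + 1) (r + 1) A B T ↔
      HasEntries (r + 1 + 1) (r + 1) T (toeplitz c) := by
  have := h.coded_f
  have hf : ∀ (s t : M.Num → M.Num) [CodedNum s] [CodedNum t], CodedInt fun z => f (s z) (t z) :=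
    CodedInt.comp₂ f h.coded_f
  have hz : ∀ (s t : M.Num → M.Num) [CodedNum s] [CodedNum t], CodedInt fun w => z (s w) (t w) :=
    CodedInt.comp₂ z h.coded_z
  have hz₁ : ∀ i, CodedInt (z i) := fun i => hz (fun _ => i) fun z => z
  -- The rows of the pairs algorithm in closed form: `(a₁₂, R)` at `0`, and `z k (S | M)` at `k +
  -- 1`, where `z k = RJ(MJ)^k`.
  let w : M.Num → M.Num → DiffRing M.Str := fun k j =>
    if k = 0 then f 0 (1 + j) else psum (fun l => z (k - 1) l * f (1 + 1 + l) (1 + j)) (r + r)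
  have w_succ : ∀ k j, w (k + 1) j = psum (fun l => z k l * f (1 + 1 + l) (1 + j)) (r + r) :=
    fun k j => by simp only [w, Ax.succ_ne_zero k, if_false, add_tsub_cancel_right]
  have hw : CodedInt fun z => w (fst z) (snd z) := by simp only [w]; infer_instance
  have hw' : ∀ (s t : M.Num → M.Num) [CodedNum s] [CodedNum t], CodedInt fun z => w (s z) (t z) :=
    CodedInt.comp₂ w hw
  have hw₁ : ∀ i, CodedInt (w i) := fun i => hw' (fun _ => i) fun z => z
  have hr : ∀ i : M.Num, 1 + (i + 1) = 1 + 1 + i := fun i => by ring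
  -- the products with the rows of `J` are the vectors `z k`
  have hwz : ∀ k, k < r → ∀ i, i < r + r → psum (fun l => w k (l + 1) * jEntry l i) (r + r) = z k i := by
    intro k hk i hi
    rcases eq_zero_or_succ k with rfl | ⟨k, rfl⟩
    · simp only [h.row_zero i hi, w, if_true, hr]
    · have hk := (Num.lt_add_one_iff.2 le_rfl).trans hk
      simp only [w_succ, hr]
      rw [h.row_succ k hk i hi, psum_assoc]
  refine VSharp.pairsMatrix_iff (w := w) hA hB (fun j _ => if_pos rfl) (fun k hk j hj => ?_) h.zero
    fun k hk => ?_
  · rw [add_lt_add_iff_right] at hk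
    have hrow : ∀ l, psum (fun i => jEntry (1 + (l + 1)) (1 + i) * f (1 + i) (1 + j)) (r + r + 1) =
        psum (fun i => jEntry l i * f (1 + 1 + i) (1 + j)) (r + r) := fun l => by
      rw [psum_succ', hr, add_zero, jEntry_col_one, zero_mul, zero_add]
      simp only [hr, jEntry_double_add]
    -- The first row of `N'` is zero, so the first coordinate of `w k` drops out and the remaining
    -- ones meet J.
    rw [psum_succ', psum_eq_zero (f := fun i => jEntry (1 + 0) (1 + i) * _) fun i _ => by
      rw [add_zero, jEntry_row_one, zero_mul], mul_zero, zero_add]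
    simp only [hrow]
    rw [← psum_assoc, w_succ]
    exact psum_congr fun i hi => by rw [hwz k hk i hi]
  -- Only the top entry `-1` of the column of J contributes, and the two signs cancel.
  · rw [psum_eq_single (a := 0) (Num.lt_add_one_iff.2 zero_le), jEntry_col_zero, if_pos rfl]
    · rcases eq_zero_or_succ k with rfl | ⟨k, rfl⟩
      · simp only [w, if_true, add_zero, zero_add, h.one]; ring
      · rw [w_succ, add_zero, h.add_two k ((add_lt_add_iff_right _).1 hk)]; ring
    · intro x _ hx
      rw [jEntry_col_zero, if_neg hx, mul_zero]

end VSharp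

/-! ### Halving, and the table of Pfaffian coefficients. -/

namespace VSharp

variable {M : Struc.{u, v}} [IsModel M]

theorem exists_half (s : M.Num) : ∃ r, s = r + r ∨ s = r + r + 1 := by
  rcases Num.even_or s with ⟨r, h⟩ | ⟨r, h⟩
  · exact ⟨r, Or.inl h⟩
  · rcases eq_zero_or_succ r with rfl | ⟨r, rfl⟩
    · exact absurd (h.trans (add_zero 0)) (Ax.succ_ne_zero s)
    · exact ⟨r, Or.inr (add_right_cancel (b := 1) (h.trans (by ring)))⟩

theorem Num.double_ne {k l : M.Num} : k + k ≠ l + l + 1 := fun h =>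
  Num.not_even_one (Num.even_double_add.1 ⟨k, h.symm⟩)

/-- The quotient of the division by `2`. -/
noncomputable def Num.half (s : M.Num) : M.Num := (exists_half s).choose

theorem Num.eq_half_iff {s r : M.Num} : r = Num.half s ↔ s = r + r ∨ s = r + r + 1 := by
  have h := (exists_half s).choose_spec
  change s = half s + half s ∨ s = half s + half s + 1 at h
  constructor
  · rintro rfl
    exact h
  · rintro (rfl | rfl)
    · exact h.elim Num.double_inj fun h => absurd h Num.double_ne
    · exact h.elim (fun h => absurd h.symm Num.double_ne) fun h => Num.double_inj (add_right_cancel h)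

instance : CodedNum (Num.half : M.Num → M.Num) := by
  refine .of_graph (fun b => ⟨b, fun x hx => lt_of_le_of_lt ?_ hx⟩) ?_
  · rcases Num.eq_half_iff.1 (rfl : Num.half x = _) with h | h
    · exact le_self_add.trans h.ge
    · exact (le_self_add.trans le_self_add).trans h.ge
  · simp only [Num.eq_half_iff]; infer_instance

/-- An array of columns. -/
theorem exists_columns (w : M.Num → M.Num → DiffRing M.Str)
    [hw : CodedInt fun z => w (fst z) (snd z)] (a b : M.Num) :
    ∃ F, ∀ s, s < a → HasEntries b 1 (row F s) fun i _ => w s i := by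
  have hw' : ∀ (s t : M.Num → M.Num) [CodedNum s] [CodedNum t], CodedInt fun z => w (s z) (t z) :=
    CodedInt.comp₂ w hw
  -- A row of the array is itself an array, so bit `k` of an entry stands at `⟨⟨i, j⟩, k⟩` of its
  -- row. `L` bounds the lengths of all entries uniformly.
  obtain ⟨L, hL⟩ := CodedStr.bdd (s := fun z => code (w (fst z) (snd z))) (pair a b)
  obtain ⟨F, hF⟩ := exists_array (fun s => mk (pair (pair b 1) L) fun x =>
    M.mem (snd x) (code (w s (fst (fst x))))) a
  refine ⟨F, fun s hs i hi j hj => str_ext fun k => ?_⟩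
  have : CodedInt (w s) := hw' (fun _ => s) fun z => z
  have := CodedInt.comp (w s) fun x => fst (fst x)
  rw [hF s hs, ent, mem_row, mem_mk, fst_pair, snd_pair, fst_pair]
  refine ⟨fun h => h.2, fun h => ⟨pair_lt_pair (pair_lt_pair hi hj) ((Ax.lt_len _ _ h).trans_le ?_), h⟩⟩
  have := hL _ (pair_lt_pair hs hi)
  rwa [fst_pair, snd_pair] at this

-- If the column `S` is zero, all coefficients below the diagonal are zero and the Toeplitz matrix
-- has the entries of the identity. The rows `R(NM)^k` must still be available as a coded family in
-- order to evaluate the formula for these coefficients.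
open Classical in
theorem pairsMatrix_one_iff {f g : M.Num → M.Num → DiffRing M.Str}
    [hf : CodedInt fun w => f (fst w) (snd w)] [hg : CodedInt fun w => g (fst w) (snd w)]
    {s m l : M.Num} {A B T : M.Str}
    (hA : HasEntries (s + 1) (s + 1) A f) (hB : HasEntries (s + 1) (s + 1) B g)
    (h : ∀ j, j < s → g (1 + j) 0 = 0) :
    PairsMatrix s m l A B T ↔ HasEntries (m + 1) l T (toeplitz fun k => if k = 0 then 1 else 0) := by
  have hf' : ∀ (s t : M.Num → M.Num) [CodedNum s] [CodedNum t], CodedInt fun z => f (s z) (t z) :=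
    CodedInt.comp₂ f hf
  have hg' : ∀ (s t : M.Num → M.Num) [CodedNum s] [CodedNum t], CodedInt fun z => g (s z) (t z) :=
    CodedInt.comp₂ g hg
  obtain ⟨w, hw, hw0, hw1⟩ := exists_linear_recursion (fun _ j => f 0 (1 + j))
    (fun _ _ l j => psum (fun i => g (1 + l) (1 + i) * f (1 + i) (1 + j)) s) inferInstance
    inferInstance 1 m s
  have : CodedInt fun z => w 0 (fst z) (snd z) := hw _ _ _
  refine pairsMatrix_iff (w := w 0) hA hB (hw0 0 one_pos) (fun k hk => hw1 0 one_pos k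
    ((Num.lt_add_one_iff.2 le_rfl).trans hk)) (if_pos rfl) fun k _ => ?_
  have := hw (fun _ => 0) (fun _ => k) fun z => z
  rw [if_neg (Ax.succ_ne_zero k), psum_eq_zero, neg_zero]
  exact fun j hj => by rw [h j hj, mul_zero]

/-- `u r` is the vector of the Pfaffian coefficients of the lower right block of size `2r` of the
`2n × 2n` matrix `A`, and `u 0 = (1)`. -/
structure IsCoeffTable (n : M.Num) (A : M.Str) (u : M.Num → M.Num → DiffRing M.Str) : Prop where
  coded : ∀ (s t : M.Num → M.Num) [CodedNum s] [CodedNum t], CodedInt fun z => u (s z) (t z)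
  zero : u 0 0 = 1
  succ : ∀ r t, t + (r + 1) = n → ∃ z c,
    IsPBColumn r (fun i j => mat A (t + t + i) (t + t + j)) z c ∧
    ∀ j, j < n + 1 → u (r + 1) j = psum (fun l => toeplitz c j l * u r l) (r + 1)

set_option synthInstance.maxHeartbeats 400000 in
set_option synthInstance.maxSize 2000 in
open Classical in
theorem exists_coeffTable (n : M.Num) (A : M.Str) : ∃ u, IsCoeffTable n A u := by
  have h1 : CodedNum fun r => n - (r + (1 : M.Num)) := inferInstance
  -- The rows `RJ(MJ)^k` for all `r < n` at once, with `r` as the parameter. The block of size `2(r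
  -- + 1)` starts at `2t` with `t = n - (r + 1)`. All vectors are padded to the length `2n`, and the
  -- condition `l < r + r` discards the padding.
  obtain ⟨v, hv, hv0, hv1⟩ := exists_linear_recursion (M := M)
    (fun r j => psum (fun l => mat A ((n - (r + 1)) + (n - (r + 1)) + 0)
      ((n - (r + 1)) + (n - (r + 1)) + (1 + 1 + l)) * jEntry l j) (r + r))
    (fun r _ l j => if l < r + r then psum (fun i => mat A ((n - (r + 1)) + (n - (r + 1)) + (1 + 1 + l))
      ((n - (r + 1)) + (n - (r + 1)) + (1 + 1 + i)) * jEntry i j) (r + r) else 0)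
    inferInstance inferInstance n n (n + n)
  let c : M.Num → M.Num → DiffRing M.Str := fun r k => if k = 0 then 1 else
    if k = 1 then mat A ((n - (r + 1)) + (n - (r + 1)) + 0) ((n - (r + 1)) + (n - (r + 1)) + 1) else
    psum (fun j => v r (k - (1 + 1)) j * mat A ((n - (r + 1)) + (n - (r + 1)) + (1 + 1 + j))
      ((n - (r + 1)) + (n - (r + 1)) + 1)) (r + r)
  have hc : CodedInt fun w => c (fst w) (snd w) := by simp only [c]; infer_instance
  have hc' : ∀ (s t : M.Num → M.Num) [CodedNum s] [CodedNum t], CodedInt fun z => c (s z) (t z) :=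
    CodedInt.comp₂ c hc
  -- Now `r` is the step of the recursion, with a different Toeplitz matrix each time and a single
  -- dummy parameter. The vectors have the common length `n + 1`, of which stage `r` uses the first
  -- `r + 1` coordinates.
  obtain ⟨u, hu, hu0, hu1⟩ := exists_linear_recursion (M := M)
    (fun _ j => if j = 0 then 1 else 0)
    (fun _ r l j => if l < r + 1 then toeplitz (c r) j l else 0) inferInstance
    (by simp only [toeplitz]; infer_instance) 1 n (n + 1)
  refine ⟨u 0, fun s t _ _ => hu _ s t, ?_, fun r t h => ?_⟩
  · rw [hu0 0 one_pos 0 (Num.lt_add_one_iff.2 zero_le), if_pos rfl]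
  · have hn : n - (r + 1) = t := by rw [← h, add_tsub_cancel_right]
    have hrn : r < n := Num.add_one_le_iff.1 (h ▸ le_add_self)
    have hrn' : r + r ≤ n + n := add_le_add hrn.le hrn.le
    have hcr : CodedInt (c r) := hc' (fun _ => r) fun z => z
    refine ⟨v r, c r, ⟨?_, hv _ _ _, hcr, fun j hj => ?_, fun k hk j hj => ?_, if_pos rfl, ?_,
      fun k hk => ?_⟩, fun j hj => ?_⟩
    · infer_instance
    · rw [hv0 r hrn j (hj.trans_le hrn'), hn]
    · have := hv (fun _ => r) (fun _ => k) fun z => z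
      rw [hv1 r hrn k (hk.trans hrn) j (hj.trans_le hrn'), hn, psum_eq_of_le hrn']
      · exact psum_congr fun l hl => by rw [if_pos hl]
      · exact fun l hl _ => by rw [if_neg hl.not_gt, mul_zero]
    · simp only [c, one_ne_zero, if_false, if_true, hn]
    · have h2 : k + 1 + 1 ≠ 1 := fun h => Ax.succ_ne_zero k (add_eq_right.1 h)
      have h3 : k + 1 + 1 - (1 + 1) = k := by rw [add_assoc, add_tsub_cancel_right]
      simp only [c, Ax.succ_ne_zero, h2, if_false, hn, h3]
    · have := hu (fun _ => 0) (fun _ => r) fun z => z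
      have := CodedInt.comp₂ (toeplitz (c r)) inferInstance (fun _ => j) fun z => z
      rw [hu1 0 one_pos r hrn j hj, psum_eq_of_le (a := r + 1) (by gcongr)]
      · exact psum_congr fun l hl => by rw [if_pos hl, mul_comm]
      · exact fun l hl _ => by rw [if_neg hl.not_gt, mul_zero]

end VSharp

/-! ### Both algorithms compute the table. -/

namespace VSharp

variable {M : Struc.{u, v}} [IsModel M]

theorem exists_block {i₀ j₀ a b a' b' : M.Num} {A : M.Str} (hA : IsMat a' b' A) (ha : i₀ + a ≤ a')
    (hb : j₀ + b ≤ b') : ∃ B, Block i₀ j₀ a b A B := by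
  obtain ⟨B, hB⟩ := exists_translate (mat A) i₀ j₀ a b
  exact ⟨B, (block_iff hA.hasEntries ha hb).2 hB⟩

namespace IsCoeffTable

variable {n : M.Num} {A : M.Str} {u : M.Num → M.Num → DiffRing M.Str}

theorem coded_row (hu : IsCoeffTable n A u) (r : M.Num) : CodedInt (u r) :=
  hu.coded (fun _ => r) fun z => z

/-- The table starts at `u 0 = (1)`, one stage before the PB algorithm. Its next vector is the first
column `(1, a₁₂)` of the Toeplitz matrix of a `2 × 2` block, which is the starting value of that
algorithm. -/
theorem one (hu : IsCoeffTable n A u) {t : M.Num} (h : t + 1 = n) :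
    u 1 0 = 1 ∧ u 1 1 = mat A (t + t) (t + t + 1) := by
  obtain ⟨z, c, hc, h1⟩ := hu.succ 0 t (by rwa [zero_add])
  have key : ∀ j, j < n + 1 → u 1 j = c j := fun j hj => by
    have := hc.coded_c
    have := hu.coded_row 0
    have := CodedInt.comp₂ (toeplitz c) inferInstance (fun _ => j) fun z => z
    rw [← zero_add (1 : M.Num), h1 j hj, psum_succ, psum_zero, hu.zero, toeplitz, if_neg not_lt_zero,
      tsub_zero, mul_one, zero_add]
  rw [key 0 (Num.lt_add_one_iff.2 zero_le), key 1 (Num.lt_add_one_iff.2 (h ▸ le_add_self)), hc.zero,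
    hc.one, add_zero]
  exact ⟨rfl, rfl⟩

/-- The product with a Toeplitz matrix of the table. -/
theorem matMul_iff (hu : IsCoeffTable n A u) {r : M.Num} {c : M.Num → DiffRing M.Str} [CodedInt c]
    (hr : r + 1 ≤ n) (hc : ∀ j, j < n + 1 → u (r + 1) j = psum (fun l => toeplitz c j l * u r l) (r + 1))
    {P F G : M.Str} (hP : HasEntries (r + 1 + 1) (r + 1) P (toeplitz c))
    (hF : HasEntries (r + 1) 1 F fun i _ => u r i) :
    MatMul (r + 1 + 1) (r + 1) 1 P F G ↔ HasEntries (r + 1 + 1) 1 G fun i _ => u (r + 1) i := by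
  have := hu.coded_row r
  have := CodedInt.comp (u r) (fst : M.Num → M.Num)
  rw [VSharp.matMul_iff hP hF]
  exact hasEntries_congr fun i hi _ _ => (hc i (hi.trans_le (by gcongr))).symm

theorem pb_step (hu : IsCoeffTable n A u) (hA : IsMat (n + n) (n + n) A) {r t : M.Num}
    (h : t + (r + 1) = n) {B : M.Str}
    (hB : Block (t + t) (t + t) (r + 1 + (r + 1)) (r + 1 + (r + 1)) A B) :
    (∃ P, PBMatrix r B P) ∧ ∀ P F G, PBMatrix r B P → HasEntries (r + 1) 1 F (fun i _ => u r i) →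
      (MatMul (r + 1 + 1) (r + 1) 1 P F G ↔ HasEntries (r + 1 + 1) 1 G fun i _ => u (r + 1) i) := by
  obtain ⟨z, c, hc, h1⟩ := hu.succ r t h
  have := hc.coded_c
  have hd : t + t + (r + 1 + (r + 1)) ≤ n + n := by rw [← h]; exact (by ring : _ = _).le
  have hB := (block_iff hA.hasEntries hd hd).1 hB
  have hP := fun P => hc.pbMatrix_iff (P := P) hB
  obtain ⟨P, hP'⟩ := exists_hasEntries (toeplitz c) (r + 1 + 1) (r + 1)
  exact ⟨⟨P, (hP P).2 hP'⟩, fun P F G hP' hF =>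
    hu.matMul_iff (h ▸ le_add_self) h1 ((hP P).1 hP') hF⟩

theorem pairs_step_even (hu : IsCoeffTable n A u) (hA : IsMat (n + n) (n + n) A) {J : M.Str}
    (hJ : HasEntries (n + n) (n + n) J jEntry) {r t : M.Num} (h : t + (r + r + 1 + 1) = n + n)
    {A' J' : M.Str} (hA' : Block t t (r + r + 1 + 1) (r + r + 1 + 1) A A')
    (hJ' : Block t t (r + r + 1 + 1) (r + r + 1 + 1) J J') :
    (∃ T, PairsMatrix (r + r + 1) (r + 1) (r + 1) A' J' T) ∧
      ∀ T F G, PairsMatrix (r + r + 1) (r + 1) (r + 1) A' J' T →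
      HasEntries (r + 1) 1 F (fun i _ => u r i) →
      (MatMul (r + 1 + 1) (r + 1) 1 T F G ↔ HasEntries (r + 1 + 1) 1 G fun i _ => u (r + 1) i) := by
  have hr : r + 1 ≤ n := Num.add_one_le_iff.2 (Num.double_lt
    (((Num.lt_add_one_iff.2 le_rfl).trans (Num.lt_add_one_iff.2 le_rfl)).trans_le (h ▸ le_add_self)))
  -- With `n = r + 1 + t₀` the block starts at the even position `2 t₀`, so the block of J is a
  -- matrix J again.
  obtain ⟨t₀, rfl⟩ := Num.le_iff.1 hr
  have ht : t = t₀ + t₀ := add_right_cancel (b := r + r + 1 + 1) (h.trans (by ring))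
  rw [ht] at h hA' hJ'
  obtain ⟨z, c, hc, h1⟩ := hu.succ r t₀ (add_comm _ _)
  have := hc.coded_c
  have hA' := (block_iff hA.hasEntries h.le h.le).1 hA'
  have hJ' := (block_iff hJ h.le h.le).1 hJ'
  simp only [jEntry_double_add] at hJ'
  have hT := fun T => hc.pairsMatrix_iff (T := T) hA' hJ'
  obtain ⟨T, hT'⟩ := exists_hasEntries (toeplitz c) (r + 1 + 1) (r + 1)
  exact ⟨⟨T, (hT T).2 hT'⟩, fun T F G hT' hF => hu.matMul_iff hr h1 ((hT T).1 hT') hF⟩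

-- A block of odd size starts at an odd position, in the second row of a `2 × 2` block of J. Below
-- the corner its first column is zero, so the step multiplies by the identity and the coefficients
-- stay the same.
open Classical in
theorem pairs_step_odd (hu : IsCoeffTable n A u) (hA : IsMat (n + n) (n + n) A) {J : M.Str}
    (hJ : HasEntries (n + n) (n + n) J jEntry) {m t : M.Num} (h : t + (m + m + 1) = n + n)
    {A' J' : M.Str} (hA' : Block t t (m + m + 1) (m + m + 1) A A')
    (hJ' : Block t t (m + m + 1) (m + m + 1) J J') :
    (∃ T, PairsMatrix (m + m) m (m + 1) A' J' T) ∧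
      ∀ T F G, PairsMatrix (m + m) m (m + 1) A' J' T → HasEntries (m + 1) 1 F (fun i _ => u m i) →
      (MatMul (m + 1) (m + 1) 1 T F G ↔ HasEntries (m + 1) 1 G fun i _ => u m i) := by
  have hm : m + 1 ≤ n := Num.add_one_le_iff.2 (Num.double_lt
    ((Num.lt_add_one_iff.2 le_rfl).trans_le (h ▸ le_add_self)))
  obtain ⟨t₀, rfl⟩ := Num.le_iff.1 hm
  have ht : t = t₀ + t₀ + 1 := add_right_cancel (b := m + m + 1) (h.trans (by ring))
  rw [ht] at h hA' hJ'
  have hA' := (block_iff hA.hasEntries h.le h.le).1 hA'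
  have hJ' := (block_iff hJ h.le h.le).1 hJ'
  have hs : ∀ i j, jEntry (t₀ + t₀ + 1 + i) (t₀ + t₀ + 1 + j) = jEntry (1 + i) (1 + j) := fun i j => by
    rw [add_assoc, add_assoc _ 1 j, jEntry_double_add]
  simp only [hs] at hJ'
  have : CodedInt fun w => mat A (t₀ + t₀ + 1 + fst w) (t₀ + t₀ + 1 + snd w) := inferInstance
  have : CodedInt fun w => jEntry ((1 : M.Num) + fst w) ((1 : M.Num) + snd w) := inferInstance
  have hT := fun T => pairsMatrix_one_iff (m := m) (l := m + 1) (T := T) hA' hJ' fun j _ => by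
    rw [add_zero, ← add_assoc, jEntry_col_one]
  have := hu.coded_row m
  have := CodedInt.comp (u m) (fst : M.Num → M.Num)
  have : CodedInt fun k : M.Num => if k = 0 then (1 : DiffRing M.Str) else 0 := inferInstance
  obtain ⟨T, hT'⟩ := exists_hasEntries (M := M) (toeplitz fun k => if k = 0 then 1 else 0) (m + 1) (m + 1)
  refine ⟨⟨T, (hT T).2 hT'⟩, fun T F G hT' hF => ?_⟩
  rw [VSharp.matMul_iff ((hT T).1 hT') hF]
  refine hasEntries_congr fun i hi j _ => ?_
  have := CodedInt.comp₂ (toeplitz fun k : M.Num => if k = 0 then (1 : DiffRing M.Str) else 0)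
    inferInstance (fun _ => i) fun z => z
  rw [psum_eq_single hi]
  · rw [toeplitz, if_neg (lt_irrefl i), tsub_self, if_pos rfl, one_mul]
  · intro x _ hx
    rw [toeplitz]
    split_ifs with h1 h2
    · exact zero_mul _
    · exact absurd (le_antisymm (not_lt.1 h1) (tsub_eq_zero_iff_le.1 h2)) hx
    · exact zero_mul _

end IsCoeffTable

theorem PBCoeffs.hasEntries {n : M.Num} {A Q : M.Str} {u : M.Num → M.Num → DiffRing M.Str}
    (hu : IsCoeffTable n A u) (hA : IsMat (n + n) (n + n) A) (hn : 1 ≤ n) (h : PBCoeffs n A Q) :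
    HasEntries (n + 1) 1 Q fun i _ => u n i := by
  obtain ⟨F, h1, h2, rfl⟩ := h
  have := hu.coded
  have key : ∀ r, 1 ≤ r → r ≤ n → HasEntries (r + 1) 1 (row F r) fun i _ => u r i := fun r => by
    refine Coded.induction (P := fun r => 1 ≤ r → r ≤ n → HasEntries (r + 1) 1 (row F r) fun i _ => u r i)
      ?_ (fun h => absurd h zero_lt_one.not_ge) (fun r ih _ hr => ?_) r
    · unfold HasEntries; infer_instance
    · obtain ⟨t, ht⟩ := Num.le_iff.1 hr
      rw [add_comm] at ht
      rcases eq_zero_or_succ r with rfl | ⟨r, rfl⟩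
      · rw [zero_add] at ht ⊢
        obtain ⟨h3, h4⟩ := h1 t ht.symm
        obtain ⟨h5, h6⟩ := hu.one ht.symm
        intro i hi j hj
        rw [Num.lt_one_iff.1 hj]
        rcases eq_zero_or_succ i with rfl | ⟨i, rfl⟩
        · simp only [h3, h5, code_one]
        · rw [add_lt_add_iff_right, Num.lt_one_iff] at hi
          simp only [hi, zero_add, h4, h6, mat]
          refine (code_val ?_).symm
          refine hA _ ?_ _ ?_
          all_goals
            rw [ht, show t + 1 + (t + 1) = t + t + 1 + 1 by ring]
            first | exact Num.lt_add_one_iff.2 le_rfl | exact Num.lt_add_one_iff.2 le_self_add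
      · obtain ⟨B, P, hB, hP, hm⟩ := h2 (r + 1) t ⟨le_add_self, ht.symm⟩
        exact ((hu.pb_step hA ht.symm hB).2 P _ _ hP
          (ih le_add_self ((Num.lt_add_one_iff.2 le_rfl).le.trans hr))).1 hm
  exact key n hn le_rfl

theorem exists_pbCoeffs {n : M.Num} {A : M.Str} {u : M.Num → M.Num → DiffRing M.Str}
    (hu : IsCoeffTable n A u) (hA : IsMat (n + n) (n + n) A) : ∃ Q, PBCoeffs n A Q := by
  have := hu.coded fst snd
  obtain ⟨F, hF⟩ := exists_columns u (n + 1) (n + 1)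
  have hF' : ∀ r, r ≤ n → HasEntries (r + 1) 1 (row F r) fun i _ => u r i := fun r hr i hi =>
    hF r (Num.lt_add_one_iff.2 hr) i (hi.trans_le (by gcongr))
  refine ⟨row F n, F, fun t ht => ?_, fun r t ⟨hr, ht⟩ => ?_, rfl⟩
  · have h := hF' 1 (ht ▸ le_add_self)
    obtain ⟨h5, h6⟩ := hu.one ht
    rw [h 0 (add_pos one_pos one_pos) 0 one_pos, h 1 (Num.lt_add_one_iff.2 le_rfl) 0 one_pos]
    simp only [h5, h6, code_one, mat]
    refine ⟨trivial, code_val ?_⟩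
    · refine hA _ ?_ _ ?_
      all_goals
        rw [← ht, show t + 1 + (t + 1) = t + t + 1 + 1 by ring]
        first | exact Num.lt_add_one_iff.2 le_rfl | exact Num.lt_add_one_iff.2 le_self_add
  · have hd : t + t + (r + 1 + (r + 1)) ≤ n + n := by rw [← ht]; exact (by ring : _ = _).le
    have hrn : r + 1 ≤ n := ht ▸ le_add_self
    obtain ⟨B, hB⟩ := exists_block hA hd hd
    obtain ⟨⟨P, hP⟩, h⟩ := hu.pb_step hA ht hB
    exact ⟨B, P, hB, hP, (h P _ _ hP (hF' r ((Num.lt_add_one_iff.2 le_rfl).le.trans hrn))).2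
      (hF' (r + 1) hrn)⟩

theorem PairsCoeffs.hasEntries {n : M.Num} {A J Q : M.Str} {u : M.Num → M.Num → DiffRing M.Str}
    (hu : IsCoeffTable n A u) (hA : IsMat (n + n) (n + n) A)
    (hJ : HasEntries (n + n) (n + n) J jEntry) (hn : 1 ≤ n) (h : PairsCoeffs (n + n) A J Q) :
    HasEntries (n + 1) 1 Q fun i _ => u n i := by
  obtain ⟨G, h1, h2, rfl⟩ := h
  have := hu.coded
  -- The step from size `2r + 1` to `2r + 2`. Parity decides which of the two size alternatives of
  -- the formula holds.
  have even : ∀ r, r + 1 ≤ n → HasEntries (r + 1) 1 (row G (r + r + 1)) (fun i _ => u r i) →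
      HasEntries (r + 1 + 1) 1 (row G (r + r + 1 + 1)) fun i _ => u (r + 1) i := by
    intro r hr h
    obtain ⟨t, ht⟩ := Num.le_iff.1 hr
    have ht' : t + t + (r + r + 1 + 1) = n + n := by rw [ht]; ring
    obtain ⟨m, l, hml, A', J', T, hA', hJ', hT, hm⟩ := h2 (r + r + 1) (t + t) ⟨le_add_self, ht'⟩
    have e : r + r + 1 + 1 = (r + 1) + (r + 1) := by ring
    rcases hml with ⟨hm', rfl⟩ | ⟨hm', -⟩
    · obtain rfl := Num.double_inj (hm'.symm.trans e)
      exact ((hu.pairs_step_even hA hJ ht' hA' hJ').2 T _ _ hT h).1 hm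
    · exact absurd (e.symm.trans hm') Num.double_ne
  -- Induction over the odd sizes only: an even step advances the table by one stage, and the odd
  -- step after it preserves the vector.
  have odd : ∀ r, r + 1 ≤ n → HasEntries (r + 1) 1 (row G (r + r + 1)) fun i _ => u r i := fun r => by
    refine Coded.induction (P := fun r => r + 1 ≤ n →
      HasEntries (r + 1) 1 (row G (r + r + 1)) fun i _ => u r i) ?_ ?_ (fun r ih hr => ?_) r
    · unfold HasEntries; infer_instance
    · intro _ i hi j hj
      rw [zero_add] at hi
      simp only [Num.lt_one_iff.1 hi, Num.lt_one_iff.1 hj, add_zero, zero_add, h1, hu.zero, code_one]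
    · have hr' : r + 1 ≤ n := (Num.lt_add_one_iff.2 le_rfl).le.trans hr
      have h := even r hr' (ih hr')
      obtain ⟨t, ht⟩ := Num.le_iff.1 hr
      have ht' : t + t + 1 + (r + r + 1 + 1 + 1) = n + n := by rw [ht]; ring
      obtain ⟨m, l, hml, A', J', T, hA', hJ', hT, hm⟩ := h2 (r + r + 1 + 1) (t + t + 1)
        ⟨le_add_self, ht'⟩
      have e : r + r + 1 + 1 = (r + 1) + (r + 1) := by ring
      rw [e] at hml ht' hA' hJ' hT hm h
      rcases hml with ⟨hm', -⟩ | ⟨hm', rfl⟩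
      · exact absurd hm'.symm Num.double_ne
      · obtain rfl := Num.double_inj (add_right_cancel hm')
        exact ((hu.pairs_step_odd hA hJ ht' hA' hJ').2 T _ _ hT h).1 hm
  obtain ⟨r, rfl⟩ := (eq_zero_or_succ n).resolve_left (one_pos.trans_le hn).ne'
  have := even r le_rfl (odd r le_rfl)
  rwa [show r + r + 1 + 1 = (r + 1) + (r + 1) by ring] at this

theorem exists_pairsCoeffs {n : M.Num} {A J : M.Str} {u : M.Num → M.Num → DiffRing M.Str}
    (hu : IsCoeffTable n A u) (hA : IsMat (n + n) (n + n) A)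
    (hJ : HasEntries (n + n) (n + n) J jEntry) (hn : 1 ≤ n) : ∃ Q, PairsCoeffs (n + n) A J Q := by
  have hu' := hu.coded
  have := CodedNum.comp Num.half (fst : M.Num → M.Num)
  have := hu.coded (fun z => Num.half (fst z)) snd
  -- The array that the pairs algorithm has to produce: at size `s` the vector `u ⌊s/2⌋`.
  obtain ⟨G, hG⟩ := exists_columns (fun s => u (Num.half s)) (n + n + 1) (n + n + 1)
  have hG' : ∀ s r, s ≤ n + n → s = r + r ∨ s = r + r + 1 →
      HasEntries (r + 1) 1 (row G s) fun i _ => u r i := fun s r hs hr i hi => by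
    have hrs : r ≤ s := hr.elim (fun h => le_self_add.trans h.ge)
      fun h => (le_self_add.trans le_self_add).trans h.ge
    rw [Num.eq_half_iff.2 hr]
    exact hG s (Num.lt_add_one_iff.2 hs) i (hi.trans_le (by gcongr; exact hrs.trans hs))
  refine ⟨row G (n + n), G, ?_, fun s t ⟨hs, ht⟩ => ?_, rfl⟩
  · rw [hG' 1 0 (hn.trans le_self_add) (Or.inr (by rw [add_zero, zero_add])) 0
      (Num.lt_add_one_iff.2 le_rfl) 0 one_pos]
    simp only [hu.zero, code_one]
  · have hsn : s + 1 ≤ n + n := ht ▸ le_add_self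
    have hsn' : s ≤ n + n := le_self_add.trans hsn
    obtain ⟨A', hA'⟩ := exists_block hA ht.le ht.le
    obtain ⟨J', hJ'⟩ := exists_block hJ.isMat ht.le ht.le
    obtain ⟨r, rfl | rfl⟩ := exists_half s
    · obtain ⟨⟨T, hT⟩, h⟩ := hu.pairs_step_odd hA hJ ht hA' hJ'
      exact ⟨r, r + 1, Or.inr ⟨rfl, rfl⟩, A', J', T, hA', hJ', hT,
        (h T _ _ hT (hG' _ r hsn' (Or.inl rfl))).2 (hG' _ r hsn (Or.inr rfl))⟩
    · obtain ⟨⟨T, hT⟩, h⟩ := hu.pairs_step_even hA hJ ht hA' hJ'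
      have e : r + r + 1 + 1 = (r + 1) + (r + 1) := by ring
      exact ⟨r + 1, r + 1, Or.inl ⟨e, rfl⟩, A', J', T, hA', hJ', hT,
        (h T _ _ hT (hG' _ r hsn' (Or.inr rfl))).2 (hG' _ (r + 1) hsn (Or.inl e))⟩

end VSharp

theorem mainTheorem8 : Proves.{u, v} VSharpL
    (fAllN fun n => fAllS fun A => (fLe 1 n ∧ᶠ isSkew (dbl n) A) →ᶠ
      -- both vectors of coefficients exist
      (fExS fun Q => isPBCoeffs n A Q) ∧ᶠ
      (fExS fun J => isJ n J ∧ᶠ fExS fun Q' => isPairsCoeffs (dbl n) A J Q') ∧ᶠ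
      -- they are equal
      (fAllS fun J => fAllS fun Q => fAllS fun Q' =>
        (isJ n J ∧ᶠ isPBCoeffs n A Q ∧ᶠ isPairsCoeffs (dbl n) A J Q') →ᶠ
          isEqualColumn (n + 1) Q Q')).sentence := by
  intro M hM ν σ
  have : IsModel M := ⟨hM⟩
  simp (disch := first | omega |
      (simp only [nb_var, nb_add, nb_one, nb_dbl, sb_dbl, sb_var]; omega)) only
    [Fm.sentence, sat_fAllN, sat_fAllS, sat_fImp, sat_fAnd, sat_fLe, isSkew, sat_isMatrix, sat_fExS,
    sat_isPBCoeffs, sat_isJ, sat_isPairsCoeffs, sat_isEqualColumn, eval_var, eval_one, eval_dbl,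
    eval_add, Function.update_self, Function.update_of_ne]
  rintro n A ⟨hn, hA, -⟩
  obtain ⟨u, hu⟩ := exists_coeffTable n A
  refine ⟨exists_pbCoeffs hu hA, ?_, ?_⟩
  · obtain ⟨J, hJ⟩ := exists_hasEntries (M := M) jEntry (n + n) (n + n)
    exact ⟨J, jMat_iff.2 hJ, exists_pairsCoeffs hu hA hJ hn⟩
  · rintro J Q Q' ⟨hJ, hQ, hQ'⟩ i hi
    -- Any two computations, with any string representing J, agree with the last vector `u n` of the
    -- table.
    rw [hQ.hasEntries hu hA hn i hi 0 one_pos,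
      hQ'.hasEntries hu hA (jMat_iff.1 hJ) hn i hi 0 one_pos]
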